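/- Let $\mathcal C$ be a modular tensor category over $\mathbb C$ with braiding $c$, and let $(A,\mu,\iota,\Delta,\epsilon)$ be a strongly separable commutative Frobenius algebra in $\mathcal C$, i.e. $\mu\circ\Delta=\lambda\,\mathrm{id}_A$ with $\lambda\neq0$, normalized by $\epsilon\circ\iota=1$, with $\dim\mathrm{Hom}_{\mathcal C}(\mathbf 1,A)=1$ and trivial twist $\theta_A=\mathrm{id}_A$. Assume that $A$ is absorbing: $A\otimes A\cong A^{\oplus M}$ as $A$-modules for some $M\ge1$. Let $G=\mathrm{Aut}(A)$ be the group of algebra automorphisms of $A$. For $A$-modules $V_1,\dots,V_N$ ($N\ge1$), $1\le n\le N$ and $g\in G$ let $$W_n^g=\frac1{\dim_{\mathcal C}A}\,(\mathrm{id}_A\otimes\rho_n)\circ\big((\mathrm{id}_A\otimes g)\Delta\otimes\mathrm{id}\big)\quad\text{on }A\otimes V_1\otimes\dots\otimes V_N,$$ where $\rho_n$ moves the strand $A$ by the braiding past $V_1,\dots,V_{n-1}$ and lets it act on $V_n$. For $A$-modules $V,W$ let $V\otimes_AW$ be the image of the idempotent on $V\otimes W$ which is $(\dim_{\mathcal C}A)^{-1}$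 times: insert $\Delta\circ\iota$ between $V$ and $W$, let the left leg act on $V$ (after crossing $V$ by $c_{A,V}^{-1}$) and the right leg on $W$. Let $L$ be a set of representatives of the simple $A$-modules. (a) $G$ is finite, and for every $n$ $$W^g_nW^h_n=\delta_{g,h}W^g_n\ (g,h\in G),\qquad \sum_{g\in G}W^g_n=\mathrm{id},$$ and $[W^g_n,W^h_m]=0$ for all $n,m$ and $g,h$. If $\mathcal C$ is unitary, $\Delta=\mu^\dagger$, $\epsilon=\iota^\dagger$ and the modules $V_n$ are unitary, then $(W^g_n)^\dagger=W^g_n$. (b) For all $V\in L$ and $g\in G$ there are a unique $V'\in L$ and an isomorphism $u_g:V'\to V$ in $\mathcal C$ with $u_g\circ\rho_{V'}=\rho_V\circ(g\otimes u_g)$; it is unique up to a nonzero scalar. Fix such $u_g$, fix bases of the spaces $\mathrm{Hom}_A(U,V\otimes_AW)$ and $\mathrm{Hom}_A(A,A\otimes_AV)$ for $U,V,W\in L$, and the dual bases of $\mathrm{Hom}_A(V\otimes_AW,U)$ and $\mathrm{Hom}_A(A\otimes_AV,A)$. For $V_1,\dots,V_N\in L$ and $g_0,\dots,g_N\in G$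 let $u_{g_n}:V_n'\to V_n$, and set $$|g_0A;g_1V_1,\dots,g_NV_N;U;\alpha\rangle=(g_0\otimes u_{g_1}\otimes\dots\otimes u_{g_N})\circ t_{U,\alpha},$$ where $t_{U,\alpha}\in\mathrm{Hom}_A(A,A\otimes_AV_1'\otimes_A\dots\otimes_AV_N')$ is the fusion tree with intermediate charges $U_1,\dots,U_{N-1}\in L$ ($U_k$ the charge of $V'_1,\dots,V'_{k+1}$) and basis elements $\alpha$ of $\mathrm{Hom}_A(U_k,U_{k-1}\otimes_AV'_{k+1})$ ($U_0=V_1'$) and $\mathrm{Hom}_A(A,A\otimes_AU_{N-1})$ at the vertices. Then: (c) These states are simultaneous eigenvectors of all $W_n^h$ (acting by composition): $W_n^{h}|g_0A;g_1V_1,\dots;U;\alpha\rangle$ is $|g_0A;g_1V_1,\dots;U;\alpha\rangle$ if $h=g_ng_0^{-1}$ and is $0$ otherwise. (d) For fixed $V_1,\dots,V_N$ the states, labelled by $g_0,\dots,g_N$, $U$ and $\alpha$, form a basis of $\mathrm{Hom}_{\mathcal C}(A,A\otimes V_1\otimes\dots\otimes V_N)$. It is orthonormal: with $\langle x|:A\otimes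 V_1\otimes\dots\otimes V_N\to A$ the mirrored diagram of $|x\rangle$ (dual basis elements at the vertices, $g_0^{-1}$ and $u_{g_n}^{-1}$), $(\dim_{\mathcal C}A)^{-1}\,\mathrm{tr}(\langle x|\circ|y\rangle)=\delta_{x,y}$. If moreover $\mathcal C$ is unitary and $A$ ($\Delta=\mu^\dagger$, $\epsilon=\iota^\dagger$), the modules in $L$, the $u_g$ and the bases ($\beta^\dagger\circ\alpha=\delta_{\alpha\beta}\,\mathrm{id}$) are chosen unitary, then the states are orthonormal for the inner product $\langle\varphi,\psi\rangle=(\dim_{\mathcal C}A)^{-1}\,\mathrm{tr}(\varphi^\dagger\circ\psi)$. -/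

import Mathlib

open CategoryTheory MonoidalCategory

universe w v u

namespace Condensate

noncomputable section

/-! ### Modular tensor categories over `ℂ` -/

/-- A ribbon structure on a braided rigid category: a natural automorphism of the identity functor
(the twist), balanced with respect to the braiding and compatible with duals. -/
class RibbonCategory (C : Type u) [Category.{v} C] [MonoidalCategory C] [BraidedCategory C]
    [RigidCategory C] where
  /-- the twist -/
  twist : 𝟭 C ≅ 𝟭 C
  twist_tensor : ∀ X Y : C, (twist.hom.app (X ⊗ Y) : X ⊗ Y ⟶ X ⊗ Y) =
    ((twist.hom.app X : X ⟶ X) ⊗ₘ (twist.hom.app Y : Y ⟶ Y)) ≫ (β_ X Y).hom ≫ (β_ Y X).hom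
  twist_dual : ∀ X : C, (twist.hom.app (Xᘁ) : (Xᘁ) ⟶ (Xᘁ)) = ((twist.hom.app X : X ⟶ X)ᘁ)

/-- The twist `θ_X`. -/
def twist {C : Type u} [Category.{v} C] [MonoidalCategory C] [BraidedCategory C]
    [RigidCategory C] [RibbonCategory C] (X : C) : X ⟶ X :=
  (RibbonCategory.twist (C := C)).hom.app X

attribute [local instance] Abelian.hasFiniteBiproducts

/-- The remaining axioms of a modular tensor category over `ℂ` for an abelian `ℂ`-linear ribbon
category: finite-dimensional morphism spaces, simple unit, semisimplicity, finitely many simple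
objects, and nondegeneracy of the braiding (a simple object which braids trivially with everything
is the unit). -/
class ModularCategory (C : Type u) [Category.{v} C] [Abelian C] [Linear ℂ C] [MonoidalCategory C]
    [MonoidalPreadditive C] [MonoidalLinear ℂ C] [BraidedCategory C] [RigidCategory C]
    [RibbonCategory C] : Prop where
  finiteDimensional_hom : ∀ X Y : C, FiniteDimensional ℂ (X ⟶ Y)
  simple_unit : Simple (𝟙_ C)
  semisimple : ∀ X : C, ∃ (n : ℕ) (S : Fin n → C), (∀ i, Simple (S i)) ∧ Nonempty (X ≅ ⨁ S)
  finite_simple : ∃ (n : ℕ) (S : Fin n → C), ∀ X : C, Simple X → ∃ i, Nonempty (X ≅ S i)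
  nondegenerate : ∀ X : C, Simple X → (∀ Y : C, (β_ X Y).hom ≫ (β_ Y X).hom = 𝟙 (X ⊗ Y)) →
    Nonempty (X ≅ 𝟙_ C)

attribute [instance] ModularCategory.finiteDimensional_hom ModularCategory.simple_unit

section Modular

variable {C : Type u} [Category.{v} C] [Abelian C] [Linear ℂ C] [MonoidalCategory C]
  [MonoidalPreadditive C] [MonoidalLinear ℂ C] [BraidedCategory C] [RigidCategory C]
  [RibbonCategory C] [ModularCategory C]

/-- The identification `End(𝟙) = ℂ`. -/
def scalar (f : 𝟙_ C ⟶ 𝟙_ C) : ℂ :=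
  Classical.choose (endomorphism_simple_eq_smul_id ℂ f)

theorem scalar_smul (f : 𝟙_ C ⟶ 𝟙_ C) : scalar f • 𝟙 (𝟙_ C) = f :=
  Classical.choose_spec (endomorphism_simple_eq_smul_id ℂ f)

/-- The categorical (quantum) trace of an endomorphism in a ribbon category. -/
def qtrace {X : C} (f : X ⟶ X) : ℂ :=
  scalar (η_ X (Xᘁ) ≫ (f ≫ twist X) ▷ (Xᘁ) ≫ (β_ X (Xᘁ)).hom ≫ ε_ X (Xᘁ))

/-- The quantum dimension `dim_C X`. -/
def qdim (X : C) : ℂ := qtrace (𝟙 X)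

variable (C) in
/-- A unitary structure on a modular tensor category: an antilinear involution `f ↦ f†` reversing
composition and compatible with `⊗`, for which all structure isomorphisms are unitary and
`tr (f† ∘ f) > 0` for `f ≠ 0`. -/
structure UnitaryStructure where
  dag : ∀ {X Y : C}, (X ⟶ Y) → (Y ⟶ X)
  dag_dag : ∀ {X Y : C} (f : X ⟶ Y), dag (dag f) = f
  dag_id : ∀ X : C, dag (𝟙 X) = 𝟙 X
  dag_comp : ∀ {X Y Z : C} (f : X ⟶ Y) (g : Y ⟶ Z), dag (f ≫ g) = dag g ≫ dag f
  dag_add : ∀ {X Y : C} (f g : X ⟶ Y), dag (f + g) = dag f + dag g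
  dag_smul : ∀ {X Y : C} (c : ℂ) (f : X ⟶ Y), dag (c • f) = (starRingEnd ℂ c) • dag f
  dag_tensor : ∀ {X Y X' Y' : C} (f : X ⟶ Y) (g : X' ⟶ Y'), dag (f ⊗ₘ g) = dag f ⊗ₘ dag g
  dag_associator : ∀ X Y Z : C, dag (α_ X Y Z).hom = (α_ X Y Z).inv
  dag_leftUnitor : ∀ X : C, dag (λ_ X).hom = (λ_ X).inv
  dag_rightUnitor : ∀ X : C, dag (ρ_ X).hom = (ρ_ X).inv
  dag_braiding : ∀ X Y : C, dag (β_ X Y).hom = (β_ X Y).inv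
  dag_twist : ∀ X : C, twist X ≫ dag (twist X) = 𝟙 X
  qtrace_im : ∀ {X Y : C} (f : X ⟶ Y), (qtrace (f ≫ dag f)).im = 0
  qtrace_pos : ∀ {X Y : C} (f : X ⟶ Y), f ≠ 0 → 0 < (qtrace (f ≫ dag f)).re

/-! ### The condensate: the algebra `A` and its automorphism group -/

/-- `A` is a strongly separable commutative Frobenius algebra, with `ε ∘ ι = 1` as normalization,
with unique unit (`dim Hom(𝟙, A) = 1`) and with trivial twist. -/
structure IsCondensate (A : C) [MonObj A] [ComonObj A] : Prop where
  frobenius_left : A ◁ ComonObj.comul (X := A) ≫ (α_ A A A).inv ≫ MonObj.mul (X := A) ▷ A =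
    MonObj.mul (X := A) ≫ ComonObj.comul (X := A)
  frobenius_right : ComonObj.comul (X := A) ▷ A ≫ (α_ A A A).hom ≫ A ◁ MonObj.mul (X := A) =
    MonObj.mul (X := A) ≫ ComonObj.comul (X := A)
  comm : (β_ A A).hom ≫ MonObj.mul (X := A) = MonObj.mul (X := A)
  counit_unit : MonObj.one (X := A) ≫ ComonObj.counit (X := A) = 𝟙 (𝟙_ C)
  separable : ∃ c : ℂ, c ≠ 0 ∧ ComonObj.comul (X := A) ≫ MonObj.mul (X := A) = c • 𝟙 A
  haploid : Module.finrank ℂ (𝟙_ C ⟶ A) = 1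
  twist_eq : twist A = 𝟙 A

/-- `A` is absorbing: as a left `A`-module (via multiplication on the first factor), `A ⊗ A` is
a direct sum of `N ≥ 1` copies of `(A, μ)`; `e i` and `f i` are the projections and inclusions. -/
def IsAbsorbing (A : C) [MonObj A] : Prop :=
  ∃ (N : ℕ) (e : Fin N → (A ⊗ A ⟶ A)) (f : Fin N → (A ⟶ A ⊗ A)), 0 < N ∧
    (∀ i, (α_ A A A).inv ≫ MonObj.mul (X := A) ▷ A ≫ e i = A ◁ e i ≫ MonObj.mul (X := A)) ∧
    (∀ i, MonObj.mul (X := A) ≫ f i = A ◁ f i ≫ (α_ A A A).inv ≫ MonObj.mul (X := A) ▷ A) ∧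
    (∀ i, f i ≫ e i = 𝟙 A) ∧ (∀ i j, i ≠ j → f i ≫ e j = 0) ∧
    ∑ i, e i ≫ f i = 𝟙 (A ⊗ A)

theorem isMonHom_inv {A : C} [MonObj A] (f : A ≅ A) (hf : IsMonHom f.hom) : IsMonHom f.inv :=
  inferInstance

/-- The group `G = Aut(A)` of algebra automorphisms of `A`; `g * h` is the composite `g ∘ h`. -/
def algAut (A : C) [MonObj A] : Subgroup (Aut A) where
  carrier := {g | IsMonHom g.hom}
  one_mem' := inferInstanceAs (IsMonHom (𝟙 A))
  mul_mem' := by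
    intro g h hg hh
    have hg' : IsMonHom g.hom := hg
    have hh' : IsMonHom h.hom := hh
    exact inferInstanceAs (IsMonHom (h.hom ≫ g.hom))
  inv_mem' := by
    intro g hg
    exact isMonHom_inv g hg

/-! ### Modules and their relative tensor products -/

/-- The regular module `(A, μ)`. -/
def regularMod (A : C) [MonObj A] : Mod C A :=
  letI := ModObj.regular A
  ⟨A⟩

/-- The action `ρ : A ⊗ V ⟶ V` of a module. -/
def act {A : C} [MonObj A] (V : Mod C A) : A ⊗ V.X ⟶ V.X :=
  ModObj.smul (M := A) (X := V.X)

/-- Zero morphisms of modules, so that simple modules make sense. -/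
instance modHasZeroMorphisms (A : C) [MonObj A] : Limits.HasZeroMorphisms (Mod C A) where
  zero M N := ⟨Mod.Hom.mk' (0 : M.X ⟶ N.X) (by simp)⟩
  comp_zero := by
    intro X Y f Z
    apply Mod.hom_ext
    exact Limits.comp_zero
  zero_comp := by
    intro X Y Z f
    apply Mod.hom_ext
    exact Limits.zero_comp

variable {A : C} [MonObj A]

/-- The right action of `A` on a left module, by crossing `A` over to the left. -/
def rightAct (V : Mod C A) : V.X ⊗ A ⟶ V.X := (β_ A V.X).inv ≫ act V

variable [ComonObj A]

/-- The coaction `V ⟶ A ⊗ V`, `v ↦ e₁ ⊗ e₂ v` where `e₁ ⊗ e₂ = Δ(1)`. -/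
def coact (V : Mod C A) : V.X ⟶ A ⊗ V.X :=
  (λ_ V.X).inv ≫ (MonObj.one (X := A) ≫ ComonObj.comul (X := A)) ▷ V.X ≫ (α_ A A V.X).hom ≫
    A ◁ act V

/-- The idempotent on `V ⊗ W` whose image is `V ⊗_A W`:
`v ⊗ w ↦ (dim A)⁻¹ v e₁ ⊗ e₂ w` where `e₁ ⊗ e₂ = Δ(1)`. -/
def relIdem (V W : Mod C A) : V.X ⊗ W.X ⟶ V.X ⊗ W.X :=
  (qdim A)⁻¹ • (V.X ◁ coact W ≫ (α_ V.X A W.X).inv ≫ rightAct V ▷ W.X)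

/-- The action of `A` on `V ⊗ W` through `V`; it preserves `V ⊗_A W`, and is its module action. -/
def relAct (V W : Mod C A) : A ⊗ (V.X ⊗ W.X) ⟶ V.X ⊗ W.X :=
  (α_ A V.X W.X).inv ≫ act V ▷ W.X

/-- `Hom_A(U, V ⊗_A W)`, inside `Hom_C(U, V ⊗ W)`: the `A`-linear morphisms with values in the
image of the idempotent. -/
def fusionHom (U V W : Mod C A) : Submodule ℂ (U.X ⟶ V.X ⊗ W.X) where
  carrier := {f | f ≫ relIdem V W = f ∧ act U ≫ f = A ◁ f ≫ relAct V W}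
  zero_mem' := by simp
  add_mem' := by
    rintro f g ⟨hf, hf'⟩ ⟨hg, hg'⟩
    refine ⟨?_, ?_⟩
    · rw [Preadditive.add_comp, hf, hg]
    · rw [Preadditive.comp_add, hf', hg', MonoidalPreadditive.whiskerLeft_add,
        Preadditive.add_comp]
  smul_mem' := by
    rintro c f ⟨hf, hf'⟩
    refine ⟨?_, ?_⟩
    · rw [Linear.smul_comp, hf]
    · rw [Linear.comp_smul, hf', MonoidalLinear.whiskerLeft_smul, Linear.smul_comp]

/-- `f : V ⊗ W ⟶ U` represents an element of `Hom_A(V ⊗_A W, U)`. -/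
def IsSplitting (U V W : Mod C A) (f : V.X ⊗ W.X ⟶ U.X) : Prop :=
  relIdem V W ≫ f = f ∧ relAct V W ≫ f = A ◁ f ≫ act U

/-- A basis of `Hom_A(U, V ⊗_A W)` together with the dual family in `Hom_A(V ⊗_A W, U)`. -/
structure FusionBasis (U V W : Mod C A) where
  ι : Type
  basis : Module.Basis ι ℂ (fusionHom U V W)
  dual : ι → (V.X ⊗ W.X ⟶ U.X)
  dual_isSplitting : ∀ a, IsSplitting U V W (dual a)
  basis_dual_self : ∀ a, (basis a : U.X ⟶ V.X ⊗ W.X) ≫ dual a = 𝟙 U.X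
  basis_dual_ne : ∀ a b, a ≠ b → (basis a : U.X ⟶ V.X ⊗ W.X) ≫ dual b = 0

/-! ### The creation operators -/

/-- `X₀ ⊗ X₁ ⊗ … ⊗ Xₙ`, bracketed to the left. -/
def tensorFam : (n : ℕ) → (Fin (n + 1) → C) → C
  | 0, X => X 0
  | n + 1, X => tensorFam n (fun k => X k.castSucc) ⊗ X (Fin.last (n + 1))

/-- `f₀ ⊗ f₁ ⊗ … ⊗ fₙ`. -/
def tensorFamMap : (n : ℕ) → {X Y : Fin (n + 1) → C} → (∀ k, X k ⟶ Y k) →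
    (tensorFam n X ⟶ tensorFam n Y)
  | 0, _, _, f => f 0
  | n + 1, _, _, f => tensorFamMap n (fun k => f k.castSucc) ⊗ₘ f (Fin.last (n + 1))

/-- `A ⊗ (V₀ ⊗ … ⊗ Vₙ) ⟶ V₀ ⊗ … ⊗ Vₙ`: the strand `A` crosses `V₀, …, V_{k-1}` and acts on
`V_k`. -/
def actOn : (n : ℕ) → (V : Fin (n + 1) → Mod C A) → Fin (n + 1) →
    (A ⊗ tensorFam n (fun k => (V k).X) ⟶ tensorFam n (fun k => (V k).X))
  | 0, V, _ => act (V 0)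
  | n + 1, V, k => Fin.lastCases
      (motive := fun _ => A ⊗ tensorFam (n + 1) (fun k => (V k).X) ⟶
        tensorFam (n + 1) (fun k => (V k).X))
      ((α_ A (tensorFam n fun k => (V k.castSucc).X) (V (Fin.last (n + 1))).X).inv ≫
        (β_ A (tensorFam n fun k => (V k.castSucc).X)).hom ▷ (V (Fin.last (n + 1))).X ≫
        (α_ (tensorFam n fun k => (V k.castSucc).X) A (V (Fin.last (n + 1))).X).hom ≫
        (tensorFam n fun k => (V k.castSucc).X) ◁ act (V (Fin.last (n + 1))))
      (fun i => (α_ A (tensorFam n fun k => (V k.castSucc).X) (V (Fin.last (n + 1))).X).inv ≫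
        actOn n (fun k => V k.castSucc) i ▷ (V (Fin.last (n + 1))).X)
      k

/-- The operator `W_k^g` on `A ⊗ V₀ ⊗ … ⊗ Vₙ`: split off a copy of `A` from the reservoir with
the coproduct, apply `g` to it, and fuse it to the `k`-th particle; normalized by `dim A`. -/
def creation (n : ℕ) (V : Fin (n + 1) → Mod C A) (k : Fin (n + 1)) (g : algAut A) :
    A ⊗ tensorFam n (fun k => (V k).X) ⟶ A ⊗ tensorFam n (fun k => (V k).X) :=
  (qdim A)⁻¹ • ((ComonObj.comul (X := A) ≫ A ◁ g.1.hom) ▷ tensorFam n (fun k => (V k).X) ≫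
    (α_ A A (tensorFam n (fun k => (V k).X))).hom ≫ A ◁ actOn n V k)

/-! ### Coherent states -/

/-- A set of representatives, indexed by `J`, of the simple objects of `Rep A`. -/
structure SimpleModules (A : C) [MonObj A] (J : Type w) where
  M : J → Mod C A
  simple : ∀ j, Simple (M j)
  eq_of_iso : ∀ i j, Nonempty (M i ≅ M j) → i = j
  complete : ∀ X : Mod C A, Simple X → ∃ j, Nonempty (X ≅ M j)

/-- The defining property `u (a v) = g(a) u(v)` of the morphisms `u_g : V' ⟶ V`. -/
def IsEquivariant (g : algAut A) (V' V : Mod C A) (f : V'.X ⟶ V.X) : Prop :=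
  act V' ≫ f = (g.1.hom ⊗ₘ f) ≫ act V

variable {J : Type w}

/-- The choices entering the coherent states: for all `g` and `j` the representative
`V' = M (source g j)` with an isomorphism `u_g : V' ⟶ V = M j`, and bases at all vertices. -/
structure CoherentData (S : SimpleModules A J) where
  source : algAut A → J → J
  u : ∀ g j, (S.M (source g j)).X ≅ (S.M j).X
  u_equivariant : ∀ g j, IsEquivariant g (S.M (source g j)) (S.M j) (u g j).hom
  /-- bases of `Hom_A(M i, M j ⊗_A M k)` -/
  vertex : ∀ i j k : J, FusionBasis (S.M i) (S.M j) (S.M k)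
  /-- bases of `Hom_A(A, A ⊗_A M j)` -/
  root : ∀ j : J, FusionBasis (regularMod A) (regularMod A) (S.M j)

/-- Labels `(U₁, U₂, …; α₁, α₂, …)` of the fusion trees of total charge `j` of
`V₀ ⊗_A V₁ ⊗_A … ⊗_A Vₙ`: the charges of `V₀ ⊗_A … ⊗_A V_k` and basis elements at the vertices. -/
inductive FusionTree {S : SimpleModules A J} (D : CoherentData S) :
    (n : ℕ) → (Fin (n + 1) → J) → J → Type w
  | leaf (V : Fin 1 → J) : FusionTree D 0 V (V 0)
  | node {n : ℕ} (V : Fin (n + 2) → J) {i : J} (t : FusionTree D n (fun k => V k.castSucc) i)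
      (j : J) (a : (D.vertex j i (V (Fin.last (n + 1)))).ι) : FusionTree D (n + 1) V j

/-- The morphism `U ⟶ V₀ ⊗ … ⊗ Vₙ` given by a fusion tree. -/
def FusionTree.ket {S : SimpleModules A J} {D : CoherentData S} :
    {n : ℕ} → {V : Fin (n + 1) → J} → {j : J} → FusionTree D n V j →
      ((S.M j).X ⟶ tensorFam n (fun k => (S.M (V k)).X))
  | _, _, _, .leaf V => 𝟙 (S.M (V 0)).X
  | _, _, _, .node (n := n) (i := i) V t j a =>
      ((D.vertex j i (V (Fin.last (n + 1)))).basis a).1 ≫ t.ket ▷ (S.M (V (Fin.last (n + 1)))).X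

/-- The morphism `V₀ ⊗ … ⊗ Vₙ ⟶ U` given by the mirrored fusion tree with dual vertices. -/
def FusionTree.bra {S : SimpleModules A J} {D : CoherentData S} :
    {n : ℕ} → {V : Fin (n + 1) → J} → {j : J} → FusionTree D n V j →
      (tensorFam n (fun k => (S.M (V k)).X) ⟶ (S.M j).X)
  | _, _, _, .leaf V => 𝟙 (S.M (V 0)).X
  | _, _, _, .node (n := n) (i := i) V t j a =>
      t.bra ▷ (S.M (V (Fin.last (n + 1)))).X ≫ (D.vertex j i (V (Fin.last (n + 1)))).dual a

/-- The labels `(g₀; g₁, …, g_N; U; α)` of the coherent states of particles `V₁, …, V_N`,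
here with `N = n + 1` and particles numbered from `0`. -/
structure CoherentLabel {S : SimpleModules A J} (D : CoherentData S) (n : ℕ)
    (V : Fin (n + 1) → J) where
  g₀ : algAut A
  g : Fin (n + 1) → algAut A
  charge : J
  tree : FusionTree D n (fun k => D.source (g k) (V k)) charge
  root : (D.root charge).ι

/-- The coherent state `|g₀A; g₁V₁, …, g_N V_N; U; α⟩ : A ⟶ A ⊗ V₁ ⊗ … ⊗ V_N`: a fusion tree in
`Hom_A(A, A ⊗_A V'₁ ⊗_A … ⊗_A V'_N)` followed by `g₀ ⊗ u_{g₁} ⊗ … ⊗ u_{g_N}`. -/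
def CoherentLabel.ket {S : SimpleModules A J} {D : CoherentData S} {n : ℕ} {V : Fin (n + 1) → J}
    (x : CoherentLabel D n V) : A ⟶ A ⊗ tensorFam n (fun k => (S.M (V k)).X) :=
  ((D.root x.charge).basis x.root).1 ≫ A ◁ x.tree.ket ≫
    (x.g₀.1.hom ⊗ₘ tensorFamMap n (fun k => (D.u (x.g k) (V k)).hom))

/-- The dual coherent state `A ⊗ V₁ ⊗ … ⊗ V_N ⟶ A`, the mirror image of the coherent state. -/
def CoherentLabel.bra {S : SimpleModules A J} {D : CoherentData S} {n : ℕ} {V : Fin (n + 1) → J}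
    (x : CoherentLabel D n V) : A ⊗ tensorFam n (fun k => (S.M (V k)).X) ⟶ A :=
  (x.g₀.1.inv ⊗ₘ tensorFamMap n (fun k => (D.u (x.g k) (V k)).inv)) ≫ A ◁ x.tree.bra ≫
    (D.root x.charge).dual x.root

/-! ### The unitary setting -/

/-- `A` is a Frobenius algebra for the unitary structure: `Δ = μ†` and `ε = ι†`. -/
def IsUnitaryAlgebra (H : UnitaryStructure C) (A : C) [MonObj A] [ComonObj A] : Prop :=
  H.dag (MonObj.mul (X := A)) = ComonObj.comul (X := A) ∧
    H.dag (MonObj.one (X := A)) = ComonObj.counit (X := A)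

/-- A unitary module: `ρ†` is the coaction. -/
def IsUnitaryModule (H : UnitaryStructure C) (V : Mod C A) : Prop :=
  H.dag (act V) = coact V

/-- A basis of `Hom_A(U, V ⊗_A W)` which is orthonormal in the sense `β† ∘ α = δ_{αβ} id_U`. -/
def IsOrthonormalVertex (H : UnitaryStructure C) {U V W : Mod C A} (b : FusionBasis U V W) :
    Prop :=
  (∀ a, (b.basis a).1 ≫ H.dag (b.basis a).1 = 𝟙 U.X) ∧
    ∀ a c, a ≠ c → (b.basis a).1 ≫ H.dag (b.basis c).1 = 0

/-- All choices entering the coherent states are unitary: representatives of simple objects,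
the isomorphisms `u_g`, and the bases at the vertices. -/
structure IsUnitaryData (H : UnitaryStructure C) {S : SimpleModules A J} (D : CoherentData S) :
    Prop where
  modules : ∀ j, IsUnitaryModule H (S.M j)
  u : ∀ g j, H.dag (D.u g j).hom = (D.u g j).inv
  vertex : ∀ i j k, IsOrthonormalVertex H (D.vertex i j k)
  root : ∀ j, IsOrthonormalVertex H (D.root j)

/-- The inner product `⟨φ, ψ⟩ = (dim X)⁻¹ tr (φ† ∘ ψ)` on `Hom_C(X, Z)`. -/
def homInner (H : UnitaryStructure C) {X Z : C} (φ ψ : X ⟶ Z) : ℂ :=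
  (qdim X)⁻¹ * qtrace (ψ ≫ H.dag φ)

end Modular

end

end Condensate

/-! The operators $W_k^g$ are $(\dim A)^{-1}$ times `cofree (g ▷ X ≫ r)`, where $r$ is the action of
$A$ on the $k$-th particle: they are extensions along the coproduct for the comonad $A\otimes-$. As
$r$ is an action, composing two of them convolves the corresponding endomorphisms of $A$
(`cofree_map_action`). The projector relations therefore live in the convolution algebra
$\mathrm{End}(A)$: $g*h=\delta_{g,h}\,(\dim A)\,g$ for automorphisms (`conv_self`, `conv_eq_zero`),
and $(\dim A)^{-1}\sum_g g$ is the convolution unit $\iota\epsilon$ (`IsCondensate.sum_algAut`).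

Orthogonality: $g*h$ satisfies $(g*h)(ab)=g(a)\,(g*h)(b)$, so by $\dim\mathrm{Hom}(\mathbf 1,A)=1$
it is a multiple of $g$; convolution is commutative, so it is the same multiple of $h$.
Completeness: otherwise the ideal annihilated by all automorphisms is nonzero and contains a common
eigenvector of the commutative convolution algebra. The decomposition of $A\otimes A$ into copies of
$A$ shows that such an eigenvector is a multiple of an algebra endomorphism, which is invertible and
does not annihilate itself. Absorption also makes the double braiding of $A$ with itself trivial
(`braiding_self_of_isAbsorbing`); hence $A$ is cocommutative and the $W$ at different particles
commute.

Conjugation with $g_0\otimes u_{g_1}\otimes\dots\otimes u_{g_N}$ turns $W_k^h$ into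
$W_k^{g_k^{-1}hg_0}$ (`twistHom_creation`), and $W_k^1$ slides through a fusion tree to the
idempotent of $A\otimes_AU$ at its root, which fixes the root vertex. This gives the eigenvalues.

Orthonormality combines three mechanisms: distinct eigenvalues; equal ratios $g_kg_0^{-1}$ with
distinct $g_0$, where the overlap is a multiple of a nontrivial automorphism and those have trace
zero; and equal $g$'s, where Schur's lemma and the dual vertex bases decide. For spanning,
`semilinear_decomposition` splits a morphism into parts semilinear for the various $g_0$, the
resolutions $\sum_hW_k^h=\mathrm{id}$ split these into simultaneous eigenvectors, and after
untwisting a vector fixed by all $W_k^1$ is expanded in fusion trees (`FusionTree.mem_span`), by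
semisimplicity of the category of modules. In the unitary case automorphisms are unitary and dual
vertices are adjoints, so the mirrored states are the adjoint states. -/

set_option linter.unusedSectionVars false

namespace Condensate
noncomputable section

/-! ### Strands of the algebra to the left of an object -/

section Strands

open scoped MonObj ComonObj

variable {C : Type u} [Category.{v} C] [MonoidalCategory C]

section Mul

variable (A : C) [MonObj A]

/-- Multiplication of the two strands to the left of `X`. -/
def mulL (X : C) : A ⊗ (A ⊗ X) ⟶ A ⊗ X := (α_ A A X).inv ≫ μ[A] ▷ X

/-- Creation of a strand to the left of `X` with the unit. -/
def oneL (X : C) : X ⟶ A ⊗ X := (λ_ X).inv ≫ η[A] ▷ X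

variable {A} {X Y Z : C}

theorem mulL_naturality (f : X ⟶ Y) : A ◁ A ◁ f ≫ mulL A Y = mulL A X ≫ A ◁ f := by
  simp [mulL, ← whisker_exchange]

theorem oneL_naturality (f : X ⟶ Y) : f ≫ oneL A Y = oneL A X ≫ A ◁ f := by
  simp [oneL, ← whisker_exchange]

theorem mulL_assoc : A ◁ mulL A X ≫ mulL A X = mulL A (A ⊗ X) ≫ mulL A X := by
  have h : A ◁ (μ[A] ▷ X) ≫ (α_ A A X).inv ≫ μ[A] ▷ X =
      (α_ A (A ⊗ A) X).inv ≫ (A ◁ μ[A] ≫ μ[A]) ▷ X := by monoidal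
  simp only [mulL, MonoidalCategory.whiskerLeft_comp, Category.assoc, h, MonObj.mul_assoc_flip]
  monoidal

theorem oneL_mulL : oneL A (A ⊗ X) ≫ mulL A X = 𝟙 (A ⊗ X) := by
  have h : oneL A (A ⊗ X) ≫ mulL A X = ((λ_ A).inv ≫ η[A] ▷ A ≫ μ[A]) ▷ X := by
    simp only [oneL, mulL]; monoidal
  rw [h]; simp

theorem whiskerLeft_oneL_mulL : A ◁ oneL A X ≫ mulL A X = 𝟙 (A ⊗ X) := by
  have h : A ◁ oneL A X ≫ mulL A X = ((ρ_ A).inv ≫ A ◁ η[A] ≫ μ[A]) ▷ X := by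
    simp only [oneL, mulL]; monoidal
  rw [h]; simp

end Mul

section Comul

variable (A : C) [ComonObj A]

/-- Splitting the strand to the left of `X`. -/
def comulL (X : C) : A ⊗ X ⟶ A ⊗ (A ⊗ X) := Δ[A] ▷ X ≫ (α_ A A X).hom

/-- Absorbing the strand to the left of `X` with the counit. -/
def counitL (X : C) : A ⊗ X ⟶ X := ε[A] ▷ X ≫ (λ_ X).hom

variable {A} {X Y Z : C}

theorem comulL_naturality (f : X ⟶ Y) : A ◁ f ≫ comulL A Y = comulL A X ≫ A ◁ A ◁ f := by
  simp [comulL, whisker_exchange_assoc]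

theorem counitL_naturality (f : X ⟶ Y) : A ◁ f ≫ counitL A Y = counitL A X ≫ f := by
  simp [counitL, whisker_exchange_assoc]

theorem comulL_assoc : comulL A X ≫ comulL A (A ⊗ X) = comulL A X ≫ A ◁ comulL A X := by
  have h : comulL A X ≫ comulL A (A ⊗ X) =
      (Δ[A] ≫ Δ[A] ▷ A) ▷ X ⊗≫ 𝟙 (A ⊗ A ⊗ A ⊗ X) := by
    simp only [comulL]; monoidal
  have h' : comulL A X ≫ A ◁ comulL A X =
      (Δ[A] ≫ A ◁ Δ[A] ≫ (α_ A A A).inv) ▷ X ⊗≫ 𝟙 (A ⊗ A ⊗ A ⊗ X) := by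
    simp only [comulL]; monoidal
  rw [h, h', ComonObj.comul_assoc_flip]

theorem comulL_counitL : comulL A X ≫ counitL A (A ⊗ X) = 𝟙 (A ⊗ X) := by
  have h : comulL A X ≫ counitL A (A ⊗ X) = (Δ[A] ≫ ε[A] ▷ A ≫ (λ_ A).hom) ▷ X := by
    simp only [comulL, counitL]; monoidal
  rw [h]; simp

theorem comulL_whiskerLeft_counitL : comulL A X ≫ A ◁ counitL A X = 𝟙 (A ⊗ X) := by
  have h : comulL A X ≫ A ◁ counitL A X = (Δ[A] ≫ A ◁ ε[A] ≫ (ρ_ A).hom) ▷ X := by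
    simp only [comulL, counitL]; monoidal
  rw [h]; simp

end Comul

section Braid

variable [BraidedCategory C] (A : C)

/-- Crossing of the two strands to the left of `X`. -/
def braidL (X : C) : A ⊗ (A ⊗ X) ⟶ A ⊗ (A ⊗ X) :=
  (α_ A A X).inv ≫ (β_ A A).hom ▷ X ≫ (α_ A A X).hom

variable {A} {X Y Z : C}

theorem braidL_map (f g : A ⟶ A) :
    A ◁ f ▷ X ≫ g ▷ (A ⊗ X) ≫ braidL A X = braidL A X ≫ A ◁ g ▷ X ≫ f ▷ (A ⊗ X) := by
  have h : A ◁ f ▷ X ≫ g ▷ (A ⊗ X) ≫ braidL A X =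
      (α_ A A X).inv ≫ (A ◁ f ≫ g ▷ A ≫ (β_ A A).hom) ▷ X ≫ (α_ A A X).hom := by
    simp only [braidL]; monoidal
  have h' : braidL A X ≫ A ◁ g ▷ X ≫ f ▷ (A ⊗ X) =
      (α_ A A X).inv ≫ ((β_ A A).hom ≫ A ◁ g ≫ f ▷ A) ▷ X ≫ (α_ A A X).hom := by
    simp only [braidL]; monoidal
  rw [h, h', BraidedCategory.braiding_naturality_left,
    BraidedCategory.braiding_naturality_right_assoc, whisker_exchange]

end Braid

/-! ### Symmetric Frobenius algebras -/

/-- A commutative Frobenius algebra which centralizes itself. -/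
structure IsSymmFrobenius [BraidedCategory C] (A : C) [MonObj A] [ComonObj A] : Prop where
  frobenius_left : A ◁ Δ[A] ≫ (α_ A A A).inv ≫ μ[A] ▷ A = μ[A] ≫ Δ[A]
  frobenius_right : Δ[A] ▷ A ≫ (α_ A A A).hom ≫ A ◁ μ[A] = μ[A] ≫ Δ[A]
  comm : (β_ A A).hom ≫ μ[A] = μ[A]
  symm : (β_ A A).hom ≫ (β_ A A).hom = 𝟙 (A ⊗ A)

/-- The convolution product of endomorphisms of `A`. -/
def conv {A : C} [MonObj A] [ComonObj A] (φ ψ : A ⟶ A) : A ⟶ A := Δ[A] ≫ (φ ⊗ₘ ψ) ≫ μ[A]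

/-- The extension of `f : A ⊗ X ⟶ X` to `A ⊗ X` along the coproduct. -/
def cofree {A X Y : C} [ComonObj A] (f : A ⊗ X ⟶ Y) : A ⊗ X ⟶ A ⊗ Y := comulL A X ≫ A ◁ f

/-- Actions of `A` on an object. -/
structure IsAction {A X : C} [MonObj A] (r : A ⊗ X ⟶ X) : Prop where
  one : oneL A X ≫ r = 𝟙 X
  mul : mulL A X ≫ r = A ◁ r ≫ r

/-- Insertion of `Δ ∘ ι` to the left of an object, whose legs act by `r` and `s`. -/
def pairing {A X : C} [MonObj A] [ComonObj A] (r s : A ⊗ X ⟶ X) : X ⟶ X :=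
  oneL A X ≫ comulL A X ≫ A ◁ s ≫ r

/-- Commuting actions. -/
def ActionsCommute [BraidedCategory C] {A X : C} (r s : A ⊗ X ⟶ X) : Prop :=
  A ◁ r ≫ s = braidL A X ≫ A ◁ s ≫ r

theorem cofree_comp {A X Y Z : C} [ComonObj A] (f : A ⊗ X ⟶ Y) (g : A ⊗ Y ⟶ Z) :
    cofree f ≫ cofree g = cofree (cofree f ≫ g) := by
  simp only [cofree, Category.assoc, MonoidalCategory.whiskerLeft_comp]
  rw [reassoc_of% (comulL_naturality (A := A) f), reassoc_of% (comulL_assoc (A := A) (X := X))]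

theorem cofree_comp_whiskerLeft {A X Y Z : C} [ComonObj A] (f : A ⊗ X ⟶ Y) (g : Y ⟶ Z) :
    cofree f ≫ A ◁ g = cofree (f ≫ g) := by
  simp [cofree]

theorem comulL_map_mulL {A : C} [MonObj A] [ComonObj A] (φ ψ : A ⟶ A) (X : C) :
    comulL A X ≫ A ◁ (ψ ▷ X) ≫ φ ▷ (A ⊗ X) ≫ mulL A X = conv φ ψ ▷ X := by
  simp only [comulL, mulL, conv, tensorHom_def']
  monoidal

/-- Two successive actions of strands split off from the reservoir merge, by the action axiom, into
one strand that was split and multiplied again. The later operator acts on the first leg, hence the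
reversed order in `conv ψ φ`. -/
theorem cofree_map_action {A X : C} [MonObj A] [ComonObj A] {r : A ⊗ X ⟶ X} (hr : IsAction r)
    (φ ψ : A ⟶ A) :
    cofree (φ ▷ X ≫ r) ≫ cofree (ψ ▷ X ≫ r) = cofree (conv ψ φ ▷ X ≫ r) := by
  rw [cofree_comp]
  congr 1
  rw [cofree, ← comulL_map_mulL]
  simp only [Category.assoc, MonoidalCategory.whiskerLeft_comp, hr.mul]
  rw [whisker_exchange_assoc]

theorem IsAction.cofree_unit {A X : C} [MonObj A] [ComonObj A] {r : A ⊗ X ⟶ X}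
    (hr : IsAction r) : cofree ((ε[A] ≫ η[A]) ▷ X ≫ r) = 𝟙 (A ⊗ X) := by
  have h : (ε[A] ≫ η[A]) ▷ X = counitL A X ≫ oneL A X := by simp [counitL, oneL]
  rw [h, Category.assoc, hr.one, Category.comp_id, cofree, comulL_whiskerLeft_counitL]

section Frobenius

variable [BraidedCategory C] {A : C} [MonObj A] [ComonObj A] (hA : IsSymmFrobenius A) {X Y : C}

include hA

namespace IsSymmFrobenius

theorem comul_mulL : A ◁ comulL A X ≫ mulL A (A ⊗ X) = mulL A X ≫ comulL A X := by
  have h : A ◁ comulL A X ≫ mulL A (A ⊗ X) =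
      (α_ A A X).inv ≫ (A ◁ Δ[A] ≫ (α_ A A A).inv ≫ μ[A] ▷ A) ▷ X ≫ (α_ A A X).hom := by
    simp only [comulL, mulL]; monoidal
  rw [h, hA.frobenius_left, mulL, comulL, comp_whiskerRight, Category.assoc, Category.assoc]

theorem comulL_mul : comulL A (A ⊗ X) ≫ A ◁ mulL A X = mulL A X ≫ comulL A X := by
  have h : comulL A (A ⊗ X) ≫ A ◁ mulL A X =
      (α_ A A X).inv ≫ (Δ[A] ▷ A ≫ (α_ A A A).hom ≫ A ◁ μ[A]) ▷ X ≫ (α_ A A X).hom := by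
    simp only [comulL, mulL]; monoidal
  rw [h, hA.frobenius_right, mulL, comulL, comp_whiskerRight, Category.assoc, Category.assoc]

theorem braidL_mulL : braidL A X ≫ mulL A X = mulL A X := by
  simp [braidL, mulL, ← comp_whiskerRight, hA.comm]

theorem braidL_braidL : braidL A X ≫ braidL A X = 𝟙 _ := by
  simp [braidL, ← comp_whiskerRight_assoc, hA.symm]

theorem oneL_comulL_mul :
    oneL A (A ⊗ X) ≫ comulL A (A ⊗ X) ≫ A ◁ mulL A X = comulL A X := by
  rw [hA.comulL_mul, reassoc_of% (oneL_mulL (A := A) (X := X))]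

theorem mul_oneL_comulL :
    A ◁ (oneL A X ≫ comulL A X) ≫ mulL A (A ⊗ X) = comulL A X := by
  rw [MonoidalCategory.whiskerLeft_comp, Category.assoc, hA.comul_mulL,
    reassoc_of% (whiskerLeft_oneL_mulL (A := A) (X := X))]

/-- The Frobenius pairing $\epsilon\mu$ is nondegenerate: applying the copairing $\Delta\iota$ to
the paired morphism recovers it. -/
theorem comul_eq_of_pairing {Z : C} (f g : Z ⟶ A ⊗ X)
    (h : A ◁ f ≫ mulL A X ≫ counitL A X = A ◁ g ≫ mulL A X ≫ counitL A X) : f = g := by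
  have key : ∀ f : Z ⟶ A ⊗ X,
      oneL A Z ≫ comulL A Z ≫ A ◁ (A ◁ f ≫ mulL A X ≫ counitL A X) = f := by
    intro f
    simp only [MonoidalCategory.whiskerLeft_comp]
    rw [← reassoc_of% (comulL_naturality (A := A) f), ← reassoc_of% (oneL_naturality (A := A) f),
      reassoc_of% (hA.comulL_mul (X := X)), reassoc_of% (oneL_mulL (A := A) (X := X)),
      comulL_whiskerLeft_counitL, Category.comp_id]
  rw [← key f, h, key g]

theorem cocomm : Δ[A] ≫ (β_ A A).hom = Δ[A] := by
  apply hA.comul_eq_of_pairing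
  have e1 : A ◁ Δ[A] ≫ mulL A A ≫ counitL A A = μ[A] := by
    have := hA.frobenius_left
    simp only [mulL, counitL, Category.assoc]
    rw [reassoc_of% this]; simp
  have e2 : A ◁ (β_ A A).hom ≫ mulL A A ≫ counitL A A =
      (β_ A (A ⊗ A)).hom ≫ (α_ A A A).hom ≫ A ◁ (μ[A] ≫ ε[A]) ≫ (ρ_ A).hom := by
    have n : (μ[A] ≫ ε[A]) ▷ A ≫ (λ_ A).hom =
        (β_ (A ⊗ A) A).hom ≫ A ◁ (μ[A] ≫ ε[A]) ≫ (ρ_ A).hom := by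
      rw [← BraidedCategory.braiding_naturality_left_assoc, braiding_rightUnitor]
    have n' : A ◁ (μ[A] ≫ ε[A]) = A ◁ (β_ A A).hom ≫ A ◁ (μ[A] ≫ ε[A]) := by
      rw [← MonoidalCategory.whiskerLeft_comp, reassoc_of% hA.comm]
    have s : A ◁ (β_ A A).hom ≫ A ◁ (β_ A A).hom = 𝟙 _ := by
      rw [← MonoidalCategory.whiskerLeft_comp, hA.symm]; simp
    have l : A ◁ (β_ A A).hom ≫ mulL A A ≫ counitL A A =
        A ◁ (β_ A A).hom ≫ (α_ A A A).inv ≫ (μ[A] ≫ ε[A]) ▷ A ≫ (λ_ A).hom := by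
      simp [mulL, counitL]
    rw [l, n, BraidedCategory.braiding_tensor_left_hom, BraidedCategory.braiding_tensor_right_hom]
    simp only [Category.assoc, Iso.inv_hom_id_assoc]
    rw [reassoc_of% s]
    conv_lhs => rw [n']
    simp only [Category.assoc]
  rw [e1, MonoidalCategory.whiskerLeft_comp, Category.assoc, e2,
    BraidedCategory.braiding_naturality_right_assoc]
  have := hA.frobenius_right
  rw [MonoidalCategory.whiskerLeft_comp, Category.assoc, reassoc_of% this]
  simp [hA.comm]

theorem comulL_braidL : comulL A X ≫ braidL A X = comulL A X := by
  simp [comulL, braidL, ← comp_whiskerRight_assoc, hA.cocomm]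

theorem conv_comm (φ ψ : A ⟶ A) : conv φ ψ = conv ψ φ := by
  have h := BraidedCategory.braiding_naturality φ ψ
  rw [conv, conv, ← hA.comm, reassoc_of% h, reassoc_of% hA.cocomm, hA.comm]

theorem actionsCommute_self {r : A ⊗ X ⟶ X} (hr : IsAction r) : ActionsCommute r r := by
  rw [ActionsCommute, ← hr.mul, reassoc_of% (hA.braidL_mulL (X := X))]

theorem actionsCommute_symm {r s : A ⊗ X ⟶ X} (h : ActionsCommute r s) :
    ActionsCommute s r := by
  rw [ActionsCommute] at *
  rw [h, reassoc_of% (hA.braidL_braidL (X := X))]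

/-- Exchanging the two actions costs a crossing of the two strands of $A$, which is absorbed by
cocommutativity where they were split off. -/
theorem cofree_commute {r s : A ⊗ X ⟶ X} (h : ActionsCommute r s) (φ ψ : A ⟶ A) :
    cofree (φ ▷ X ≫ r) ≫ cofree (ψ ▷ X ≫ s) = cofree (ψ ▷ X ≫ s) ≫ cofree (φ ▷ X ≫ r) := by
  rw [ActionsCommute] at h
  rw [cofree_comp, cofree_comp]
  congr 1
  simp only [cofree, MonoidalCategory.whiskerLeft_comp, Category.assoc]
  rw [whisker_exchange_assoc, h,
    reassoc_of% (braidL_map (X := X) φ ψ), reassoc_of% (hA.comulL_braidL (X := X)),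
    ← whisker_exchange_assoc]

/-! ### The copairing $\Delta\iota$ acting through two commuting actions. -/

section Pairing

variable {r s : A ⊗ X ⟶ X}

/-- By the Frobenius relation, multiplying one leg of $\Delta(1)$ by $a$ gives $\Delta(a)$. -/
theorem whiskerLeft_pairing (hr : IsAction r) : A ◁ pairing r s ≫ r = cofree s ≫ r := by
  have h := hA.mul_oneL_comulL (X := X)
  simp only [MonoidalCategory.whiskerLeft_comp, Category.assoc] at h
  simp only [pairing, MonoidalCategory.whiskerLeft_comp, Category.assoc, cofree]
  rw [← hr.mul, reassoc_of% (mulL_naturality (A := A) s), reassoc_of% h]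

theorem cofree_comm (h : ActionsCommute r s) : cofree s ≫ r = cofree r ≫ s := by
  rw [ActionsCommute] at h
  rw [cofree, cofree, Category.assoc, Category.assoc, h,
    reassoc_of% (hA.comulL_braidL (X := X))]

theorem pairing_comm (h : ActionsCommute r s) : pairing r s = pairing s r := by
  have := hA.cofree_comm h
  simp only [cofree, Category.assoc] at this
  rw [pairing, this, pairing]

theorem action_pairing (h : ActionsCommute r s) (hr : IsAction r) :
    r ≫ pairing r s = cofree s ≫ r := by
  rw [hA.pairing_comm h, pairing, hA.cofree_comm h, reassoc_of% (oneL_naturality (A := A) r),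
    reassoc_of% (comulL_naturality (A := A) r), ← MonoidalCategory.whiskerLeft_comp_assoc, ← hr.mul,
    MonoidalCategory.whiskerLeft_comp_assoc, reassoc_of% (hA.oneL_comulL_mul (X := X)), cofree,
    Category.assoc]

/-- This converts being fixed by the creation operators of two particles into being fixed by the
idempotent of their relative tensor product; see `pairing_fixed`. -/
theorem cofree_cofree (h : ActionsCommute r s) (hr : IsAction r) :
    cofree r ≫ cofree s = cofree r ≫ A ◁ pairing r s := by
  rw [cofree_comp, cofree_comp_whiskerLeft, hA.action_pairing h hr, hA.cofree_comm h]

end Pairing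

end IsSymmFrobenius

end Frobenius

end Strands

end

end Condensate

namespace Condensate
noncomputable section

/-! ### Commuting operators -/

/-- As long as some operator is not scalar on $I$, one of its eigenspaces in $I$ is strictly smaller
and, by commutation, invariant under all the others. -/
theorem exists_common_eigenvector {ι V : Type*} [AddCommGroup V] [Module ℂ V]
    [FiniteDimensional ℂ V] (T : ι → Module.End ℂ V) (hT : ∀ i j, Commute (T i) (T j))
    (I : Submodule ℂ V) (hI : I ≠ ⊥) (inv : ∀ i, ∀ v ∈ I, T i v ∈ I) :
    ∃ v ∈ I, v ≠ 0 ∧ ∀ i, ∃ c : ℂ, T i v = c • v := by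
  induction h : Module.finrank ℂ I using Nat.strong_induction_on generalizing I with
  | _ n ih =>
    by_cases hs : ∀ i, ∃ c : ℂ, ∀ v ∈ I, T i v = c • v
    · obtain ⟨v, hv, hv0⟩ := Submodule.exists_mem_ne_zero_of_ne_bot hI
      exact ⟨v, hv, hv0, fun i => (hs i).imp fun c hc => hc v hv⟩
    · push Not at hs
      obtain ⟨i, hi⟩ := hs
      have : Nontrivial I := Submodule.nontrivial_iff_ne_bot.mpr hI
      obtain ⟨c, hc⟩ := Module.End.exists_eigenvalue ((T i).restrict (inv i))
      obtain ⟨v, hv⟩ := hc.exists_hasEigenvector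
      let J : Submodule ℂ V := I ⊓ LinearMap.ker (T i - c • LinearMap.id)
      have hJ : ∀ w, w ∈ J ↔ w ∈ I ∧ T i w = c • w := by
        intro w
        simp [J, sub_eq_zero]
      have hvJ : (v : V) ∈ J := by
        rw [hJ]
        exact ⟨v.2, by simpa using congrArg Subtype.val hv.apply_eq_smul⟩
      have hlt : J < I := by
        refine lt_of_le_of_ne inf_le_left fun e => ?_
        obtain ⟨w, hw, hne⟩ := hi c
        rw [← e, hJ] at hw
        exact hne hw.2
      obtain ⟨w, hw, h0, hw'⟩ := ih (Module.finrank ℂ J)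
        (h ▸ Submodule.finrank_lt_finrank_of_lt hlt) J
        (fun e => hv.2 (by rw [e] at hvJ; exact Subtype.ext ((Submodule.mem_bot ℂ).mp hvJ)))
        (fun j w hw => by
          rw [hJ] at hw ⊢
          refine ⟨inv j w hw.1, ?_⟩
          have := congrArg (· w) (hT i j).eq
          simp only [Module.End.mul_apply] at this
          rw [this, hw.2, map_smul])
        rfl
      exact ⟨w, (hlt.le hw), h0, hw'⟩

section Modular

open scoped MonObj ComonObj

variable {C : Type u} [Category.{v} C] [Abelian C] [Linear ℂ C] [MonoidalCategory C]
  [MonoidalPreadditive C] [MonoidalLinear ℂ C] [BraidedCategory C] [RigidCategory C]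
  [RibbonCategory C] [ModularCategory C]

variable {A : C} [MonObj A]

/-! ### Self-centralization and scalars -/

/-- Commutativity lets $\mu$ absorb the double braiding of $A$ with $A$. Since the module $A\otimes
A$ is a sum of copies of $(A,\mu)$, its action `mulL` absorbs the double braiding of $A$ with
$A\otimes A$; inserting the unit into the acted-on factor removes the product. -/
theorem braiding_self_of_isAbsorbing (comm : (β_ A A).hom ≫ μ[A] = μ[A]) (h : IsAbsorbing A) :
    (β_ A A).hom ≫ (β_ A A).hom = 𝟙 (A ⊗ A) := by
  obtain ⟨N, e, f, -, he, -, -, -, hef⟩ := h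
  have key : (β_ A (A ⊗ A)).hom ≫ (β_ (A ⊗ A) A).hom ≫ mulL A A = mulL A A := by
    have h1 : ∀ i, mulL A A ≫ e i = A ◁ e i ≫ μ[A] := fun i => by
      rw [mulL, Category.assoc]; exact he i
    rw [← Category.comp_id (mulL A A), ← hef, Preadditive.comp_sum, Preadditive.comp_sum,
      Preadditive.comp_sum]
    refine Finset.sum_congr rfl fun i _ => ?_
    rw [reassoc_of% (h1 i), ← BraidedCategory.braiding_naturality_left_assoc,
      ← BraidedCategory.braiding_naturality_right_assoc, reassoc_of% comm,
      reassoc_of% comm]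
  have h2 : A ◁ oneL A A ≫ (β_ A (A ⊗ A)).hom ≫ (β_ (A ⊗ A) A).hom =
      (β_ A A).hom ≫ (β_ A A).hom ≫ A ◁ oneL A A := by
    rw [BraidedCategory.braiding_naturality_right_assoc, BraidedCategory.braiding_naturality_left]
  rw [← Category.comp_id ((β_ A A).hom ≫ (β_ A A).hom), ← whiskerLeft_oneL_mulL, Category.assoc,
    ← reassoc_of% h2, key]

variable [ComonObj A]

theorem IsCondensate.isSymmFrobenius (hA : IsCondensate A) (h : IsAbsorbing A) :
    IsSymmFrobenius A :=
  ⟨hA.frobenius_left, hA.frobenius_right, hA.comm, braiding_self_of_isAbsorbing hA.comm h⟩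

namespace IsCondensate

variable (hA : IsCondensate A)

include hA

theorem one_ne_zero : η[A] ≠ 0 := fun h => by
  have := hA.counit_unit
  rw [h, Limits.zero_comp] at this
  exact (id_nonzero (𝟙_ C)) this.symm

theorem id_ne_zero : 𝟙 A ≠ 0 := fun h => by
  have := Category.comp_id η[A]
  rw [h, Limits.comp_zero] at this
  exact hA.one_ne_zero this.symm

theorem exists_eq_smul_one (f : 𝟙_ C ⟶ A) : ∃ s : ℂ, f = s • η[A] :=
  ((finrank_eq_one_iff_of_nonzero' _ hA.one_ne_zero).mp hA.haploid f).imp fun _ h => h.symm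

theorem smul_one_inj {s t : ℂ} (h : s • η[A] = t • η[A]) : s = t :=
  smul_left_injective ℂ hA.one_ne_zero h

/-- $h(a)=h(a\cdot1)=k(a)\,h(1)$, and $h(1)$ is a multiple of the unit. -/
theorem eq_smul_of_semilinear (k h : A ⟶ A) (H : μ[A] ≫ h = (k ⊗ₘ h) ≫ μ[A]) :
    ∃ s : ℂ, η[A] ≫ h = s • η[A] ∧ h = s • k := by
  obtain ⟨s, hs⟩ := hA.exists_eq_smul_one (η[A] ≫ h)
  refine ⟨s, hs, ?_⟩
  calc h = (ρ_ A).inv ≫ A ◁ η[A] ≫ μ[A] ≫ h := by simp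
    _ = (ρ_ A).inv ≫ (k ⊗ₘ (η[A] ≫ h)) ≫ μ[A] := by simp [H, tensorHom_def']
    _ = s • k := by simp [hs, MonoidalCategory.tensorHom_def]

/-- By the Frobenius relation $(\mathrm{id}\otimes f)\Delta$ is $A$-linear, hence a scalar; applying
$\epsilon$ to the remaining leg returns $f$. -/
theorem eq_smul_counit (f : A ⟶ 𝟙_ C) : ∃ s : ℂ, f = s • ε[A] := by
  obtain ⟨s, -, hs⟩ := hA.eq_smul_of_semilinear (𝟙 A) (Δ[A] ≫ A ◁ f ≫ (ρ_ A).hom) (by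
    rw [← reassoc_of% hA.frobenius_left, ← whisker_exchange_assoc]
    simp)
  refine ⟨s, ?_⟩
  have := hs =≫ ε[A]
  simp only [Category.assoc, Linear.smul_comp, Category.id_comp] at this
  rw [← this, ← rightUnitor_naturality, whisker_exchange_assoc]
  simp [← unitors_equal]

theorem counit_of_one (g : A ⟶ A) (hg : η[A] ≫ g = η[A]) : g ≫ ε[A] = ε[A] := by
  obtain ⟨s, hs⟩ := hA.eq_smul_counit (g ≫ ε[A])
  have h := hA.counit_unit
  have := η[A] ≫= hs
  rw [reassoc_of% hg, h, Linear.comp_smul, h] at this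
  have h1 : s = 1 := smul_left_injective ℂ (id_nonzero (𝟙_ C)) (by simpa using this.symm)
  rw [hs, h1, one_smul]

end IsCondensate

/-! ### The convolution algebra of endomorphisms -/

theorem conv_add (φ ψ χ : A ⟶ A) : conv φ (ψ + χ) = conv φ ψ + conv φ χ := by
  simp [conv, MonoidalCategory.tensorHom_def]

theorem conv_smul (c : ℂ) (φ ψ : A ⟶ A) : conv φ (c • ψ) = c • conv φ ψ := by
  simp [conv, MonoidalCategory.tensorHom_def]

theorem conv_unit (φ : A ⟶ A) : conv φ (ε[A] ≫ η[A]) = φ := by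
  simp [conv, MonoidalCategory.tensorHom_def', whisker_exchange_assoc]

/-- Convolution as a linear map. -/
def convLeft (φ : A ⟶ A) : (A ⟶ A) →ₗ[ℂ] (A ⟶ A) where
  toFun := conv φ
  map_add' := conv_add φ
  map_smul' c := conv_smul c φ

theorem conv_zero (φ : A ⟶ A) : conv φ 0 = 0 := map_zero (convLeft φ)

theorem conv_assoc (φ ψ χ : A ⟶ A) : conv (conv φ ψ) χ = conv φ (conv ψ χ) := by
  have h1 : conv (conv φ ψ) χ =
      (Δ[A] ≫ Δ[A] ▷ A) ≫ ((φ ⊗ₘ ψ) ⊗ₘ χ) ≫ (μ[A] ▷ A ≫ μ[A]) := by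
    simp only [conv, ← tensorHom_id, Category.assoc, tensorHom_comp_tensorHom_assoc,
      Category.id_comp, Category.comp_id]
  have h2 : conv φ (conv ψ χ) =
      (Δ[A] ≫ A ◁ Δ[A]) ≫ (φ ⊗ₘ (ψ ⊗ₘ χ)) ≫ (A ◁ μ[A] ≫ μ[A]) := by
    simp only [conv, ← id_tensorHom, Category.assoc, tensorHom_comp_tensorHom_assoc,
      Category.id_comp, Category.comp_id]
  rw [h1, h2, MonObj.mul_assoc, ComonObj.comul_assoc_flip]
  simp

/-! ### Quantum dimension and quantum traces on the algebra -/

theorem scalar_eq {f : 𝟙_ C ⟶ 𝟙_ C} {s : ℂ} (h : f = s • 𝟙 (𝟙_ C)) : scalar f = s :=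
  smul_left_injective ℂ (id_nonzero (𝟙_ C)) ((scalar_smul f).trans h)

theorem qtrace_smul {X : C} (s : ℂ) (f : X ⟶ X) : qtrace (s • f) = s * qtrace f := by
  apply scalar_eq
  rw [mul_smul, qtrace, scalar_smul]
  simp

theorem qtrace_zero {X : C} : qtrace (0 : X ⟶ X) = 0 := by
  simpa using qtrace_smul (0 : ℂ) (0 : X ⟶ X)

theorem qtrace_add {X : C} (f g : X ⟶ X) : qtrace (f + g) = qtrace f + qtrace g := by
  apply scalar_eq
  rw [add_smul, qtrace, qtrace, scalar_smul, scalar_smul]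
  simp

namespace IsCondensate

variable (hA : IsCondensate A)

include hA

theorem copairing_pairing_left :
    (λ_ A).inv ≫ (η[A] ≫ Δ[A]) ▷ A ≫ (α_ A A A).hom ≫ A ◁ (μ[A] ≫ ε[A]) ≫ (ρ_ A).hom =
      𝟙 A := by
  have := hA.frobenius_right
  rw [comp_whiskerRight, MonoidalCategory.whiskerLeft_comp, Category.assoc, Category.assoc,
    reassoc_of% this]
  simp

/-- The Frobenius form makes $A$ its own dual, so the trace can be closed with $\Delta\iota$ and
$\epsilon\mu$; trivial twist and commutativity remove the twist and the braiding from the loop. -/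
theorem qtrace_eq (φ : A ⟶ A) :
    qtrace φ • 𝟙 (𝟙_ C) = (η[A] ≫ Δ[A]) ≫ φ ▷ A ≫ μ[A] ≫ ε[A] := by
  -- The map to the dual defined by the Frobenius form; `h1` and `h2` say that it carries copairing
  -- and pairing to coevaluation and evaluation.
  let θ : A ⟶ Aᘁ := (ρ_ A).inv ≫ A ◁ η_ A (Aᘁ) ≫ (α_ A A (Aᘁ)).inv ≫
    (μ[A] ≫ ε[A]) ▷ (Aᘁ) ≫ (λ_ (Aᘁ)).hom
  have h1 : (η[A] ≫ Δ[A]) ≫ A ◁ θ = η_ A (Aᘁ) := by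
    have e : (η[A] ≫ Δ[A]) ≫ A ◁ θ = η_ A (Aᘁ) ≫
        ((λ_ A).inv ≫ (η[A] ≫ Δ[A]) ▷ A ≫ (α_ A A A).hom ≫ A ◁ (μ[A] ≫ ε[A]) ≫
          (ρ_ A).hom) ▷ (Aᘁ) := by
      calc (η[A] ≫ Δ[A]) ≫ A ◁ θ
          = 𝟙 _ ⊗≫ ((η[A] ≫ Δ[A]) ▷ 𝟙_ C ≫ (A ⊗ A) ◁ η_ A (Aᘁ)) ⊗≫
              A ◁ (μ[A] ≫ ε[A]) ▷ (Aᘁ) ⊗≫ 𝟙 _ := by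
            simp only [θ]; monoidal
        _ = 𝟙 _ ⊗≫ (𝟙_ C ◁ η_ A (Aᘁ) ≫ (η[A] ≫ Δ[A]) ▷ (A ⊗ (Aᘁ))) ⊗≫
              A ◁ (μ[A] ≫ ε[A]) ▷ (Aᘁ) ⊗≫ 𝟙 _ := by rw [whisker_exchange]
        _ = _ := by monoidal
    rw [e, hA.copairing_pairing_left]; simp
  have h2 : θ ▷ A ≫ ε_ A (Aᘁ) = μ[A] ≫ ε[A] := by
    have e : θ ▷ A ≫ ε_ A (Aᘁ) = 𝟙 _ ⊗≫ A ◁ (η_ A (Aᘁ) ▷ A ⊗≫ A ◁ ε_ A (Aᘁ)) ⊗≫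
        (μ[A] ≫ ε[A]) := by
      calc θ ▷ A ≫ ε_ A (Aᘁ)
          = 𝟙 _ ⊗≫ A ◁ η_ A (Aᘁ) ▷ A ⊗≫
              ((μ[A] ≫ ε[A]) ▷ ((Aᘁ) ⊗ A) ≫ 𝟙_ C ◁ ε_ A (Aᘁ)) ⊗≫ 𝟙 _ := by
            simp only [θ]; monoidal
        _ = 𝟙 _ ⊗≫ A ◁ η_ A (Aᘁ) ▷ A ⊗≫
              ((A ⊗ A) ◁ ε_ A (Aᘁ) ≫ (μ[A] ≫ ε[A]) ▷ 𝟙_ C) ⊗≫ 𝟙 _ := by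
            rw [whisker_exchange]
        _ = _ := by monoidal
    rw [e, ExactPairing.evaluation_coevaluation'']
    monoidal
  rw [qtrace, scalar_smul, hA.twist_eq, Category.comp_id, ← h1, Category.assoc,
    whisker_exchange_assoc, BraidedCategory.braiding_naturality_right_assoc, h2,
    reassoc_of% hA.comm]

theorem qtrace_conv (φ : A ⟶ A) :
    qtrace φ • 𝟙 (𝟙_ C) = η[A] ≫ conv φ (𝟙 A) ≫ ε[A] := by
  rw [hA.qtrace_eq, conv, tensorHom_id]
  simp

/-- Evaluating $\Delta\iota$ under $\epsilon\mu$ gives the separability constant on one side and the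
trace of the identity on the other. -/
theorem comul_mul : Δ[A] ≫ μ[A] = qdim A • 𝟙 A := by
  obtain ⟨c, -, hc⟩ := hA.separable
  rw [hc]
  congr 1
  have h := hA.qtrace_eq (𝟙 A)
  simp only [id_whiskerRight, Category.id_comp, Category.assoc, reassoc_of% hc, Linear.smul_comp,
    Linear.comp_smul, hA.counit_unit] at h
  exact (smul_left_injective ℂ (id_nonzero (𝟙_ C)) h).symm

theorem qdim_ne_zero : qdim A ≠ 0 := fun h => by
  obtain ⟨c, hc, hc'⟩ := hA.separable
  rw [hA.comul_mul, h, zero_smul] at hc'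
  exact hA.id_ne_zero ((smul_eq_zero_iff_right hc).mp hc'.symm)

/-! ### Algebra endomorphisms under convolution -/

theorem conv_self (g : A ⟶ A) [IsMonHom g] : conv g g = qdim A • g := by
  rw [conv, ← IsMonHom.mul_hom g, ← Category.assoc, hA.comul_mul]; simp

theorem mul_conv (g h : A ⟶ A) [IsMonHom g] :
    μ[A] ≫ conv g h = (g ⊗ₘ conv g h) ≫ μ[A] := by
  calc μ[A] ≫ conv g h = A ◁ Δ[A] ≫ (α_ A A A).inv ≫ (μ[A] ≫ g ⊗ₘ h) ≫ μ[A] := by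
        rw [conv, ← reassoc_of% hA.frobenius_left]
        simp only [MonoidalCategory.tensorHom_def, comp_whiskerRight, Category.assoc]
    _ = A ◁ Δ[A] ≫ (α_ A A A).inv ≫ ((g ⊗ₘ g) ⊗ₘ h) ≫ μ[A] ▷ A ≫ μ[A] := by
        simp only [← tensorHom_id, tensorHom_comp_tensorHom_assoc, Category.comp_id,
          IsMonHom.mul_hom]
    _ = _ := by
        rw [MonObj.mul_assoc, associator_naturality_assoc, Iso.inv_hom_id_assoc, conv]
        simp only [← id_tensorHom, tensorHom_comp_tensorHom_assoc, Category.comp_id,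
          Category.id_comp]

/-- The convolution is a multiple of $g$ and, by commutativity, of $h$; both factors are its value
at the unit. A nonzero common factor would force $g=h$. -/
theorem conv_eq_zero (hs : IsSymmFrobenius A) (g h : A ⟶ A) [IsMonHom g] [IsMonHom h]
    (hgh : g ≠ h) : conv g h = 0 := by
  obtain ⟨s, hs1, hs2⟩ := hA.eq_smul_of_semilinear _ _ (hA.mul_conv g h)
  obtain ⟨t, ht1, ht2⟩ := hA.eq_smul_of_semilinear _ _ (hA.mul_conv h g)
  rw [hs.conv_comm] at ht1 ht2
  have hst : s = t := hA.smul_one_inj (hs1.symm.trans ht1)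
  by_cases h0 : s = 0
  · rw [hs2, h0, zero_smul]
  · exact absurd (smul_right_injective _ h0 (hs2.symm.trans (hst ▸ ht2))) hgh

/-- The trace is $\epsilon(g*\mathrm{id})(1)$, so orthogonality to the identity automorphism
suffices. This serves both orthogonality of states and unitarity of automorphisms. -/
theorem qtrace_eq_zero (hs : IsSymmFrobenius A) (g : A ⟶ A) [IsMonHom g] (hg : g ≠ 𝟙 A) :
    qtrace g = 0 := by
  have h := hA.qtrace_conv g
  rw [hA.conv_eq_zero hs g (𝟙 A) hg, Limits.zero_comp, Limits.comp_zero] at h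
  exact (smul_eq_zero_iff_left (id_nonzero _)).mp h

/-- An algebra endomorphism preserves the nondegenerate Frobenius form, so its transpose $t$ is a
one-sided inverse; in the finite-dimensional algebra $\mathrm{End}(A)$ it is two-sided. -/
theorem isIso_of_isMonHom (g : A ⟶ A) [IsMonHom g] : IsIso g := by
  let t : A ⟶ A := (λ_ A).inv ≫ (η[A] ≫ Δ[A]) ▷ A ≫ (α_ A A A).hom ≫
    A ◁ (g ▷ A ≫ μ[A] ≫ ε[A]) ≫ (ρ_ A).hom
  have h1 : g ≫ t = 𝟙 A := by
    have e : g ≫ t = (λ_ A).inv ≫ (η[A] ≫ Δ[A]) ▷ A ≫ (α_ A A A).hom ≫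
        A ◁ ((g ⊗ₘ g) ≫ μ[A] ≫ ε[A]) ≫ (ρ_ A).hom := by
      simp only [t]
      rw [leftUnitor_inv_naturality_assoc, whisker_exchange_assoc,
        MonoidalCategory.tensorHom_def']
      simp
    rw [e, ← IsMonHom.mul_hom_assoc g, hA.counit_of_one g (IsMonHom.one_hom g)]
    exact hA.copairing_pairing_left
  have : FiniteDimensional ℂ (End A) := ModularCategory.finiteDimensional_hom A A
  have h2 : t ≫ g = 𝟙 A := by
    have h : End.of t * End.of g = 1 := h1
    have : IsNoetherianRing (End A) := IsNoetherianRing.of_finite ℂ _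
    exact mul_eq_one_comm.mp h
  exact ⟨t, h1, h2⟩

end IsCondensate

/-! ### Completeness of the automorphism group -/

/-- Expanding $1\otimes a=\sum_if_i(e_i(1\otimes a))$ and pairing the second factor with $b$ gives
$\epsilon(ab)1=\sum_i\varphi_i(a)\chi_i(b)$. Here $\varphi_i=e_i(1\otimes-)$, and $\chi_i$ pairs the
second leg of $f_i(1)$ with its argument. -/
theorem IsAbsorbing.exists_dual_bases (h : IsAbsorbing A) :
    ∃ (N : ℕ) (φ χ : Fin N → (A ⟶ A)), μ[A] ≫ ε[A] ≫ η[A] = ∑ i, (φ i ⊗ₘ χ i) ≫ μ[A] := by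
  obtain ⟨N, e, f, -, he, hf, -, -, hef⟩ := h
  let r : Fin N → (𝟙_ C ⟶ A ⊗ A) := fun i => η[A] ≫ f i
  let χ : Fin N → (A ⟶ A) := fun i =>
    (λ_ A).inv ≫ r i ▷ A ≫ (α_ A A A).hom ≫ A ◁ (μ[A] ≫ ε[A]) ≫ (ρ_ A).hom
  have hr : ∀ i, f i = (ρ_ A).inv ≫ A ◁ r i ≫ (α_ A A A).inv ≫ μ[A] ▷ A := fun i => by
    rw [MonoidalCategory.whiskerLeft_comp, Category.assoc, ← hf i]
    simp
  have hχ : ∀ i, f i ▷ A ≫ (α_ A A A).hom ≫ A ◁ (μ[A] ≫ ε[A]) ≫ (ρ_ A).hom =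
      A ◁ χ i ≫ μ[A] := fun i => by
    calc f i ▷ A ≫ (α_ A A A).hom ≫ A ◁ (μ[A] ≫ ε[A]) ≫ (ρ_ A).hom
        = 𝟙 _ ⊗≫ A ◁ r i ▷ A ⊗≫ (μ[A] ▷ (A ⊗ A) ≫ A ◁ (μ[A] ≫ ε[A])) ⊗≫ 𝟙 _ := by
          rw [hr]; monoidal
      _ = 𝟙 _ ⊗≫ A ◁ r i ▷ A ⊗≫ ((A ⊗ A) ◁ (μ[A] ≫ ε[A]) ≫ μ[A] ▷ 𝟙_ C) ⊗≫ 𝟙 _ := by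
          rw [whisker_exchange]
      _ = A ◁ χ i ≫ μ[A] := by simp only [χ]; monoidal
  refine ⟨N, fun i => oneL A A ≫ e i, χ, ?_⟩
  calc μ[A] ≫ ε[A] ≫ η[A]
      = (oneL A A ≫ ∑ i, e i ≫ f i) ▷ A ≫ (α_ A A A).hom ≫ A ◁ (μ[A] ≫ ε[A]) ≫ (ρ_ A).hom := by
        have e : (oneL A A) ▷ A ≫ (α_ A A A).hom ≫ A ◁ (μ[A] ≫ ε[A]) ≫ (ρ_ A).hom =
            𝟙 _ ⊗≫ (η[A] ▷ (A ⊗ A) ≫ A ◁ (μ[A] ≫ ε[A])) ⊗≫ 𝟙 _ := by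
          simp only [oneL]; monoidal
        rw [hef, Category.comp_id, e, ← whisker_exchange]
        monoidal
    _ = ∑ i, (oneL A A ≫ e i) ▷ A ≫ f i ▷ A ≫ (α_ A A A).hom ≫ A ◁ (μ[A] ≫ ε[A]) ≫
          (ρ_ A).hom := by
        simp [Preadditive.comp_sum, Preadditive.sum_comp, sum_whiskerRight]
    _ = _ := by
        simp only [hχ, MonoidalCategory.tensorHom_def, Category.assoc]

/-- Frobenius gives $\psi(ab)=\psi(a_1)\,\epsilon(a_2b)$ for $\Delta(a)=a_1\otimes a_2$. By the dual
bases this is $\sum_i(\psi*\varphi_i)(a)\chi_i(b)=\psi(a)g(b)$, where the eigenvalues of $\psi$ are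
the coefficients of $g$. At $a=1$ it says that $\psi$ is a multiple of $g$, so $g$ is
multiplicative. -/
theorem IsCondensate.exists_isMonHom_of_eigenvector (hA : IsCondensate A) (h : IsAbsorbing A)
    (ψ : A ⟶ A) (h0 : ψ ≠ 0) (hψ : ∀ φ, ∃ c : ℂ, conv ψ φ = c • ψ) :
    ∃ (s : ℂ) (g : A ⟶ A), IsMonHom g ∧ ψ = s • g := by
  obtain ⟨N, φ, χ, hφ⟩ := h.exists_dual_bases
  choose c hc using hψ
  let g : A ⟶ A := ∑ i, c (φ i) • χ i
  have key : μ[A] ≫ ψ = (ψ ⊗ₘ g) ≫ μ[A] := by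
    calc μ[A] ≫ ψ = Δ[A] ▷ A ≫ (α_ A A A).hom ≫ (ψ ⊗ₘ (μ[A] ≫ ε[A] ≫ η[A])) ≫ μ[A] := by
          have := hA.frobenius_right
          rw [MonoidalCategory.tensorHom_def', MonoidalCategory.whiskerLeft_comp]
          simp only [Category.assoc]
          rw [reassoc_of% this]
          simp [whisker_exchange_assoc]
      _ = ∑ i, Δ[A] ▷ A ≫ (α_ A A A).hom ≫ (ψ ⊗ₘ ((φ i ⊗ₘ χ i) ≫ μ[A])) ≫ μ[A] := by
          rw [hφ]
          simp [MonoidalCategory.tensorHom_def, whiskerLeft_sum, Preadditive.comp_sum,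
            Preadditive.sum_comp]
      _ = ∑ i, (conv ψ (φ i) ⊗ₘ χ i) ≫ μ[A] := by
          refine Finset.sum_congr rfl fun i _ => ?_
          have e1 : (ψ ⊗ₘ ((φ i ⊗ₘ χ i) ≫ μ[A])) = (ψ ⊗ₘ (φ i ⊗ₘ χ i)) ≫ A ◁ μ[A] := by
            simp only [← id_tensorHom, tensorHom_comp_tensorHom, Category.comp_id]
          have e2 : (conv ψ (φ i) ⊗ₘ χ i) = Δ[A] ▷ A ≫ ((ψ ⊗ₘ φ i) ⊗ₘ χ i) ≫ μ[A] ▷ A := by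
            simp only [conv, ← tensorHom_id, tensorHom_comp_tensorHom, Category.comp_id,
              Category.id_comp]
          rw [e1, e2]
          simp only [Category.assoc, MonObj.mul_assoc]
          rw [associator_naturality_assoc]
      _ = _ := by
          simp [g, hc, MonoidalCategory.tensorHom_def, whiskerLeft_sum, Preadditive.comp_sum,
            Preadditive.sum_comp]
  obtain ⟨s, hs⟩ := hA.exists_eq_smul_one (η[A] ≫ ψ)
  have hψg : ψ = s • g := by
    calc ψ = (λ_ A).inv ≫ η[A] ▷ A ≫ μ[A] ≫ ψ := by simp
      _ = (λ_ A).inv ≫ ((η[A] ≫ ψ) ⊗ₘ g) ≫ μ[A] := by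
          rw [key]; simp [MonoidalCategory.tensorHom_def]
      _ = s • g := by simp [hs, MonoidalCategory.tensorHom_def']
  have hs0 : s ≠ 0 := fun e => h0 (by rw [hψg, e, zero_smul])
  refine ⟨s, g, ⟨?_, ?_⟩, hψg⟩
  · apply smul_right_injective _ hs0
    simpa only [hψg, Linear.comp_smul] using hs
  · apply smul_right_injective _ hs0
    simpa [hψg, MonoidalCategory.tensorHom_def] using key

theorem IsCondensate.linearIndependent_algAut (hA : IsCondensate A) (hs : IsSymmFrobenius A) :
    LinearIndependent ℂ (fun g : algAut A => g.1.hom) := by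
  classical
  rw [linearIndependent_iff']
  intro s a h g hg
  have hm : ∀ g : algAut A, IsMonHom g.1.hom := fun g => g.2
  have h1 := congrArg (convLeft g.1.hom) h
  have h2 : ∀ k ∈ s, k ≠ g → convLeft g.1.hom (a k • k.1.hom) = 0 := fun k _ hk => by
    rw [map_smul]
    have := hA.conv_eq_zero hs g.1.hom k.1.hom
      (fun e => hk (Subtype.ext (Iso.ext e)).symm)
    rw [show convLeft g.1.hom k.1.hom = 0 from this, smul_zero]
  rw [map_sum, map_zero, Finset.sum_eq_single g h2 (fun h => absurd hg h), map_smul,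
    show convLeft g.1.hom g.1.hom = _ from hA.conv_self g.1.hom, smul_smul] at h1
  have h3 : g.1.hom ≠ 0 := fun e => hA.id_ne_zero (by
    rw [← g.1.hom_inv_id, e, Limits.zero_comp])
  exact (mul_eq_zero_iff_right hA.qdim_ne_zero).mp ((smul_eq_zero_iff_left h3).mp h1)

theorem IsCondensate.finite_algAut (hA : IsCondensate A) (hs : IsSymmFrobenius A) :
    Finite (algAut A) :=
  (hA.linearIndependent_algAut hs).finite

theorem IsCondensate.sum_algAut (hA : IsCondensate A) (h : IsAbsorbing A)
    [Fintype (algAut A)] :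
    ∑ g : algAut A, (qdim A)⁻¹ • g.1.hom = ε[A] ≫ η[A] := by
  classical
  have hs := hA.isSymmFrobenius h
  have hm : ∀ g : algAut A, IsMonHom g.1.hom := fun g => g.2
  by_contra hne
  -- The ideal annihilated by all automorphisms; it contains the difference of the convolution unit
  -- and the normalized sum over $G$.
  let I : Submodule ℂ (A ⟶ A) := ⨅ g : algAut A, LinearMap.ker (convLeft g.1.hom)
  have hI : ∀ φ, φ ∈ I ↔ ∀ g : algAut A, conv g.1.hom φ = 0 := fun φ => by
    simp [I, convLeft]
  have hmem : (ε[A] ≫ η[A]) - ∑ g : algAut A, (qdim A)⁻¹ • g.1.hom ∈ I := by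
    rw [hI]
    intro g
    change convLeft g.1.hom _ = 0
    rw [map_sub, map_sum, Finset.sum_eq_single g]
    · rw [map_smul]
      change conv _ _ - (qdim A)⁻¹ • conv _ _ = 0
      rw [conv_unit, hA.conv_self, smul_smul, inv_mul_cancel₀ hA.qdim_ne_zero, one_smul, sub_self]
    · intro k _ hk
      rw [map_smul]
      have := hA.conv_eq_zero hs g.1.hom k.1.hom (fun e => hk (Subtype.ext (Iso.ext e)).symm)
      rw [show convLeft g.1.hom k.1.hom = 0 from this, smul_zero]
    · simp
  have hI0 : I ≠ ⊥ := fun e => by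
    rw [e, Submodule.mem_bot, sub_eq_zero] at hmem
    exact hne hmem.symm
  have hcomm : ∀ φ ψ χ : A ⟶ A, conv φ (conv ψ χ) = conv ψ (conv φ χ) := fun φ ψ χ => by
    rw [← conv_assoc, hs.conv_comm φ ψ, conv_assoc]
  obtain ⟨ψ, hψI, hψ0, hψ⟩ := exists_common_eigenvector (fun φ : A ⟶ A => convLeft φ)
    (fun φ ψ => LinearMap.ext fun χ => hcomm φ ψ χ) I hI0 (fun φ ψ hψ => by
      rw [hI] at hψ ⊢
      intro g
      change conv _ (conv φ ψ) = 0
      rw [hcomm, hψ g, conv_zero])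
  obtain ⟨s, g, hg, rfl⟩ := hA.exists_isMonHom_of_eigenvector h ψ hψ0
    (fun φ => (hψ φ).imp fun c hc => (hs.conv_comm _ _).trans hc)
  -- Now $g$ belongs to $G$, so $s\,g\in I$ gives $0=g*(s\,g)=s\,(\dim A)\,g$, contradicting
  -- $s\,g\ne0$.
  have := hA.isIso_of_isMonHom g
  have h1 := (hI _).mp hψI ⟨asIso g, hg⟩
  rw [conv_smul, asIso_hom, hA.conv_self] at h1
  have h2 : s • g ≠ 0 := hψ0
  rw [smul_comm] at h1
  exact h2 ((smul_eq_zero_iff_right hA.qdim_ne_zero).mp h1)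

/-! ### Actions on tensor products -/

section Cross

/-- The leftmost strand `A` crosses over `X`. -/
def crossL (A X Y : C) : A ⊗ (X ⊗ Y) ⟶ X ⊗ (A ⊗ Y) :=
  (α_ A X Y).inv ≫ (β_ A X).hom ▷ Y ≫ (α_ X A Y).hom

/-- The inverse crossing. -/
def crossLInv (A X Y : C) : X ⊗ (A ⊗ Y) ⟶ A ⊗ (X ⊗ Y) :=
  (α_ X A Y).inv ≫ (β_ A X).inv ▷ Y ≫ (α_ A X Y).hom

/-- The action on `X ⊗ Y` through `X`. -/
def actLeft {A X : C} (r : A ⊗ X ⟶ X) (Y : C) : A ⊗ (X ⊗ Y) ⟶ X ⊗ Y :=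
  (α_ A X Y).inv ≫ r ▷ Y

/-- The action on `X ⊗ Y` through `Y`. -/
def actRight {A Y : C} (X : C) (r : A ⊗ Y ⟶ Y) : A ⊗ (X ⊗ Y) ⟶ X ⊗ Y :=
  crossL A X Y ≫ X ◁ r

variable (B X Y : C)

theorem crossL_crossLInv : crossL B X Y ≫ crossLInv B X Y = 𝟙 _ := by
  simp [crossL, crossLInv, ← comp_whiskerRight_assoc]

variable {B X Y}

theorem crossL_naturality {Y' : C} (f : Y ⟶ Y') :
    B ◁ X ◁ f ≫ crossL B X Y' = crossL B X Y ≫ X ◁ B ◁ f := by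
  have h : crossL B X Y ≫ X ◁ B ◁ f =
      (α_ B X Y).inv ≫ ((β_ B X).hom ▷ Y ≫ (X ⊗ B) ◁ f) ≫ (α_ X B Y').hom := by
    simp only [crossL]; monoidal
  rw [h, ← whisker_exchange]
  simp only [crossL]; monoidal

theorem crossLInv_naturality {Y' : C} (f : Y ⟶ Y') :
    X ◁ B ◁ f ≫ crossLInv B X Y' = crossLInv B X Y ≫ B ◁ X ◁ f := by
  have h : crossLInv B X Y ≫ B ◁ X ◁ f =
      (α_ X B Y).inv ≫ ((β_ B X).inv ▷ Y ≫ (B ⊗ X) ◁ f) ≫ (α_ B X Y').hom := by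
    simp only [crossLInv]; monoidal
  rw [h, ← whisker_exchange]
  simp only [crossLInv]; monoidal

theorem crossL_naturality_left {X' : C} (f : X ⟶ X') :
    B ◁ f ▷ Y ≫ crossL B X' Y = crossL B X Y ≫ f ▷ (B ⊗ Y) := by
  have h : B ◁ f ▷ Y ≫ crossL B X' Y =
      (α_ B X Y).inv ≫ (B ◁ f ≫ (β_ B X').hom) ▷ Y ≫ (α_ X' B Y).hom := by
    simp only [crossL]; monoidal
  rw [h, BraidedCategory.braiding_naturality_right]
  simp only [crossL]; monoidal

theorem crossL_map {D : C} (f : B ⟶ D) :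
    f ▷ (X ⊗ Y) ≫ crossL D X Y = crossL B X Y ≫ X ◁ f ▷ Y := by
  have h : f ▷ (X ⊗ Y) ≫ crossL D X Y =
      (α_ B X Y).inv ≫ (f ▷ X ≫ (β_ D X).hom) ▷ Y ≫ (α_ X D Y).hom := by
    simp only [crossL]; monoidal
  rw [h, BraidedCategory.braiding_naturality_left]
  simp only [crossL]; monoidal

theorem crossL_crossL :
    A ◁ crossL A X Y ≫ crossL A X (A ⊗ Y) =
      (α_ A A (X ⊗ Y)).inv ≫ crossL (A ⊗ A) X Y ≫ X ◁ (α_ A A Y).hom := by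
  simp only [crossL, BraidedCategory.braiding_tensor_left_hom]
  monoidal

theorem crossL_oneL : oneL A (X ⊗ Y) ≫ crossL A X Y = X ◁ oneL A Y := by
  rw [oneL, Category.assoc, crossL_map, crossL, braiding_tensorUnit_left, oneL]
  monoidal

theorem crossL_mulL :
    mulL A (X ⊗ Y) ≫ crossL A X Y = A ◁ crossL A X Y ≫ crossL A X (A ⊗ Y) ≫ X ◁ mulL A Y := by
  rw [mulL, Category.assoc, crossL_map, reassoc_of% (crossL_crossL (A := A) (X := X) (Y := Y)),
    mulL]
  monoidal

theorem crossL_comulL :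
    comulL A (X ⊗ Y) ≫ A ◁ crossL A X Y ≫ crossL A X (A ⊗ Y) =
      crossL A X Y ≫ X ◁ comulL A Y := by
  rw [comulL, Category.assoc, crossL_crossL, Iso.hom_inv_id_assoc,
    reassoc_of% (crossL_map (X := X) (Y := Y) Δ[A]), comulL, MonoidalCategory.whiskerLeft_comp]

/-- The hexagon: passing $A\otimes X$ costs one additional crossing of two strands of $A$, exactly
the crossing in `ActionsCommute`. -/
theorem crossL_tensor :
    A ◁ (α_ A X Y).inv ≫ crossL A (A ⊗ X) Y =
      braidL A (X ⊗ Y) ≫ A ◁ crossL A X Y ≫ (α_ A X (A ⊗ Y)).inv := by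
  simp only [crossL, braidL, BraidedCategory.braiding_tensor_right_hom]
  monoidal

/-- The whole copairing passes $X$ freely because it is created from the unit; undoing the passage
of its left leg leaves an inverse braiding. This is the source of $c_{A,V}^{-1}$ in `relIdem`. -/
theorem crossL_pairing :
    oneL A (X ⊗ Y) ≫ comulL A (X ⊗ Y) ≫ A ◁ crossL A X Y =
      X ◁ (oneL A Y ≫ comulL A Y) ≫ crossLInv A X (A ⊗ Y) := by
  have h := oneL A (X ⊗ Y) ≫= (crossL_comulL (A := A) (X := X) (Y := Y))
  rw [reassoc_of% (crossL_oneL (A := A) (X := X) (Y := Y)),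
    ← MonoidalCategory.whiskerLeft_comp] at h
  rw [← h]
  simp [crossL_crossLInv]

theorem IsAction.actLeft {r : A ⊗ X ⟶ X} (hr : IsAction r) : IsAction (actLeft r Y) := by
  constructor
  · have h : oneL A (X ⊗ Y) ≫ Condensate.actLeft r Y = (oneL A X ≫ r) ▷ Y := by
      simp only [oneL, Condensate.actLeft]; monoidal
    rw [h, hr.one]; simp
  · have h : mulL A (X ⊗ Y) ≫ Condensate.actLeft r Y =
        A ◁ (α_ A X Y).inv ≫ (α_ A (A ⊗ X) Y).inv ≫ (mulL A X ≫ r) ▷ Y := by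
      simp only [mulL, Condensate.actLeft]; monoidal
    rw [h, hr.mul]
    simp only [Condensate.actLeft]; monoidal

theorem IsAction.actRight {r : A ⊗ Y ⟶ Y} (hr : IsAction r) : IsAction (actRight X r) := by
  constructor
  · rw [Condensate.actRight, reassoc_of% (crossL_oneL (A := A) (X := X) (Y := Y)),
      ← MonoidalCategory.whiskerLeft_comp, hr.one, MonoidalCategory.whiskerLeft_id]
  · simp only [Condensate.actRight, MonoidalCategory.whiskerLeft_comp, Category.assoc]
    rw [reassoc_of% (crossL_naturality (B := A) (X := X) r), ← MonoidalCategory.whiskerLeft_comp,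
      ← hr.mul, reassoc_of% (crossL_mulL (A := A) (X := X) (Y := Y)),
      MonoidalCategory.whiskerLeft_comp]

theorem actionsCommute_actLeft_actRight (r : A ⊗ X ⟶ X) (s : A ⊗ Y ⟶ Y) :
    ActionsCommute (actLeft r Y) (actRight X s) := by
  have e : A ◁ X ◁ s ≫ (α_ A X Y).inv ≫ r ▷ Y =
      (α_ A X (A ⊗ Y)).inv ≫ r ▷ (A ⊗ Y) ≫ X ◁ s := by
    rw [← whisker_exchange]; monoidal
  simp only [ActionsCommute, actRight, actLeft, MonoidalCategory.whiskerLeft_comp, Category.assoc]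
  rw [e, reassoc_of% (crossL_naturality_left (B := A) (Y := Y) r),
    reassoc_of% (crossL_tensor (A := A) (X := X) (Y := Y))]

theorem ActionsCommute.actLeft {r s : A ⊗ X ⟶ X} (h : ActionsCommute r s) (Y : C) :
    ActionsCommute (actLeft r Y) (actLeft s Y) := by
  have e : ∀ r s : A ⊗ X ⟶ X, A ◁ Condensate.actLeft r Y ≫ Condensate.actLeft s Y =
      A ◁ (α_ A X Y).inv ≫ (α_ A (A ⊗ X) Y).inv ≫ (A ◁ r ≫ s) ▷ Y := fun r s => by
    simp only [Condensate.actLeft]; monoidal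
  rw [ActionsCommute] at h
  rw [ActionsCommute, e, e, h]
  simp only [braidL]; monoidal

end Cross

/-! ### Module actions, relative idempotents and the action on a single particle. -/

theorem act_isAction (V : Mod C A) : IsAction (act V) := by
  constructor
  · rw [oneL, Category.assoc, act, ModObj.one_smul_self]; simp
  · rw [mulL, Category.assoc, act, ModObj.mul_smul_self]; simp

theorem coact_eq (V : Mod C A) : coact V = oneL A V.X ≫ comulL A V.X ≫ A ◁ act V := by
  simp [coact, oneL, comulL]

/-- With both legs starting to the left of $V\otimes W$, the idempotent becomes a `pairing` of two
commuting actions and the general lemmas apply. -/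
theorem relIdem_eq (V W : Mod C A) :
    relIdem V W = (qdim A)⁻¹ • pairing (actLeft (act V) W.X) (actRight V.X (act W)) := by
  rw [relIdem]
  congr 1
  have e : crossLInv A V.X W.X ≫ actLeft (act V) W.X =
      (α_ V.X A W.X).inv ≫ rightAct V ▷ W.X := by
    simp [crossLInv, actLeft, rightAct]
  rw [coact_eq, pairing, actRight, ← e]
  have h := crossL_pairing (A := A) (X := V.X) (Y := W.X)
  simp only [MonoidalCategory.whiskerLeft_comp, Category.assoc] at h ⊢
  rw [reassoc_of% h, reassoc_of% (crossLInv_naturality (B := A) (X := V.X) (act W))]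

theorem actOn_last (n : ℕ) (V : Fin (n + 2) → Mod C A) :
    actOn (n + 1) V (Fin.last (n + 1)) =
      actRight (tensorFam n fun k => (V k.castSucc).X) (act (V (Fin.last (n + 1)))) := by
  simp only [actOn, Fin.lastCases_last, actRight, crossL, Category.assoc]
  rfl

theorem actOn_castSucc (n : ℕ) (V : Fin (n + 2) → Mod C A) (k : Fin (n + 1)) :
    actOn (n + 1) V k.castSucc =
      actLeft (actOn n (fun k => V k.castSucc) k) (V (Fin.last (n + 1))).X := by
  simp only [actOn, Fin.lastCases_castSucc, actLeft]
  rfl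

theorem actOn_isAction : ∀ (n : ℕ) (V : Fin (n + 1) → Mod C A) (k : Fin (n + 1)),
    IsAction (actOn n V k)
  | 0, V, k => act_isAction (V 0)
  | n + 1, V, k => by
    induction k using Fin.lastCases with
    | last => rw [actOn_last]; exact (act_isAction _).actRight
    | cast k => rw [actOn_castSucc]; exact (actOn_isAction n _ k).actLeft

theorem actOn_commute (hs : IsSymmFrobenius A) :
    ∀ (n : ℕ) (V : Fin (n + 1) → Mod C A) (k l : Fin (n + 1)),
      ActionsCommute (actOn n V k) (actOn n V l)
  | 0, V, k, l => hs.actionsCommute_self (act_isAction (V 0))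
  | n + 1, V, k, l => by
    induction k using Fin.lastCases with
    | last =>
      induction l using Fin.lastCases with
      | last => exact hs.actionsCommute_self (actOn_isAction _ _ _)
      | cast l =>
        rw [actOn_castSucc, actOn_last]
        exact hs.actionsCommute_symm (actionsCommute_actLeft_actRight _ _)
    | cast k =>
      induction l using Fin.lastCases with
      | last =>
        rw [actOn_castSucc, actOn_last]
        exact actionsCommute_actLeft_actRight _ _
      | cast l =>
        rw [actOn_castSucc, actOn_castSucc]
        exact (actOn_commute hs n _ k l).actLeft _

/-! ### The creation operators -/

theorem creation_eq (n : ℕ) (V : Fin (n + 1) → Mod C A) (k : Fin (n + 1)) (g : algAut A) :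
    creation n V k g = (qdim A)⁻¹ •
      cofree (g.1.hom ▷ tensorFam n (fun k => (V k).X) ≫ actOn n V k) := by
  simp [creation, cofree, comulL]

section Creation

variable (hA : IsCondensate A) (n : ℕ) (V : Fin (n + 1) → Mod C A) (k l : Fin (n + 1))

include hA

theorem creation_idem (g : algAut A) : creation n V k g ≫ creation n V k g = creation n V k g := by
  have : IsMonHom g.1.hom := g.2
  rw [creation_eq, Linear.smul_comp, Linear.comp_smul, cofree_map_action (actOn_isAction n V k),
    hA.conv_self]
  simp only [MonoidalLinear.smul_whiskerRight, Linear.smul_comp, cofree,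
    MonoidalLinear.whiskerLeft_smul, Linear.comp_smul, inv_smul_smul₀ hA.qdim_ne_zero]

theorem creation_comp_of_ne (hs : IsSymmFrobenius A) {g h : algAut A} (hgh : g ≠ h) :
    creation n V k h ≫ creation n V k g = 0 := by
  have : IsMonHom g.1.hom := g.2
  have : IsMonHom h.1.hom := h.2
  rw [creation_eq, creation_eq, Linear.smul_comp, Linear.comp_smul,
    cofree_map_action (actOn_isAction n V k),
    hA.conv_eq_zero hs _ _ fun e => hgh (Subtype.ext (Iso.ext e))]
  simp [cofree]

theorem sum_creation (h : IsAbsorbing A) [Fintype (algAut A)] :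
    ∑ g : algAut A, creation n V k g = 𝟙 _ := by
  have h1 := (actOn_isAction n V k).cofree_unit
  rw [← hA.sum_algAut h] at h1
  rw [← h1]
  simp only [creation_eq, cofree, sum_whiskerRight, whiskerLeft_sum, Preadditive.sum_comp,
    Preadditive.comp_sum, MonoidalLinear.smul_whiskerRight, Linear.smul_comp,
    MonoidalLinear.whiskerLeft_smul, Linear.comp_smul]

omit hA in
theorem creation_comm (hs : IsSymmFrobenius A) (g h : algAut A) :
    creation n V k g ≫ creation n V l h = creation n V l h ≫ creation n V k g := by
  simp only [creation_eq, Linear.smul_comp, Linear.comp_smul]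
  rw [hs.cofree_commute (actOn_commute hs n V k l)]

end Creation

/-! ### Splitting of monomorphisms -/

attribute [local instance] Abelian.hasFiniteBiproducts in
-- A nonzero map from the simple unit into a sum of simples has a nonzero component, which is
-- invertible.
theorem exists_retraction_of_mono_unit {P : C} (i : 𝟙_ C ⟶ P) [Mono i] :
    ∃ r : P ⟶ 𝟙_ C, i ≫ r = 𝟙 _ := by
  obtain ⟨n, S, hS, ⟨e⟩⟩ := ModularCategory.semisimple P
  have hi : i ≠ 0 := fun h => id_nonzero (𝟙_ C) (by
    rw [← cancel_mono i, h, Limits.comp_zero, Limits.comp_zero])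
  have : ∃ j, i ≫ e.hom ≫ Limits.biproduct.π S j ≠ 0 := by
    by_contra hc
    push Not at hc
    apply hi
    rw [← cancel_mono e.hom, Limits.zero_comp]
    exact Limits.biproduct.hom_ext _ _ fun j => by simpa using hc j
  obtain ⟨j, hj⟩ := this
  have := hS j
  have := isIso_of_hom_simple hj
  exact ⟨e.hom ≫ Limits.biproduct.π S j ≫ inv (i ≫ e.hom ≫ Limits.biproduct.π S j), by
    simpa only [Category.assoc] using IsIso.hom_inv_id (i ≫ e.hom ≫ Limits.biproduct.π S j)⟩

/-- By rigidity a retraction of $f$ amounts to an extension of the evaluation of $Y$ along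
$Y^*\otimes f$. Pushing this monomorphism out along the evaluation reduces the extension to
splitting a monomorphism from the unit. -/
theorem exists_retraction_of_mono {X Y : C} (f : Y ⟶ X) [Mono f] :
    ∃ r : X ⟶ Y, f ≫ r = 𝟙 Y := by
  have : Limits.PreservesLimits (tensorLeft (Yᘁ)) :=
    (tensorLeftAdjunction (Yᘁ) ((Yᘁ)ᘁ)).rightAdjoint_preservesLimits
  have hm : Mono ((Yᘁ) ◁ f) := inferInstanceAs (Mono ((tensorLeft (Yᘁ)).map f))
  obtain ⟨r, hr⟩ := exists_retraction_of_mono_unit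
    (Limits.pushout.inr ((Yᘁ) ◁ f) (ε_ Y (Yᘁ)))
  have hs : (Yᘁ) ◁ f ≫ Limits.pushout.inl ((Yᘁ) ◁ f) (ε_ Y (Yᘁ)) ≫ r = ε_ Y (Yᘁ) := by
    rw [Limits.pushout.condition_assoc, hr, Category.comp_id]
  set s := Limits.pushout.inl ((Yᘁ) ◁ f) (ε_ Y (Yᘁ)) ≫ r
  refine ⟨(λ_ X).inv ≫ η_ Y (Yᘁ) ▷ X ≫ (α_ _ _ _).hom ≫ Y ◁ s ≫ (ρ_ Y).hom, ?_⟩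
  rw [leftUnitor_inv_naturality_assoc, whisker_exchange_assoc, associator_naturality_right_assoc,
    ← MonoidalCategory.whiskerLeft_comp_assoc, hs]
  simp

/-! ### Linear maps of modules -/

theorem hom_act {V W : Mod C A} (f : V ⟶ W) : act V ≫ f.hom = A ◁ f.hom ≫ act W :=
  IsModHom.smul_hom

/-- `A`-linear morphisms. -/
def IsLinear (V W : Mod C A) (f : V.X ⟶ W.X) : Prop := act V ≫ f = A ◁ f ≫ act W

/-- A linear morphism as a morphism of modules. -/
def IsLinear.toHom {V W : Mod C A} {f : V.X ⟶ W.X} (h : IsLinear V W f) : V ⟶ W :=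
  Mod.Hom.mk' f h

theorem hom_isLinear {V W : Mod C A} (f : V ⟶ W) : IsLinear V W f.hom := hom_act f

theorem IsLinear.comp {V W U : Mod C A} {f : V.X ⟶ W.X} {g : W.X ⟶ U.X} (hf : IsLinear V W f)
    (hg : IsLinear W U g) : IsLinear V U (f ≫ g) := by
  rw [IsLinear] at *
  rw [reassoc_of% hf, hg, MonoidalCategory.whiskerLeft_comp, Category.assoc]

theorem IsLinear.sub {V W : Mod C A} {f g : V.X ⟶ W.X} (hf : IsLinear V W f)
    (hg : IsLinear V W g) : IsLinear V W (f - g) := by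
  rw [IsLinear] at *
  have h : A ◁ (f - g) = A ◁ f - A ◁ g := (tensorLeft A).map_sub
  rw [Preadditive.comp_sub, hf, hg, h, Preadditive.sub_comp]

theorem IsLinear.smul {V W : Mod C A} {f : V.X ⟶ W.X} (hf : IsLinear V W f) (c : ℂ) :
    IsLinear V W (c • f) := by
  rw [IsLinear] at *
  simp [hf]

theorem isLinear_id (V : Mod C A) : IsLinear V V (𝟙 V.X) := by simp [IsLinear]

theorem IsLinear.inv {V W : Mod C A} {f : V.X ⟶ W.X} {g : W.X ⟶ V.X} (hf : IsLinear V W f)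
    (h1 : f ≫ g = 𝟙 _) (h2 : g ≫ f = 𝟙 _) : IsLinear W V g := by
  rw [IsLinear] at *
  calc act W ≫ g = A ◁ g ≫ (A ◁ f ≫ act W) ≫ g := by
        rw [Category.assoc, ← MonoidalCategory.whiskerLeft_comp_assoc, h2]; simp
    _ = A ◁ g ≫ act V := by rw [← hf, Category.assoc, h1, Category.comp_id]

/-- An object with an action as a module. -/
def IsAction.toMod {X : C} {r : A ⊗ X ⟶ X} (hr : IsAction r) : Mod C A :=
  letI : ModObj A X :=
    { smul := r
      one_smul := by
        have := hr.one
        rw [oneL, Category.assoc, Iso.inv_comp_eq, Category.comp_id] at this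
        exact this
      mul_smul := by
        have := hr.mul
        rw [mulL, Category.assoc, Iso.inv_comp_eq] at this
        exact this }
  ⟨X⟩

theorem mulL_isAction (X : C) : IsAction (mulL A X) := ⟨oneL_mulL, mulL_assoc.symm⟩

/-- Arbitrary morphisms $Z\to V$ of $\mathcal C$ are linear morphisms from the free module $A\otimes
Z$, on which the monomorphism of modules can be tested. -/
theorem mono_hom {V W : Mod C A} (f : V ⟶ W) [Mono f] : Mono f.hom := by
  constructor
  intro Z x y hxy
  have hl : ∀ x : Z ⟶ V.X, IsLinear (mulL_isAction (A := A) Z).toMod V (A ◁ x ≫ act V) := by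
    intro x
    change mulL A Z ≫ A ◁ x ≫ act V = A ◁ (A ◁ x ≫ act V) ≫ act V
    rw [MonoidalCategory.whiskerLeft_comp, Category.assoc, ← (act_isAction V).mul,
      ← reassoc_of% (mulL_naturality (A := A) x)]
  have h1 : (hl x).toHom = (hl y).toHom := by
    rw [← cancel_mono f]
    apply Mod.hom_ext
    change (A ◁ x ≫ act V) ≫ f.hom = (A ◁ y ≫ act V) ≫ f.hom
    rw [Category.assoc, Category.assoc, hom_act, ← MonoidalCategory.whiskerLeft_comp_assoc,
      ← MonoidalCategory.whiskerLeft_comp_assoc, hxy]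
  have h2 : A ◁ x ≫ act V = A ◁ y ≫ act V := congrArg Mod.Hom.hom h1
  have h3 := oneL A Z ≫= h2
  rw [← reassoc_of% (oneL_naturality (A := A) x), ← reassoc_of% (oneL_naturality (A := A) y),
    (act_isAction V).one, Category.comp_id, Category.comp_id] at h3
  exact h3

theorem mono_of_hom {V W : Mod C A} (f : V ⟶ W) [Mono f.hom] : Mono f :=
  ⟨fun _ _ h => Mod.hom_ext _ _ ((cancel_mono f.hom).mp (congrArg Mod.Hom.hom h))⟩

theorem isIso_of_hom {V W : Mod C A} (f : V ⟶ W) [IsIso f.hom] : IsIso f :=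
  ⟨((hom_isLinear f).inv (IsIso.hom_inv_id f.hom) (IsIso.inv_hom_id f.hom)).toHom,
    Mod.hom_ext _ _ (IsIso.hom_inv_id f.hom), Mod.hom_ext _ _ (IsIso.inv_hom_id f.hom)⟩

theorem isIso_hom {V W : Mod C A} (f : V ⟶ W) [IsIso f] : IsIso f.hom :=
  ⟨(inv f).hom, by rw [← Mod.comp_hom', IsIso.hom_inv_id, Mod.id_hom'],
    by rw [← Mod.comp_hom', IsIso.inv_hom_id, Mod.id_hom']⟩

theorem hom_ne_zero {V W : Mod C A} {f : V ⟶ W} : f.hom ≠ 0 ↔ f ≠ 0 :=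
  not_congr ⟨fun h => Mod.hom_ext _ _ h, fun h => by rw [h]; rfl⟩

theorem simple_iff (V : Mod C A) : Simple V ↔
    𝟙 V.X ≠ 0 ∧ ∀ (Y : Mod C A) (f : Y.X ⟶ V.X), IsLinear Y V f → Mono f → f ≠ 0 → IsIso f := by
  constructor
  · intro hV
    refine ⟨hom_ne_zero.mpr (id_nonzero V), fun Y f hf hm h0 => ?_⟩
    have : Mono hf.toHom.hom := hm
    have := mono_of_hom hf.toHom
    have h0' : hf.toHom ≠ 0 := hom_ne_zero.mp h0
    have := isIso_of_mono_of_nonzero h0'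
    exact isIso_hom hf.toHom
  · rintro ⟨h1, h2⟩
    refine ⟨fun {Y} f _ => ⟨fun hf h0 => h1 ?_, fun h0 => ?_⟩⟩
    · obtain ⟨s, -, hs⟩ := hf.out
      rw [h0, Limits.comp_zero] at hs
      exact (congrArg Mod.Hom.hom hs).symm
    · have := h2 Y f.hom (hom_isLinear f) (mono_hom f) (hom_ne_zero.mpr h0)
      exact isIso_of_hom f

theorem kernel_isAction {V W : Mod C A} {f : V.X ⟶ W.X} (hf : IsLinear V W f) :
    ∃ (K : Mod C A) (i : K.X ⟶ V.X), IsLinear K V i ∧ Mono i ∧ i ≫ f = 0 ∧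
      ∀ {Z : C} (h : Z ⟶ V.X), h ≫ f = 0 → ∃ l, l ≫ i = h := by
  have hk : (A ◁ Limits.kernel.ι f ≫ act V) ≫ f = 0 := by
    rw [Category.assoc, hf, ← MonoidalCategory.whiskerLeft_comp_assoc, Limits.kernel.condition]
    simp
  let r : A ⊗ Limits.kernel f ⟶ Limits.kernel f := Limits.kernel.lift f _ hk
  have hr : r ≫ Limits.kernel.ι f = A ◁ Limits.kernel.ι f ≫ act V := Limits.kernel.lift_ι _ _ _
  have ha : IsAction r := by
    constructor
    · rw [← cancel_mono (Limits.kernel.ι f), Category.assoc, hr,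
        ← reassoc_of% (oneL_naturality (A := A) (Limits.kernel.ι f)), (act_isAction V).one]
      simp
    · rw [← cancel_mono (Limits.kernel.ι f), Category.assoc, Category.assoc, hr,
        ← reassoc_of% (mulL_naturality (A := A) (Limits.kernel.ι f)), (act_isAction V).mul,
        ← MonoidalCategory.whiskerLeft_comp_assoc, ← MonoidalCategory.whiskerLeft_comp_assoc, hr]
  have hm : Mono (Limits.kernel.ι f) := inferInstance
  exact ⟨ha.toMod, Limits.kernel.ι f, hr, hm, Limits.kernel.condition f,
    fun h hh => ⟨Limits.kernel.lift f h hh, Limits.kernel.lift_ι _ _ _⟩⟩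

theorem IsLinear.isIso_of_ne_zero {V W : Mod C A} (hV : Simple V) (hW : Simple W)
    {f : V.X ⟶ W.X} (hf : IsLinear V W f) (h0 : f ≠ 0) : IsIso f := by
  obtain ⟨K, i, hi, him, hif, hl⟩ := kernel_isAction hf
  have hi0 : i = 0 := by
    by_contra hne
    have := ((simple_iff V).mp hV).2 K i hi him hne
    exact h0 (by rw [← cancel_epi i, hif, Limits.comp_zero])
  have hm : Mono f := Preadditive.mono_of_cancel_zero f fun h hh => by
    obtain ⟨l, hl⟩ := hl h hh
    rw [← hl, hi0, Limits.comp_zero]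
  exact ((simple_iff W).mp hW).2 V f hf hm h0

/-- Schur: for a spectral value $c$ the linear map $f-c$ is not invertible, hence zero. -/
theorem IsLinear.eq_smul_id {V : Mod C A} (hV : Simple V) {f : V.X ⟶ V.X} (hf : IsLinear V V f) :
    ∃ c : ℂ, f = c • 𝟙 V.X := by
  have hn : Nontrivial (End V.X) := nontrivial_of_ne _ _ ((simple_iff V).mp hV).1
  have : FiniteDimensional ℂ (End V.X) := ModularCategory.finiteDimensional_hom V.X V.X
  obtain ⟨c, hc⟩ := spectrum.nonempty_of_isAlgClosed_of_finiteDimensional ℂ (End.of f)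
  refine ⟨c, ?_⟩
  rw [spectrum.mem_iff, IsUnit.sub_iff, isUnit_iff_isIso, Algebra.algebraMap_eq_smul_one] at hc
  by_contra hne
  exact hc ((hf.sub ((isLinear_id V).smul c)).isIso_of_ne_zero hV hV (sub_ne_zero.mpr hne))

/-! ### Semisimplicity of the category of modules -/

namespace IsSymmFrobenius

variable (hs : IsSymmFrobenius A)

include hs

theorem act_coact (V : Mod C A) : act V ≫ coact V = cofree (act V) := by
  rw [coact_eq, reassoc_of% (oneL_naturality (A := A) (act V)),
    reassoc_of% (comulL_naturality (A := A) (act V)), ← MonoidalCategory.whiskerLeft_comp,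
    ← (act_isAction V).mul, MonoidalCategory.whiskerLeft_comp,
    reassoc_of% (hs.oneL_comulL_mul (X := V.X)), cofree]

theorem whiskerLeft_coact (V : Mod C A) : A ◁ coact V ≫ mulL A V.X = cofree (act V) := by
  have h := hs.mul_oneL_comulL (X := V.X)
  simp only [MonoidalCategory.whiskerLeft_comp, Category.assoc] at h
  rw [coact_eq]
  simp only [MonoidalCategory.whiskerLeft_comp, Category.assoc]
  rw [mulL_naturality, reassoc_of% h, cofree]

theorem isLinear_average (V W : Mod C A) (f : V.X ⟶ W.X) :
    IsLinear V W (coact V ≫ A ◁ f ≫ act W) := by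
  rw [IsLinear, reassoc_of% (hs.act_coact V)]
  simp only [MonoidalCategory.whiskerLeft_comp, Category.assoc]
  rw [← (act_isAction W).mul, reassoc_of% (mulL_naturality (A := A) f),
    reassoc_of% (hs.whiskerLeft_coact V)]

end IsSymmFrobenius

theorem IsCondensate.coact_act (hA : IsCondensate A) (V : Mod C A) :
    coact V ≫ act V = qdim A • 𝟙 V.X := by
  have h : comulL A V.X ≫ mulL A V.X = qdim A • 𝟙 _ := by
    rw [comulL, mulL, Category.assoc, Iso.hom_inv_id_assoc, ← comp_whiskerRight, hA.comul_mul]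
    simp
  rw [coact_eq, Category.assoc, Category.assoc, ← (act_isAction V).mul, reassoc_of% h]
  simp [(act_isAction V).one]

theorem coact_naturality {V W : Mod C A} {f : V.X ⟶ W.X} (hf : IsLinear V W f) :
    f ≫ coact W = coact V ≫ A ◁ f := by
  rw [IsLinear] at hf
  rw [coact_eq, coact_eq, reassoc_of% (oneL_naturality (A := A) f),
    reassoc_of% (comulL_naturality (A := A) f), ← MonoidalCategory.whiskerLeft_comp, ← hf]
  simp

/-- Maschke's argument: a retraction in $\mathcal C$ is averaged with $\Delta\iota$, and `coact_act`
supplies the normalization. -/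
theorem IsCondensate.exists_linear_retraction (hA : IsCondensate A) (hs : IsSymmFrobenius A)
    {V W : Mod C A} {f : V.X ⟶ W.X} (hf : IsLinear V W f) [Mono f] :
    ∃ r : W.X ⟶ V.X, IsLinear W V r ∧ f ≫ r = 𝟙 _ := by
  obtain ⟨r, hr⟩ := exists_retraction_of_mono f
  refine ⟨(qdim A)⁻¹ • (coact W ≫ A ◁ r ≫ act V), (hs.isLinear_average W V r).smul _, ?_⟩
  rw [Linear.comp_smul, reassoc_of% (coact_naturality hf),
    ← MonoidalCategory.whiskerLeft_comp_assoc, hr, MonoidalCategory.whiskerLeft_id,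
    Category.id_comp, hA.coact_act, inv_smul_smul₀ hA.qdim_ne_zero]

theorem finrank_end_lt {X Y : C} (i : Y ⟶ X) (p : X ⟶ Y) (h : i ≫ p = 𝟙 Y)
    (hne : ∀ f, p ≫ f ≫ i ≠ 𝟙 X) :
    Module.finrank ℂ (Y ⟶ Y) < Module.finrank ℂ (X ⟶ X) := by
  let T : (Y ⟶ Y) →ₗ[ℂ] (X ⟶ X) := Linear.leftComp ℂ X p ∘ₗ Linear.rightComp ℂ Y i
  have hT : ∀ f, T f = p ≫ f ≫ i := fun f => rfl
  have hinj : Function.Injective T := fun f g hfg => by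
    rw [hT, hT] at hfg
    have := i ≫= hfg =≫ p
    simpa [reassoc_of% h, h] using this
  rw [← LinearMap.finrank_range_of_inj hinj]
  apply Submodule.finrank_lt
  intro htop
  obtain ⟨f, hf⟩ := LinearMap.range_eq_top.mp htop (𝟙 X)
  exact hne f hf

/-- A nonzero module which is not simple is a sum of two linear direct summands with smaller
endomorphism spaces, so induction applies. Stating complete reducibility through factorizations of
the identity lets it be transported along linear maps. -/
theorem SimpleModules.id_mem_span {J : Type w} (S : SimpleModules A J) (hA : IsCondensate A)
    (hs : IsSymmFrobenius A) (V : Mod C A) :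
    𝟙 V.X ∈ Submodule.span ℂ {f : V.X ⟶ V.X | ∃ (j : J) (p : V.X ⟶ (S.M j).X)
      (q : (S.M j).X ⟶ V.X), IsLinear V (S.M j) p ∧ IsLinear (S.M j) V q ∧ f = p ≫ q} := by
  induction hn : Module.finrank ℂ (V.X ⟶ V.X) using Nat.strong_induction_on generalizing V with
  | _ n ih =>
    by_cases h0 : 𝟙 V.X = 0
    · rw [h0]; exact Submodule.zero_mem _
    by_cases hV : Simple V
    · obtain ⟨j, ⟨e⟩⟩ := S.complete V hV
      refine Submodule.subset_span ⟨j, e.hom.hom, e.inv.hom, hom_isLinear _, hom_isLinear _, ?_⟩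
      rw [← Mod.comp_hom', e.hom_inv_id, Mod.id_hom']
    rw [simple_iff] at hV
    push Not at hV
    obtain ⟨Y, f, hf, hm, hf0, hfi⟩ := hV h0
    obtain ⟨r, hr, hfr⟩ := hA.exists_linear_retraction hs hf
    -- The complement of $Y$ is the kernel of the retraction; $s$ will be the projection onto it.
    obtain ⟨Z, i, hi, him, hir, hl⟩ := kernel_isAction hr
    obtain ⟨s, hsi⟩ := hl (𝟙 V.X - r ≫ f) (by simp [hfr])
    have his : i ≫ s = 𝟙 Z.X := by
      rw [← cancel_mono i, Category.assoc, hsi]; simp [reassoc_of% hir]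
    have hfs : f ≫ s = 0 := by
      rw [← cancel_mono i, Category.assoc, hsi]; simp [reassoc_of% hfr]
    have hsl : IsLinear V Z s := by
      have h1 : IsLinear V V (s ≫ i) := by
        rw [hsi]; exact (isLinear_id V).sub (hr.comp hf)
      rw [IsLinear] at h1 hi ⊢
      rw [← cancel_mono i, Category.assoc, h1, Category.assoc, hi,
        MonoidalCategory.whiskerLeft_comp, Category.assoc]
    have transport : ∀ {W : Mod C A} {p : V.X ⟶ W.X} {q : W.X ⟶ V.X}, IsLinear V W p →
        IsLinear W V q → Module.finrank ℂ (W.X ⟶ W.X) < n →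
        p ≫ q ∈ Submodule.span ℂ {f : V.X ⟶ V.X | ∃ (j : J) (p : V.X ⟶ (S.M j).X)
          (q : (S.M j).X ⟶ V.X), IsLinear V (S.M j) p ∧ IsLinear (S.M j) V q ∧ f = p ≫ q} := by
      intro W p q hp hq hlt
      have h := Submodule.mem_map_of_mem
        (f := Linear.leftComp ℂ V.X p ∘ₗ Linear.rightComp ℂ W.X q) (ih _ hlt W rfl)
      rw [Submodule.map_span] at h
      have e : (Linear.leftComp ℂ V.X p ∘ₗ Linear.rightComp ℂ W.X q) (𝟙 W.X) = p ≫ q := by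
        simp
      rw [e] at h
      refine Submodule.span_mono ?_ h
      rintro _ ⟨_, ⟨j, p', q', hp', hq', rfl⟩, rfl⟩
      exact ⟨j, p ≫ p', q' ≫ q, hp.comp hp', hq'.comp hq, by simp⟩
    have e1 : 𝟙 V.X = r ≫ f + s ≫ i := by rw [hsi]; simp
    rw [e1]
    refine Submodule.add_mem _ (transport hr hf (hn ▸ finrank_end_lt f r hfr fun h hh => ?_))
      (transport hsl hi (hn ▸ finrank_end_lt i s his fun h hh => ?_))
    · refine hfi ⟨r, hfr, ?_⟩
      calc r ≫ f = r ≫ f ≫ (r ≫ h ≫ f) := by rw [hh, Category.comp_id]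
        _ = 𝟙 _ := by rw [reassoc_of% hfr, hh]
    · apply hf0
      rw [← Category.comp_id f, ← hh, reassoc_of% hfs, Limits.zero_comp]

/-! ### Twisting modules by automorphisms -/

theorem IsAction.twist {X : C} {r : A ⊗ X ⟶ X} (hr : IsAction r) (g : A ⟶ A) [IsMonHom g] :
    IsAction (g ▷ X ≫ r) := by
  constructor
  · have h : oneL A X ≫ g ▷ X = oneL A X := by
      rw [oneL, Category.assoc, ← comp_whiskerRight, IsMonHom.one_hom]
    rw [reassoc_of% h, hr.one]
  · have h : mulL A X ≫ g ▷ X = A ◁ g ▷ X ≫ g ▷ (A ⊗ X) ≫ mulL A X := by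
      have : mulL A X ≫ g ▷ X = (α_ A A X).inv ≫ (μ[A] ≫ g) ▷ X := by
        rw [mulL, comp_whiskerRight, Category.assoc]
      rw [this, IsMonHom.mul_hom, MonoidalCategory.tensorHom_def', mulL]
      monoidal
    rw [reassoc_of% h, hr.mul, MonoidalCategory.whiskerLeft_comp, Category.assoc,
      ← whisker_exchange_assoc]

theorem isEquivariant_iff (g : algAut A) (V W : Mod C A) (f : V.X ⟶ W.X) :
    IsEquivariant g V W f ↔ act V ≫ f = A ◁ f ≫ g.1.hom ▷ W.X ≫ act W := by
  rw [IsEquivariant, MonoidalCategory.tensorHom_def', Category.assoc]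

/-- The module `V` with the action twisted by `g`. -/
def twistMod (g : algAut A) (V : Mod C A) : Mod C A :=
  haveI : IsMonHom g.1.hom := g.2
  ((act_isAction V).twist g.1.hom).toMod

theorem algAut_inv_hom (g : algAut A) : g.1.inv ≫ g.1.hom = 𝟙 A := Iso.inv_hom_id g.1

theorem algAut_hom_inv (g : algAut A) : g.1.hom ≫ g.1.inv = 𝟙 A := Iso.hom_inv_id g.1

theorem simple_twistMod (g : algAut A) {V : Mod C A} (hV : Simple V) : Simple (twistMod g V) := by
  rw [simple_iff] at *
  refine ⟨hV.1, fun Y f hf hm h0 => hV.2 (twistMod g⁻¹ Y) f ?_ hm h0⟩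
  have key : ∀ f : Y.X ⟶ V.X, act Y ≫ f = A ◁ f ≫ g.1.hom ▷ V.X ≫ act V →
      (g.1.inv ▷ Y.X ≫ act Y) ≫ f = A ◁ f ≫ act V := fun f hf => by
    rw [Category.assoc, hf, ← whisker_exchange_assoc, ← comp_whiskerRight_assoc,
      algAut_inv_hom]
    simp
  exact key f hf

/-- Equivariant maps into $V$ are linear maps into `twistMod g V`, which is again simple; $V'$ is
its representative. -/
theorem SimpleModules.existsUnique_source {J : Type w} (S : SimpleModules A J) (g : algAut A)
    (j : J) : ∃! i : J, ∃ f : (S.M i).X ≅ (S.M j).X, IsEquivariant g (S.M i) (S.M j) f.hom := by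
  obtain ⟨i, ⟨e⟩⟩ := S.complete _ (simple_twistMod g (S.simple j))
  refine ⟨i, ⟨⟨e.inv.hom, e.hom.hom, congrArg Mod.Hom.hom e.inv_hom_id,
    congrArg Mod.Hom.hom e.hom_inv_id⟩, (isEquivariant_iff _ _ _ _).mpr ?_⟩, ?_⟩
  · exact hom_act e.inv
  rintro k ⟨f, hf⟩
  rw [isEquivariant_iff] at hf
  have hl : IsLinear (S.M k) (twistMod g (S.M j)) f.hom := hf
  have : IsIso hl.toHom.hom := inferInstanceAs (IsIso f.hom)
  have := isIso_of_hom hl.toHom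
  exact S.eq_of_iso _ _ ⟨asIso hl.toHom ≪≫ e⟩

theorem SimpleModules.equivariant_unique {J : Type w} (S : SimpleModules A J) (g : algAut A)
    (i j : J) (f f' : (S.M i).X ≅ (S.M j).X) (hf : IsEquivariant g (S.M i) (S.M j) f.hom)
    (hf' : IsEquivariant g (S.M i) (S.M j) f'.hom) : ∃ c : ℂ, c ≠ 0 ∧ f'.hom = c • f.hom := by
  rw [isEquivariant_iff] at hf hf'
  have h1 : IsLinear (S.M i) (twistMod g (S.M j)) f.hom := hf
  have h2 : IsLinear (S.M i) (twistMod g (S.M j)) f'.hom := hf'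
  obtain ⟨c, hc⟩ := (h2.comp (h1.inv f.hom_inv_id f.inv_hom_id)).eq_smul_id (S.simple i)
  refine ⟨c, ?_, ?_⟩
  · rintro rfl
    have h3 : f'.hom ≫ f.inv = 0 := hc.trans (zero_smul _ _)
    apply ((simple_iff _).mp (S.simple i)).1
    have := f'.inv ≫= h3
    rw [f'.inv_hom_id_assoc, Limits.comp_zero] at this
    rw [← f.hom_inv_id, this, Limits.comp_zero]
  · calc f'.hom = (f'.hom ≫ f.inv) ≫ f.hom := by simp
      _ = (c • 𝟙 _) ≫ f.hom := congrArg (· ≫ f.hom) hc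
      _ = c • f.hom := by simp

/-! ### Fusion vertices and fusion trees -/

section Vertex

variable (hA : IsCondensate A) (hs : IsSymmFrobenius A)

theorem relAct_isAction (V W : Mod C A) : IsAction (relAct V W) := (act_isAction V).actLeft

include hs

/-- Acting after the idempotent through either factor gives the same `cofree` expression, so on
$V\otimes_AW$ the two actions agree. Hence vertices, defined by linearity in the left factor, are
linear in the right one as well. -/
theorem whiskerLeft_relIdem (V W : Mod C A) :
    A ◁ relIdem V W ≫ relAct V W = A ◁ relIdem V W ≫ actRight V.X (act W) := by
  have hc : ActionsCommute (relAct V W) (actRight V.X (act W)) :=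
    actionsCommute_actLeft_actRight (act V) (act W)
  have h1 := hs.whiskerLeft_pairing (s := actRight V.X (act W)) (relAct_isAction V W)
  have h2 := hs.whiskerLeft_pairing (s := relAct V W) ((act_isAction W).actRight (X := V.X))
  rw [← hs.pairing_comm hc, ← hs.cofree_comm hc] at h2
  rw [relIdem_eq, MonoidalLinear.whiskerLeft_smul, Linear.smul_comp, Linear.smul_comp]
  exact congrArg _ (h1.trans h2.symm)

theorem relAct_relIdem (V W : Mod C A) :
    relAct V W ≫ relIdem V W = actRight V.X (act W) ≫ relIdem V W := by
  have hc : ActionsCommute (relAct V W) (actRight V.X (act W)) :=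
    actionsCommute_actLeft_actRight (act V) (act W)
  have h1 := hs.action_pairing hc (relAct_isAction V W)
  have h2 := hs.action_pairing (hs.actionsCommute_symm hc) ((act_isAction W).actRight (X := V.X))
  rw [← hs.pairing_comm hc, ← hs.cofree_comm hc] at h2
  rw [relIdem_eq, Linear.comp_smul, Linear.comp_smul]
  exact congrArg _ (h1.trans h2.symm)

theorem act_fusionHom {U V W : Mod C A} {f : U.X ⟶ V.X ⊗ W.X} (hf : f ∈ fusionHom U V W) :
    act U ≫ f = A ◁ f ≫ actRight V.X (act W) := by
  rw [hf.2, ← hf.1, MonoidalCategory.whiskerLeft_comp, Category.assoc, Category.assoc,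
    whiskerLeft_relIdem hs]

theorem act_splitting {U V W : Mod C A} {f : V.X ⊗ W.X ⟶ U.X} (hf : IsSplitting U V W f) :
    actRight V.X (act W) ≫ f = A ◁ f ≫ act U := by
  rw [← hf.2, ← hf.1, ← reassoc_of% (relAct_relIdem hs V W)]

omit hs

theorem actLeft_naturality {X X' Y : C} {r : A ⊗ X ⟶ X} {r' : A ⊗ X' ⟶ X'} {t : X ⟶ X'}
    (h : r ≫ t = A ◁ t ≫ r') : actLeft r Y ≫ t ▷ Y = A ◁ t ▷ Y ≫ actLeft r' Y := by
  have e : actLeft r Y ≫ t ▷ Y = (α_ A X Y).inv ≫ (r ≫ t) ▷ Y := by simp [actLeft]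
  rw [e, h, actLeft]; monoidal

theorem actRight_naturality {X X' Y : C} {s : A ⊗ Y ⟶ Y} (t : X ⟶ X') :
    actRight X s ≫ t ▷ Y = A ◁ t ▷ Y ≫ actRight X' s := by
  rw [actRight, actRight, Category.assoc, whisker_exchange,
    ← reassoc_of% (crossL_naturality_left (B := A) (Y := Y) t)]

theorem fusionHom_actLeft {U V W : Mod C A} {f : U.X ⟶ V.X ⊗ W.X} (hf : f ∈ fusionHom U V W)
    {X : C} {r : A ⊗ X ⟶ X} {t : V.X ⟶ X} (ht : act V ≫ t = A ◁ t ≫ r) :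
    act U ≫ f ≫ t ▷ W.X = A ◁ (f ≫ t ▷ W.X) ≫ actLeft r W.X := by
  rw [reassoc_of% hf.2, MonoidalCategory.whiskerLeft_comp, Category.assoc,
    ← actLeft_naturality ht, relAct, actLeft]

theorem splitting_actLeft {U V W : Mod C A} {f : V.X ⊗ W.X ⟶ U.X} (hf : IsSplitting U V W f)
    {X : C} {r : A ⊗ X ⟶ X} {t : X ⟶ V.X} (ht : r ≫ t = A ◁ t ≫ act V) :
    actLeft r W.X ≫ t ▷ W.X ≫ f = A ◁ (t ▷ W.X ≫ f) ≫ act U := by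
  rw [reassoc_of% (actLeft_naturality (Y := W.X) ht), MonoidalCategory.whiskerLeft_comp,
    Category.assoc, ← hf.2, relAct, actLeft]

include hs

theorem fusionHom_actRight {U V W : Mod C A} {f : U.X ⟶ V.X ⊗ W.X} (hf : f ∈ fusionHom U V W)
    {X : C} (t : V.X ⟶ X) :
    act U ≫ f ≫ t ▷ W.X = A ◁ (f ≫ t ▷ W.X) ≫ actRight X (act W) := by
  rw [reassoc_of% (act_fusionHom hs hf), MonoidalCategory.whiskerLeft_comp, Category.assoc,
    actRight_naturality]

theorem splitting_actRight {U V W : Mod C A} {f : V.X ⊗ W.X ⟶ U.X} (hf : IsSplitting U V W f)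
    {X : C} (t : X ⟶ V.X) :
    actRight X (act W) ≫ t ▷ W.X ≫ f = A ◁ (t ▷ W.X ≫ f) ≫ act U := by
  rw [reassoc_of% (actRight_naturality (s := act W) t), act_splitting hs hf,
    MonoidalCategory.whiskerLeft_comp, Category.assoc]

omit hs

/-- For $V=A$ the inverse crossing is absorbed by commutativity, leaving the untwisted creation
operator on $A\otimes U$; this links the root vertex to the operators $W_k^1$. -/
theorem relIdem_regularMod (hs : IsSymmFrobenius A) (U : Mod C A) :
    relIdem (regularMod A) U = (qdim A)⁻¹ • cofree (act U) := by
  have h : rightAct (regularMod A) = μ[A] := by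
    change (β_ A A).inv ≫ μ[A] = μ[A]
    rw [Iso.inv_comp_eq, hs.comm]
  rw [relIdem, h, ← hs.whiskerLeft_coact]
  rfl

end Vertex

section Trees

variable {J : Type w} {S : SimpleModules A J} {D : CoherentData S}

/-- $A$ acting on the total charge may be moved to any single leaf. This is why all the $W_k^1$ act
on a tree in the same way. -/
theorem FusionTree.act_ket (hs : IsSymmFrobenius A) {n : ℕ} {V : Fin (n + 1) → J} {j : J}
    (t : FusionTree D n V j) (k : Fin (n + 1)) :
    act (S.M j) ≫ t.ket = A ◁ t.ket ≫ actOn n (fun k => S.M (V k)) k := by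
  induction t with
  | leaf V => exact isLinear_id (S.M (V 0))
  | node V t j a ih =>
    induction k using Fin.lastCases with
    | last =>
      rw [actOn_last]
      exact fusionHom_actRight hs ((D.vertex _ _ _).basis a).2 t.ket
    | cast k =>
      rw [actOn_castSucc]
      exact fusionHom_actLeft ((D.vertex _ _ _).basis a).2 (ih k)

theorem FusionTree.act_bra (hs : IsSymmFrobenius A) {n : ℕ} {V : Fin (n + 1) → J} {j : J}
    (t : FusionTree D n V j) (k : Fin (n + 1)) :
    actOn n (fun k => S.M (V k)) k ≫ t.bra = A ◁ t.bra ≫ act (S.M j) := by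
  induction t with
  | leaf V => exact isLinear_id (S.M (V 0))
  | node V t j a ih =>
    induction k using Fin.lastCases with
    | last =>
      rw [actOn_last]
      exact splitting_actRight hs ((D.vertex _ _ _).dual_isSplitting a) t.bra
    | cast k =>
      rw [actOn_castSucc]
      exact splitting_actLeft ((D.vertex _ _ _).dual_isSplitting a) (ih k)

/-! ### Equivariance of the creation operators -/

omit [MonObj A] [ComonObj A] in
theorem tensorFamMap_comp : ∀ (n : ℕ) {X Y Z : Fin (n + 1) → C} (f : ∀ k, X k ⟶ Y k)
    (g : ∀ k, Y k ⟶ Z k),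
    tensorFamMap n f ≫ tensorFamMap n g = tensorFamMap n (fun k => f k ≫ g k)
  | 0, _, _, _, _, _ => rfl
  | n + 1, _, _, _, _, _ => (tensorHom_comp_tensorHom _ _ _ _).trans
      (congrArg (· ⊗ₘ _) (tensorFamMap_comp n _ _))

omit [MonObj A] [ComonObj A] in
theorem tensorFamMap_id : ∀ (n : ℕ) (X : Fin (n + 1) → C),
    tensorFamMap n (fun k => 𝟙 (X k)) = 𝟙 (tensorFam n X)
  | 0, _ => rfl
  | n + 1, X => by
    simp only [tensorFamMap]
    rw [tensorFamMap_id n, id_tensorHom_id]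
    rfl

theorem actLeft_equivariant {X X' Y Y' : C} {r : A ⊗ X ⟶ X} {r' : A ⊗ X' ⟶ X'} {t : X ⟶ X'}
    (g : A ⟶ A) (h : r ≫ t = (g ⊗ₘ t) ≫ r') (u : Y ⟶ Y') :
    actLeft r Y ≫ (t ⊗ₘ u) = (g ⊗ₘ (t ⊗ₘ u)) ≫ actLeft r' Y' := by
  have e : actLeft r Y ≫ (t ⊗ₘ u) = (α_ A X Y).inv ≫ ((r ≫ t) ⊗ₘ u) := by
    rw [actLeft, Category.assoc, ← tensorHom_id, tensorHom_comp_tensorHom, Category.id_comp]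
  have e' : (((g ⊗ₘ t) ≫ r') ⊗ₘ u) = ((g ⊗ₘ t) ⊗ₘ u) ≫ r' ▷ Y' := by
    rw [← tensorHom_id, tensorHom_comp_tensorHom, Category.comp_id]
  rw [e, h, e', actLeft, associator_inv_naturality_assoc]

theorem actRight_equivariant {X X' Y Y' : C} {s : A ⊗ Y ⟶ Y} {s' : A ⊗ Y' ⟶ Y'} {u : Y ⟶ Y'}
    (g : A ⟶ A) (h : s ≫ u = (g ⊗ₘ u) ≫ s') (t : X ⟶ X') :
    actRight X s ≫ (t ⊗ₘ u) = (g ⊗ₘ (t ⊗ₘ u)) ≫ actRight X' s' := by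
  have e : (g ⊗ₘ (t ⊗ₘ u)) = A ◁ t ▷ Y ≫ g ▷ (X' ⊗ Y) ≫ A ◁ X' ◁ u := by
    rw [MonoidalCategory.tensorHom_def' g, MonoidalCategory.tensorHom_def t,
      MonoidalCategory.whiskerLeft_comp, Category.assoc, whisker_exchange]
  have e' : X' ◁ g ▷ Y ≫ X' ◁ A ◁ u = X' ◁ (g ⊗ₘ u) := by
    rw [MonoidalCategory.tensorHom_def, MonoidalCategory.whiskerLeft_comp]
  rw [e, actRight, actRight, Category.assoc, Category.assoc, Category.assoc,
    reassoc_of% (crossL_naturality (B := A) (X := X') u),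
    reassoc_of% (crossL_map (X := X') (Y := Y) g),
    reassoc_of% (crossL_naturality_left (B := A) (Y := Y) t), reassoc_of% e',
    ← MonoidalCategory.whiskerLeft_comp, ← h, MonoidalCategory.tensorHom_def,
    MonoidalCategory.whiskerLeft_comp, whisker_exchange_assoc]

theorem actOn_equivariant : ∀ (n : ℕ) (V V' : Fin (n + 1) → Mod C A) (g : Fin (n + 1) → algAut A)
    (u : ∀ k, (V' k).X ⟶ (V k).X) (_ : ∀ k, IsEquivariant (g k) (V' k) (V k) (u k))
    (k : Fin (n + 1)),
    actOn n V' k ≫ tensorFamMap n u = ((g k).1.hom ⊗ₘ tensorFamMap n u) ≫ actOn n V k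
  | 0, V, V', g, u, hu, k => by
    obtain rfl : k = 0 := Fin.ext (by omega)
    exact hu 0
  | n + 1, V, V', g, u, hu, k => by
    induction k using Fin.lastCases with
    | last =>
      rw [actOn_last, actOn_last]
      exact actRight_equivariant _ (hu _) _
    | cast k =>
      rw [actOn_castSucc, actOn_castSucc]
      exact actLeft_equivariant _ (actOn_equivariant n _ _ _ _ (fun k => hu k.castSucc) k) _

theorem comulL_map {X X' : C} (g : A ⟶ A) (hg : g ≫ Δ[A] = Δ[A] ≫ (g ⊗ₘ g)) (t : X ⟶ X') :
    (g ⊗ₘ t) ≫ comulL A X' = comulL A X ≫ (g ⊗ₘ (g ⊗ₘ t)) := by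
  have e : (g ⊗ₘ t) ≫ comulL A X' = ((g ≫ Δ[A]) ⊗ₘ t) ≫ (α_ A A X').hom := by
    rw [comulL, ← tensorHom_id, tensorHom_comp_tensorHom_assoc, Category.comp_id]
  have e' : ((Δ[A] ≫ (g ⊗ₘ g)) ⊗ₘ t) = Δ[A] ▷ X ≫ ((g ⊗ₘ g) ⊗ₘ t) := by
    rw [← tensorHom_id, tensorHom_comp_tensorHom, Category.id_comp]
  rw [e, hg, e', Category.assoc, associator_naturality, comulL, Category.assoc]

/-- The conjugation rule: $g$ passes through both legs of $\Delta$, and the action turns the $g$ on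
the second leg into the relation `hl` among the labels. -/
theorem cofree_map {X X' : C} (g h k : A ⟶ A) (hg : g ≫ Δ[A] = Δ[A] ≫ (g ⊗ₘ g))
    {r : A ⊗ X ⟶ X} {r' : A ⊗ X' ⟶ X'} {t : X ⟶ X'} (ht : r ≫ t = (k ⊗ₘ t) ≫ r')
    (l : A ⟶ A) (hl : l ≫ k = g ≫ h) :
    (g ⊗ₘ t) ≫ cofree (h ▷ X' ≫ r') = cofree (l ▷ X ≫ r) ≫ (g ⊗ₘ t) := by
  have e1 : (g ⊗ₘ t) ≫ h ▷ X' ≫ r' = l ▷ X ≫ r ≫ t := by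
    rw [ht, ← tensorHom_id, ← tensorHom_id, tensorHom_comp_tensorHom_assoc,
      tensorHom_comp_tensorHom_assoc, hl]
    simp
  rw [cofree, cofree, reassoc_of% (comulL_map g hg t), Category.assoc]
  congr 1
  rw [← id_tensorHom, ← id_tensorHom, tensorHom_comp_tensorHom, tensorHom_comp_tensorHom, e1]
  simp

end Trees

/-! ### Algebra endomorphisms respect the coproduct. -/

theorem IsCondensate.mul_hom_counit (hA : IsCondensate A) (g : A ⟶ A) [IsMonHom g] :
    (g ⊗ₘ g) ≫ μ[A] ≫ ε[A] = μ[A] ≫ ε[A] := by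
  rw [← IsMonHom.mul_hom_assoc g, hA.counit_of_one g (IsMonHom.one_hom g)]

theorem IsCondensate.comul_mulL_counitL (hA : IsCondensate A) :
    A ◁ Δ[A] ≫ mulL A A ≫ counitL A A = μ[A] := by
  have := hA.frobenius_left
  simp only [mulL, counitL, Category.assoc]
  rw [reassoc_of% this]; simp

theorem mulL_counitL (X : C) :
    mulL A X ≫ counitL A X = (α_ A A X).inv ≫ (μ[A] ≫ ε[A]) ▷ X ≫ (λ_ X).hom := by
  simp [mulL, counitL]

/-- The coproduct is determined by the product and the Frobenius form, and $g$ preserves both. -/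
theorem IsCondensate.comul_hom (hA : IsCondensate A) (hs : IsSymmFrobenius A) (g : A ⟶ A)
    [IsMonHom g] : g ≫ Δ[A] = Δ[A] ≫ (g ⊗ₘ g) := by
  have := hA.isIso_of_isMonHom g
  apply hs.comul_eq_of_pairing
  rw [← cancel_epi (g ▷ A)]
  have e1 : g ▷ A ≫ A ◁ (Δ[A] ≫ (g ⊗ₘ g)) ≫ mulL A A ≫ counitL A A = μ[A] ≫ g := by
    have h1 : g ▷ A ≫ A ◁ (Δ[A] ≫ (g ⊗ₘ g)) = A ◁ Δ[A] ≫ (g ⊗ₘ (g ⊗ₘ g)) := by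
      rw [← MonoidalCategory.tensorHom_def, ← id_tensorHom, tensorHom_comp_tensorHom,
        Category.id_comp]
    have h2 : ((g ⊗ₘ g) ⊗ₘ g) ≫ (μ[A] ≫ ε[A]) ▷ A ≫ (λ_ A).hom =
        (μ[A] ≫ ε[A]) ▷ A ≫ (λ_ A).hom ≫ g := by
      rw [← tensorHom_id, tensorHom_comp_tensorHom_assoc, hA.mul_hom_counit,
        MonoidalCategory.tensorHom_def]
      simp
    rw [reassoc_of% h1, mulL_counitL, associator_inv_naturality_assoc, h2]
    have h3 := hA.comul_mulL_counitL =≫ g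
    rw [mulL_counitL] at h3
    simpa only [Category.assoc] using h3
  rw [e1, MonoidalCategory.whiskerLeft_comp, Category.assoc, hA.comul_mulL_counitL,
    ← MonoidalCategory.tensorHom_def_assoc, IsMonHom.mul_hom]

/-! ### Coherent states -/

section States

variable {J : Type w} {S : SimpleModules A J} {D : CoherentData S} {n : ℕ} {V : Fin (n + 1) → J}

/-- The morphism `g₀ ⊗ u_{g₁} ⊗ … ⊗ u_{g_N}`. -/
def twistHom (D : CoherentData S) (V : Fin (n + 1) → J) (g₀ : algAut A)
    (g : Fin (n + 1) → algAut A) :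
    A ⊗ tensorFam n (fun k => (S.M (D.source (g k) (V k))).X) ⟶
      A ⊗ tensorFam n (fun k => (S.M (V k)).X) :=
  g₀.1.hom ⊗ₘ tensorFamMap n (fun k => (D.u (g k) (V k)).hom)

/-- The inverse of `twistHom`. -/
def twistInv (D : CoherentData S) (V : Fin (n + 1) → J) (g₀ : algAut A)
    (g : Fin (n + 1) → algAut A) :
    A ⊗ tensorFam n (fun k => (S.M (V k)).X) ⟶
      A ⊗ tensorFam n (fun k => (S.M (D.source (g k) (V k))).X) :=
  g₀.1.inv ⊗ₘ tensorFamMap n (fun k => (D.u (g k) (V k)).inv)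

theorem twistHom_twistInv (g₀ : algAut A) (g : Fin (n + 1) → algAut A) :
    twistHom D V g₀ g ≫ twistInv D V g₀ g = 𝟙 _ := by
  rw [twistHom, twistInv, tensorHom_comp_tensorHom, tensorFamMap_comp, algAut_hom_inv]
  simp only [Iso.hom_inv_id, tensorFamMap_id, id_tensorHom_id]

theorem twistInv_twistHom (g₀ : algAut A) (g : Fin (n + 1) → algAut A) :
    twistInv D V g₀ g ≫ twistHom D V g₀ g = 𝟙 _ := by
  rw [twistHom, twistInv, tensorHom_comp_tensorHom, tensorFamMap_comp, algAut_inv_hom]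
  simp only [Iso.inv_hom_id, tensorFamMap_id, id_tensorHom_id]

theorem twistHom_creation (hA : IsCondensate A) (hs : IsSymmFrobenius A) (g₀ : algAut A)
    (g : Fin (n + 1) → algAut A) (k : Fin (n + 1)) (h : algAut A) :
    twistHom D V g₀ g ≫ creation n (fun k => S.M (V k)) k h =
      creation n (fun k => S.M (D.source (g k) (V k))) k ((g k)⁻¹ * h * g₀) ≫
        twistHom D V g₀ g := by
  have : IsMonHom g₀.1.hom := g₀.2
  rw [creation_eq, creation_eq, Linear.comp_smul, Linear.smul_comp]
  congr 1
  refine cofree_map _ _ _ (hA.comul_hom hs g₀.1.hom) (actOn_equivariant n _ _ g _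
    (fun k => D.u_equivariant (g k) (V k)) k) _ ?_
  -- Products in `algAut` compose right to left, so $g_k^{-1}hg_0$ applies $g_0$ first.
  change (g₀.1.hom ≫ h.1.hom ≫ (g k).1.inv) ≫ (g k).1.hom = _
  rw [Category.assoc, Category.assoc, algAut_inv_hom, Category.comp_id]

theorem creation_twistInv (hA : IsCondensate A) (hs : IsSymmFrobenius A) (g₀ : algAut A)
    (g : Fin (n + 1) → algAut A) (k : Fin (n + 1)) (h : algAut A) :
    creation n (fun k => S.M (V k)) k h ≫ twistInv D V g₀ g =
      twistInv D V g₀ g ≫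
        creation n (fun k => S.M (D.source (g k) (V k))) k ((g k)⁻¹ * h * g₀) := by
  rw [← Category.comp_id (twistInv D V g₀ g ≫ _), ← twistHom_twistInv (D := D) (V := V) g₀ g,
    Category.assoc, ← reassoc_of% (twistHom_creation (D := D) (V := V) hA hs g₀ g k h),
    reassoc_of% (twistInv_twistHom (D := D) (V := V) g₀ g)]

theorem creation_one (n : ℕ) (V : Fin (n + 1) → Mod C A) (k : Fin (n + 1)) :
    creation n V k 1 = (qdim A)⁻¹ • cofree (actOn n V k) := by
  have h : (1 : algAut A).1.hom = 𝟙 A := rfl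
  rw [creation_eq, h, id_whiskerRight, Category.id_comp]

end States

/-! ### Root vertices, eigenvalues and semilinearity of the states. -/

section States

variable {J : Type w} {S : SimpleModules A J} {D : CoherentData S} {n : ℕ} {V : Fin (n + 1) → J}

/-- The idempotent on `A ⊗ U` with image `A ⊗_A U`. -/
def regIdem (U : Mod C A) : A ⊗ U.X ⟶ A ⊗ U.X := (qdim A)⁻¹ • cofree (act U)

/-- The chosen basis of `Hom_A(A, A ⊗_A M j)`. -/
def rootKet (D : CoherentData S) {j : J} (a : (D.root j).ι) : A ⟶ A ⊗ (S.M j).X :=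
  ((D.root j).basis a).1

/-- The dual basis of `Hom_A(A ⊗_A M j, A)`. -/
def rootBra (D : CoherentData S) {j : J} (a : (D.root j).ι) : A ⊗ (S.M j).X ⟶ A :=
  (D.root j).dual a

theorem rootKet_regIdem (hs : IsSymmFrobenius A) {j : J} (a : (D.root j).ι) :
    rootKet D a ≫ regIdem (S.M j) = rootKet D a := by
  have h := ((D.root j).basis a).2.1
  rw [relIdem_regularMod hs] at h
  exact h

theorem mul_rootKet {j : J} (a : (D.root j).ι) :
    μ[A] ≫ rootKet D a = A ◁ rootKet D a ≫ mulL A (S.M j).X :=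
  ((D.root j).basis a).2.2

theorem regIdem_rootBra (hs : IsSymmFrobenius A) {j : J} (a : (D.root j).ι) :
    regIdem (S.M j) ≫ rootBra D a = rootBra D a := by
  have h := ((D.root j).dual_isSplitting a).1
  rw [relIdem_regularMod hs] at h
  exact h

theorem mulL_rootBra {j : J} (a : (D.root j).ι) :
    mulL A (S.M j).X ≫ rootBra D a = A ◁ rootBra D a ≫ μ[A] :=
  ((D.root j).dual_isSplitting a).2

theorem rootKet_rootBra_self {j : J} (a : (D.root j).ι) : rootKet D a ≫ rootBra D a = 𝟙 A :=
  (D.root j).basis_dual_self a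

theorem rootKet_rootBra_of_ne {j : J} {a b : (D.root j).ι} (h : a ≠ b) :
    rootKet D a ≫ rootBra D b = 0 :=
  (D.root j).basis_dual_ne a b h

theorem mulL_map {X X' : C} (g : A ⟶ A) [IsMonHom g] (t : X ⟶ X') :
    mulL A X ≫ (g ⊗ₘ t) = (g ⊗ₘ (g ⊗ₘ t)) ≫ mulL A X' := by
  have h1 : μ[A] ▷ X ≫ (g ⊗ₘ t) = ((g ⊗ₘ g) ⊗ₘ t) ≫ μ[A] ▷ X' := by
    rw [← tensorHom_id, ← tensorHom_id, tensorHom_comp_tensorHom, tensorHom_comp_tensorHom,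
      IsMonHom.mul_hom]
    simp
  rw [mulL, mulL, Category.assoc, h1, associator_inv_naturality_assoc]

theorem FusionTree.ket_creation (hs : IsSymmFrobenius A) {j : J} (t : FusionTree D n V j)
    (k : Fin (n + 1)) :
    A ◁ t.ket ≫ creation n (fun k => S.M (V k)) k 1 =
      regIdem (S.M j) ≫ A ◁ t.ket := by
  rw [creation_one, regIdem, Linear.comp_smul, Linear.smul_comp, cofree,
    reassoc_of% (comulL_naturality (A := A) t.ket), ← MonoidalCategory.whiskerLeft_comp,
    ← t.act_ket hs k, cofree, MonoidalCategory.whiskerLeft_comp, Category.assoc]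

theorem FusionTree.creation_bra (hs : IsSymmFrobenius A) {j : J} (t : FusionTree D n V j)
    (k : Fin (n + 1)) :
    creation n (fun k => S.M (V k)) k 1 ≫ A ◁ t.bra =
      A ◁ t.bra ≫ regIdem (S.M j) := by
  rw [creation_one, regIdem, Linear.comp_smul, Linear.smul_comp, cofree,
    Category.assoc, ← MonoidalCategory.whiskerLeft_comp, t.act_bra hs k, cofree,
    reassoc_of% (comulL_naturality (A := A) t.bra), MonoidalCategory.whiskerLeft_comp]

namespace CoherentLabel

theorem ket_eq (x : CoherentLabel D n V) :
    x.ket = rootKet D x.root ≫ A ◁ x.tree.ket ≫ twistHom D V x.g₀ x.g := rfl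

theorem bra_eq (x : CoherentLabel D n V) :
    x.bra = twistInv D V x.g₀ x.g ≫ A ◁ x.tree.bra ≫ rootBra D x.root := rfl

theorem ket_creation_self (hA : IsCondensate A) (hs : IsSymmFrobenius A)
    (x : CoherentLabel D n V) (k : Fin (n + 1)) :
    x.ket ≫ creation n (fun k => S.M (V k)) k (x.g k * x.g₀⁻¹) = x.ket := by
  have h1 : (x.g k)⁻¹ * (x.g k * x.g₀⁻¹) * x.g₀ = 1 := by group
  rw [ket_eq, Category.assoc, Category.assoc, twistHom_creation hA hs, h1,
    reassoc_of% (x.tree.ket_creation hs k), reassoc_of% (rootKet_regIdem (D := D) hs x.root)]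

theorem creation_bra_self (hA : IsCondensate A) (hs : IsSymmFrobenius A)
    (x : CoherentLabel D n V) (k : Fin (n + 1)) :
    creation n (fun k => S.M (V k)) k (x.g k * x.g₀⁻¹) ≫ x.bra = x.bra := by
  have h1 : (x.g k)⁻¹ * (x.g k * x.g₀⁻¹) * x.g₀ = 1 := by group
  rw [bra_eq, reassoc_of% (creation_twistInv (D := D) (V := V) hA hs x.g₀ x.g k), h1,
    reassoc_of% (x.tree.creation_bra hs k), regIdem_rootBra hs]

theorem ket_creation_of_ne (hA : IsCondensate A) (hs : IsSymmFrobenius A)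
    (x : CoherentLabel D n V) (k : Fin (n + 1)) {h : algAut A} (hh : h ≠ x.g k * x.g₀⁻¹) :
    x.ket ≫ creation n (fun k => S.M (V k)) k h = 0 := by
  rw [← x.ket_creation_self hA hs k, Category.assoc,
    creation_comp_of_ne hA n _ k hs hh, Limits.comp_zero]

/-- The creation operators see only the ratios $g_kg_0^{-1}$; this semilinearity is what detects
$g_0$ itself. -/
theorem mul_ket (x : CoherentLabel D n V) :
    μ[A] ≫ x.ket = (x.g₀.1.hom ⊗ₘ x.ket) ≫ mulL A _ := by
  have : IsMonHom x.g₀.1.hom := x.g₀.2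
  have h : ∀ {X T T' : C} (b : A ⟶ A ⊗ X) (s : X ⟶ T) (g : A ⟶ A) (t : A ⊗ T ⟶ A ⊗ T'),
      μ[A] ≫ b = A ◁ b ≫ mulL A X → mulL A T ≫ t = (g ⊗ₘ t) ≫ mulL A T' →
      μ[A] ≫ b ≫ A ◁ s ≫ t = (g ⊗ₘ (b ≫ A ◁ s ≫ t)) ≫ mulL A T' := by
    intro X T T' b s g t h1 h2
    rw [reassoc_of% h1, ← reassoc_of% (mulL_naturality (A := A) s), h2,
      ← id_tensorHom A b, ← id_tensorHom A (A ◁ s), tensorHom_comp_tensorHom_assoc,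
      tensorHom_comp_tensorHom_assoc, Category.id_comp, Category.id_comp, Category.assoc]
  exact h _ _ _ _ (mul_rootKet x.root) (mulL_map x.g₀.1.hom _)

theorem mulL_bra (x : CoherentLabel D n V) :
    mulL A _ ≫ x.bra = (x.g₀.1.inv ⊗ₘ x.bra) ≫ μ[A] := by
  have : IsMonHom x.g₀.1.inv := (x.g₀⁻¹).2
  have h : ∀ {X T T' : C} (b : A ⊗ X ⟶ A) (s : T ⟶ X) (g : A ⟶ A) (t : A ⊗ T' ⟶ A ⊗ T),
      mulL A X ≫ b = A ◁ b ≫ μ[A] → mulL A T' ≫ t = (g ⊗ₘ t) ≫ mulL A T →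
      mulL A T' ≫ t ≫ A ◁ s ≫ b = (g ⊗ₘ (t ≫ A ◁ s ≫ b)) ≫ μ[A] := by
    intro X T T' b s g t h1 h2
    rw [reassoc_of% h2, ← reassoc_of% (mulL_naturality (A := A) s), h1,
      ← id_tensorHom A b, ← id_tensorHom A (A ◁ s), tensorHom_comp_tensorHom_assoc,
      tensorHom_comp_tensorHom_assoc, Category.comp_id, Category.comp_id, Category.assoc]
  exact h _ _ _ _ (mulL_rootBra x.root) (mulL_map x.g₀.1.inv _)

/-! ### Orthogonality of the coherent states -/

/-- The overlap is semilinear, hence a multiple of a nontrivial automorphism, whose trace vanishes.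
This covers states that share all eigenvalues. -/
theorem qtrace_ket_bra_of_ne (hA : IsCondensate A) (hs : IsSymmFrobenius A)
    (x y : CoherentLabel D n V) (h : x.g₀ ≠ y.g₀) : qtrace (y.ket ≫ x.bra) = 0 := by
  obtain ⟨s, -, e⟩ := hA.eq_smul_of_semilinear (y.g₀.1.hom ≫ x.g₀.1.inv) (y.ket ≫ x.bra) (by
    rw [reassoc_of% y.mul_ket, x.mulL_bra, tensorHom_comp_tensorHom_assoc])
  have : IsMonHom (y.g₀.1.hom ≫ x.g₀.1.inv) := (x.g₀⁻¹ * y.g₀).2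
  rw [e, qtrace_smul, hA.qtrace_eq_zero hs, mul_zero]
  intro h1
  apply h
  have h2 : x.g₀⁻¹ * y.g₀ = 1 := Subtype.ext (Iso.ext h1)
  rw [inv_mul_eq_one] at h2
  exact h2

theorem ket_bra_of_ne (hA : IsCondensate A) (hs : IsSymmFrobenius A)
    (x y : CoherentLabel D n V) (k : Fin (n + 1))
    (h : x.g k * x.g₀⁻¹ ≠ y.g k * y.g₀⁻¹) : y.ket ≫ x.bra = 0 := by
  rw [← x.creation_bra_self hA hs k, reassoc_of% (y.ket_creation_of_ne hA hs k h),
    Limits.zero_comp]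

end CoherentLabel

theorem simple_hom_eq_zero {i j : J} (h : i ≠ j) {f : (S.M i).X ⟶ (S.M j).X}
    (hf : IsLinear (S.M i) (S.M j) f) : f = 0 := by
  by_contra h0
  have : IsIso hf.toHom.hom := hf.isIso_of_ne_zero (S.simple i) (S.simple j) h0
  have := isIso_of_hom hf.toHom
  exact h (S.eq_of_iso _ _ ⟨asIso hf.toHom⟩)

theorem fusionHom_comp_splitting {U U' V W : Mod C A} {f : U.X ⟶ V.X ⊗ W.X}
    {g : V.X ⊗ W.X ⟶ U'.X} (hf : f ∈ fusionHom U V W) (hg : IsSplitting U' V W g) :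
    IsLinear U U' (f ≫ g) := by
  rw [IsLinear, reassoc_of% hf.2, hg.2, MonoidalCategory.whiskerLeft_comp, Category.assoc]

theorem FusionTree.ket_bra_self {j : J} (t : FusionTree D n V j) :
    t.ket ≫ t.bra = 𝟙 (S.M j).X := by
  induction t with
  | leaf V => exact Category.comp_id (𝟙 (S.M (V 0)).X)
  | node V t j a ih =>
    have h : ∀ {X T W Y : C} (b : X ⟶ Y ⊗ W) (k : Y ⟶ T) (r : T ⟶ Y) (d : Y ⊗ W ⟶ X),
        k ≫ r = 𝟙 _ → b ≫ d = 𝟙 _ → (b ≫ k ▷ W) ≫ r ▷ W ≫ d = 𝟙 _ := by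
      intro X T W Y b k r d h1 h2
      rw [Category.assoc, ← comp_whiskerRight_assoc, h1]
      simp [h2]
    exact h _ _ _ _ ih ((D.vertex _ _ _).basis_dual_self a)

/-- If the subtrees differ, their overlap already vanishes; if they agree it is the identity, and
the last vertex is decided by Schur's lemma or by duality. `HEq` compares trees whose charges, and
so types, may differ. -/
theorem FusionTree.ket_bra_of_ne {i j : J} (s : FusionTree D n V i) (t : FusionTree D n V j)
    (h : ¬ (i = j ∧ HEq s t)) : s.ket ≫ t.bra = 0 := by
  induction s generalizing j with
  | leaf V =>
    cases t with
    | leaf V => exact absurd ⟨rfl, HEq.rfl⟩ h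
  | @node _ V i' s i a ih =>
    cases t with
    | @node _ _ l t _ b =>
      have h3 : ∀ {X X' T W Y Y' : C} (b : X ⟶ Y ⊗ W) (k : Y ⟶ T) (r : T ⟶ Y')
          (d : Y' ⊗ W ⟶ X'), k ≫ r = 0 → (b ≫ k ▷ W) ≫ r ▷ W ≫ d = 0 := by
        intro X X' T W Y Y' b k r d h1
        rw [Category.assoc, ← comp_whiskerRight_assoc, h1]
        simp
      by_cases hst : i' = l ∧ HEq s t
      · obtain ⟨rfl, hst⟩ := hst
        obtain rfl := eq_of_heq hst
        have h4 : ∀ {X X' T W Y : C} (b : X ⟶ Y ⊗ W) (k : Y ⟶ T) (r : T ⟶ Y) (d : Y ⊗ W ⟶ X'),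
            k ≫ r = 𝟙 _ → b ≫ d = 0 → (b ≫ k ▷ W) ≫ r ▷ W ≫ d = 0 := by
          intro X X' T W Y b k r d h1 h2
          rw [Category.assoc, ← comp_whiskerRight_assoc, h1]
          simp [h2]
        refine h4 _ _ _ _ s.ket_bra_self ?_
        by_cases hij : i = j
        · subst hij
          refine (D.vertex _ _ _).basis_dual_ne a b fun hab => h ⟨rfl, ?_⟩
          rw [hab]
        · exact simple_hom_eq_zero hij (fusionHom_comp_splitting ((D.vertex _ _ _).basis a).2
            ((D.vertex _ _ _).dual_isSplitting b))
      · exact h3 _ _ _ _ (ih t hst)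

namespace CoherentLabel

theorem ket_bra_self (x : CoherentLabel D n V) : x.ket ≫ x.bra = 𝟙 A := by
  rw [ket_eq, bra_eq, Category.assoc, Category.assoc,
    reassoc_of% (twistHom_twistInv (D := D) (V := V) x.g₀ x.g),
    ← MonoidalCategory.whiskerLeft_comp_assoc, x.tree.ket_bra_self,
    MonoidalCategory.whiskerLeft_id, Category.id_comp]
  exact rootKet_rootBra_self x.root

theorem qtrace_ket_bra (hA : IsCondensate A) (hs : IsSymmFrobenius A)
    (x y : CoherentLabel D n V) (h : x ≠ y) : qtrace (y.ket ≫ x.bra) = 0 := by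
  by_cases h₀ : x.g₀ = y.g₀
  swap
  · exact qtrace_ket_bra_of_ne hA hs x y h₀
  by_cases hg : x.g = y.g
  swap
  · obtain ⟨k, hk⟩ := Function.ne_iff.mp hg
    rw [ket_bra_of_ne hA hs x y k, qtrace_zero]
    rw [h₀]
    exact fun e => hk (mul_right_cancel e)
  obtain ⟨x₀, xg, i, s, a⟩ := x
  obtain ⟨y₀, yg, j, t, b⟩ := y
  obtain rfl : x₀ = y₀ := h₀
  obtain rfl : xg = yg := hg
  suffices H : (⟨x₀, xg, j, t, b⟩ : CoherentLabel D n V).ket ≫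
      (⟨x₀, xg, i, s, a⟩ : CoherentLabel D n V).bra = 0 by rw [H, qtrace_zero]
  rw [ket_eq, bra_eq, Category.assoc, Category.assoc,
    reassoc_of% (twistHom_twistInv (D := D) (V := V) x₀ xg),
    ← MonoidalCategory.whiskerLeft_comp_assoc]
  by_cases hst : j = i ∧ HEq t s
  · obtain ⟨rfl, hst⟩ := hst
    obtain rfl := eq_of_heq hst
    rw [FusionTree.ket_bra_self, MonoidalCategory.whiskerLeft_id, Category.id_comp]
    exact rootKet_rootBra_of_ne fun e => h (congrArg (CoherentLabel.mk x₀ xg j t) e.symm)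
  · rw [FusionTree.ket_bra_of_ne t s hst]
    simp

end CoherentLabel

end States

theorem mem_of_mem_span {M N : Type*} [AddCommGroup M] [Module ℂ M] [AddCommGroup N] [Module ℂ N]
    {s : Set M} {x : M} (hx : x ∈ Submodule.span ℂ s) (f : M →ₗ[ℂ] N) (T : Submodule ℂ N)
    (h : ∀ y ∈ s, f y ∈ T) : f x ∈ T :=
  (Submodule.span_le.mpr h : Submodule.span ℂ s ≤ T.comap f) hx

/-! ### Completeness of the fusion vertices -/

section Completeness

variable (hA : IsCondensate A) (hs : IsSymmFrobenius A)

include hs in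
theorem relIdem_isLinear (V W : Mod C A) :
    relAct V W ≫ relIdem V W = A ◁ relIdem V W ≫ relAct V W := by
  have hc : ActionsCommute (relAct V W) (actRight V.X (act W)) :=
    actionsCommute_actLeft_actRight (act V) (act W)
  have h1 := hs.whiskerLeft_pairing (s := actRight V.X (act W)) (relAct_isAction V W)
  have h2 := hs.action_pairing hc (relAct_isAction V W)
  rw [relIdem_eq, Linear.comp_smul, MonoidalLinear.whiskerLeft_smul, Linear.smul_comp]
  exact congrArg _ (h2.trans h1.symm)

include hA in
theorem pairing_self {X : C} {r : A ⊗ X ⟶ X} (hr : IsAction r) : pairing r r = qdim A • 𝟙 X := by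
  have h : comulL A X ≫ mulL A X = qdim A • 𝟙 _ := by
    rw [comulL, mulL, Category.assoc, Iso.hom_inv_id_assoc, ← comp_whiskerRight, hA.comul_mul]
    simp
  rw [pairing, ← hr.mul, reassoc_of% h]
  simp [hr.one]

include hA hs in
theorem relIdem_relIdem (V W : Mod C A) : relIdem V W ≫ relIdem V W = relIdem V W := by
  have h4 : relIdem V W ≫ pairing (relAct V W) (actRight V.X (act W)) =
      qdim A • relIdem V W := by
    rw [pairing, reassoc_of% (oneL_naturality (A := A) (relIdem V W)),
      reassoc_of% (comulL_naturality (A := A) (relIdem V W)),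
      ← MonoidalCategory.whiskerLeft_comp_assoc, ← whiskerLeft_relIdem hs V W,
      ← relIdem_isLinear hs, MonoidalCategory.whiskerLeft_comp_assoc, ← relIdem_isLinear hs]
    have h5 := pairing_self hA (relAct_isAction V W) =≫ relIdem V W
    rw [pairing] at h5
    simpa only [Category.assoc, Linear.smul_comp, Category.id_comp] using h5
  calc relIdem V W ≫ relIdem V W = (qdim A)⁻¹ •
        (relIdem V W ≫ pairing (relAct V W) (actRight V.X (act W))) := by
        rw [← Linear.comp_smul]; exact congrArg _ (relIdem_eq V W)
    _ = relIdem V W := by rw [h4, inv_smul_smul₀ hA.qdim_ne_zero]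

variable {J : Type w} (S : SimpleModules A J) (V W : Mod C A)

theorem IsAction.id_mem_span (hA : IsCondensate A) (hs : IsSymmFrobenius A)
    (S : SimpleModules A J) {X : C} {r : A ⊗ X ⟶ X} (hr : IsAction r) :
    𝟙 X ∈ Submodule.span ℂ {f : X ⟶ X | ∃ (j : J) (p : X ⟶ (S.M j).X) (q : (S.M j).X ⟶ X),
      r ≫ p = A ◁ p ≫ act (S.M j) ∧ act (S.M j) ≫ q = A ◁ q ≫ r ∧ f = p ≫ q} :=
  S.id_mem_span hA hs hr.toMod

include hA hs in
theorem relIdem_mem_span : relIdem V W ∈ Submodule.span ℂ {f : V.X ⊗ W.X ⟶ V.X ⊗ W.X |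
    ∃ (j : J) (p : V.X ⊗ W.X ⟶ (S.M j).X) (q : (S.M j).X ⟶ V.X ⊗ W.X),
      IsSplitting (S.M j) V W p ∧ q ∈ fusionHom (S.M j) V W ∧ f = p ≫ q} := by
  have h := (relAct_isAction V W).id_mem_span hA hs S
  have e := relIdem_relIdem hA hs V W
  have h2 := mem_of_mem_span h
    ((Linear.leftComp ℂ _ (relIdem V W)).comp (Linear.rightComp ℂ _ (relIdem V W)))
    (Submodule.span ℂ {f : V.X ⊗ W.X ⟶ V.X ⊗ W.X |
      ∃ (j : J) (p : V.X ⊗ W.X ⟶ (S.M j).X) (q : (S.M j).X ⟶ V.X ⊗ W.X),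
        IsSplitting (S.M j) V W p ∧ q ∈ fusionHom (S.M j) V W ∧ f = p ≫ q}) (by
    rintro _ ⟨j, p, q, hp, hq, rfl⟩
    refine Submodule.subset_span ⟨j, relIdem V W ≫ p, q ≫ relIdem V W, ⟨?_, ?_⟩, ⟨?_, ?_⟩, ?_⟩
    · rw [reassoc_of% e]
    · rw [reassoc_of% (relIdem_isLinear hs V W), hp, MonoidalCategory.whiskerLeft_comp,
        Category.assoc]
    · rw [Category.assoc, e]
    · rw [reassoc_of% hq, relIdem_isLinear hs V W, MonoidalCategory.whiskerLeft_comp,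
        Category.assoc]
    · simp [Linear.leftComp, Linear.rightComp])
  simpa [Linear.leftComp, Linear.rightComp, e] using h2

variable {S V W}

theorem fusionHom_comp_eq_zero {U : Mod C A} (B : FusionBasis U V W) {X : C}
    (g : V.X ⊗ W.X ⟶ X) (hg : ∀ a, (B.basis a).1 ≫ g = 0) {f : U.X ⟶ V.X ⊗ W.X}
    (hf : f ∈ fusionHom U V W) : f ≫ g = 0 := by
  have h : (Linear.rightComp ℂ U.X g).comp (fusionHom U V W).subtype = 0 :=
    B.basis.ext fun a => hg a
  exact LinearMap.congr_fun h ⟨f, hf⟩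

/-- The space of morphisms representing elements of `Hom_A(V ⊗_A W, U)`. -/
def splittingHom (U V W : Mod C A) : Submodule ℂ (V.X ⊗ W.X ⟶ U.X) where
  carrier := {f | IsSplitting U V W f}
  zero_mem' := by constructor <;> simp
  add_mem' := by
    rintro f g ⟨hf, hf'⟩ ⟨hg, hg'⟩
    refine ⟨?_, ?_⟩
    · rw [Preadditive.comp_add, hf, hg]
    · rw [Preadditive.comp_add, hf', hg', MonoidalPreadditive.whiskerLeft_add,
        Preadditive.add_comp]
  smul_mem' := by
    rintro c f ⟨hf, hf'⟩
    refine ⟨?_, ?_⟩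
    · rw [Linear.comp_smul, hf]
    · rw [Linear.comp_smul, hf', MonoidalLinear.whiskerLeft_smul, Linear.smul_comp]

theorem IsSplitting.comp {U U' : Mod C A} {f : V.X ⊗ W.X ⟶ U.X} (hf : IsSplitting U V W f)
    {g : U.X ⟶ U'.X} (hg : IsLinear U U' g) : IsSplitting U' V W (f ≫ g) := by
  refine ⟨?_, ?_⟩
  · rw [reassoc_of% hf.1]
  · rw [reassoc_of% hf.2, hg, MonoidalCategory.whiskerLeft_comp, Category.assoc]

include hA hs in
-- The idempotent factors through simple modules: charges other than $j$ contribute nothing by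
-- Schur, and charge $j$ is covered by the basis.
theorem IsSplitting.eq_zero (B : ∀ j, FusionBasis (S.M j) V W) {j : J}
    {g : V.X ⊗ W.X ⟶ (S.M j).X} (hg : IsSplitting (S.M j) V W g)
    (h : ∀ a, ((B j).basis a).1 ≫ g = 0) : g = 0 := by
  have h1 := mem_of_mem_span (relIdem_mem_span hA hs S V W)
    (Linear.rightComp ℂ _ g) ⊥ (by
    rintro _ ⟨i, p, q, hp, hq, rfl⟩
    have h2 : q ≫ g = 0 := by
      by_cases hij : i = j
      · subst hij
        exact fusionHom_comp_eq_zero (B i) g h hq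
      · exact simple_hom_eq_zero hij (fusionHom_comp_splitting hq hg)
    simp [Linear.rightComp, h2])
  rw [← hg.1]
  exact h1

instance finite_fusionBasis {U V W : Mod C A} (B : FusionBasis U V W) : Finite B.ι :=
  Module.Finite.finite_basis B.basis

/-- The projection to the isotypic component of `V ⊗_A W` given by a basis of vertices. -/
def FusionBasis.proj {U : Mod C A} (B : FusionBasis U V W) : V.X ⊗ W.X ⟶ V.X ⊗ W.X :=
  ∑ a ∈ (Set.finite_univ (α := B.ι)).toFinset, B.dual a ≫ (B.basis a).1

theorem FusionBasis.proj_relIdem {U : Mod C A} (B : FusionBasis U V W) :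
    B.proj ≫ relIdem V W = B.proj := by
  rw [FusionBasis.proj, Preadditive.sum_comp]
  refine Finset.sum_congr rfl fun a _ => ?_
  rw [Category.assoc, (B.basis a).2.1]

theorem FusionBasis.basis_proj {U : Mod C A} (B : FusionBasis U V W) (b : B.ι) :
    (B.basis b).1 ≫ B.proj = (B.basis b).1 := by
  rw [FusionBasis.proj, Preadditive.comp_sum, Finset.sum_eq_single b]
  · rw [← Category.assoc, B.basis_dual_self, Category.id_comp]
  · intro a _ hab
    rw [← Category.assoc, B.basis_dual_ne b a hab.symm, Limits.zero_comp]
  · simp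

theorem FusionBasis.proj_comp_mem {U U' : Mod C A} (B : FusionBasis U V W)
    {f : V.X ⊗ W.X ⟶ U'.X} (hf : IsSplitting U' V W f) :
    B.proj ≫ f ∈ splittingHom U' V W := by
  rw [FusionBasis.proj, Preadditive.sum_comp]
  refine Submodule.sum_mem _ fun a _ => ?_
  rw [Category.assoc]
  exact (B.dual_isSplitting a).comp (fusionHom_comp_splitting (B.basis a).2 hf)

theorem basis_proj_of_ne (B : ∀ j, FusionBasis (S.M j) V W) {i j : J} (h : i ≠ j)
    (b : (B i).ι) : ((B i).basis b).1 ≫ (B j).proj = 0 := by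
  rw [FusionBasis.proj, Preadditive.comp_sum]
  refine Finset.sum_eq_zero fun a _ => ?_
  rw [← Category.assoc, simple_hom_eq_zero h (fusionHom_comp_splitting ((B i).basis b).2
    ((B j).dual_isSplitting a)), Limits.zero_comp]

include hA hs in
-- The defect is again a splitting and is killed by every basis vertex.
theorem sum_proj_comp (B : ∀ j, FusionBasis (S.M j) V W) {j : J}
    {f : V.X ⊗ W.X ⟶ (S.M j).X} (hf : IsSplitting (S.M j) V W f) (s : Finset J) (hj : j ∈ s) :
    (∑ i ∈ s, (B i).proj) ≫ f = f := by
  have h : f - (∑ i ∈ s, (B i).proj) ≫ f ∈ splittingHom (S.M j) V W := by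
    rw [Preadditive.sum_comp]
    exact Submodule.sub_mem _ hf (Submodule.sum_mem _ fun i _ => (B i).proj_comp_mem hf)
  refine (sub_eq_zero.mp (IsSplitting.eq_zero hA hs B h fun a => ?_)).symm
  rw [Preadditive.comp_sub, ← Category.assoc, Preadditive.comp_sum, Finset.sum_eq_single j,
    FusionBasis.basis_proj, sub_self]
  · intro i _ hij
    exact basis_proj_of_ne B hij.symm a
  · exact fun h => absurd hj h

include hA hs in
theorem relIdem_eq_sum_proj (B : ∀ j, FusionBasis (S.M j) V W) : ∃ s : Finset J,
    relIdem V W = ∑ j ∈ s, (B j).proj := by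
  classical
  -- $J$ carries no finiteness assumption. Asking for stability under enlarging $s$ makes the
  -- property additive, and finitely many charges suffice for each element of the span.
  have key : ∃ s : Finset J, ∀ s' : Finset J, s ⊆ s' →
      (∑ i ∈ s', (B i).proj) ≫ relIdem V W = relIdem V W := by
    refine Submodule.span_induction ?_ ⟨∅, ?_⟩ ?_ ?_ (relIdem_mem_span hA hs S V W)
    · rintro _ ⟨j, p, q, hp, hq, rfl⟩
      refine ⟨{j}, fun s' h => ?_⟩
      rw [← Category.assoc, sum_proj_comp hA hs B hp s' (h (Finset.mem_singleton_self j))]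
    · intro s' _
      exact Limits.comp_zero
    · rintro x y - - ⟨s, hx⟩ ⟨t, hy⟩
      refine ⟨s ∪ t, fun s' h => ?_⟩
      rw [Preadditive.comp_add, hx s' (Finset.union_subset_left h),
        hy s' (Finset.union_subset_right h)]
    · rintro c x - ⟨s, hx⟩
      refine ⟨s, fun s' h => ?_⟩
      rw [Linear.comp_smul, hx s' h]
  obtain ⟨s, h⟩ := key
  refine ⟨s, ?_⟩
  rw [← h s (Finset.Subset.refl s), Preadditive.sum_comp]
  exact Finset.sum_congr rfl fun j _ => (B j).proj_relIdem

include hA hs in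
theorem relIdem_mem_span_basis (B : ∀ j, FusionBasis (S.M j) V W) :
    relIdem V W ∈ Submodule.span ℂ {f : V.X ⊗ W.X ⟶ V.X ⊗ W.X |
      ∃ (j : J) (a : (B j).ι), f = (B j).dual a ≫ ((B j).basis a).1} := by
  obtain ⟨s, h⟩ := relIdem_eq_sum_proj hA hs B
  rw [h]
  exact Submodule.sum_mem _ fun j _ => Submodule.sum_mem _ fun a _ =>
    Submodule.subset_span ⟨j, a, rfl⟩

end Completeness

/-! ### The coherent states span -/

theorem actLeft_tensor {X : C} (r : A ⊗ X ⟶ X) (Y Z : C) :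
    actLeft r (Y ⊗ Z) ≫ (α_ X Y Z).inv = A ◁ (α_ X Y Z).inv ≫ actLeft (actLeft r Y) Z := by
  simp only [actLeft]; monoidal

theorem actLeft_unit {X : C} (r : A ⊗ X ⟶ X) :
    r ≫ (ρ_ X).inv = A ◁ (ρ_ X).inv ≫ actLeft r (𝟙_ C) := by
  simp [actLeft]

theorem pairing_actLeft {X : C} (r s : A ⊗ X ⟶ X) (Y : C) :
    pairing (actLeft r Y) (actLeft s Y) = pairing r s ▷ Y := by
  have h1 : A ◁ actLeft s Y ≫ actLeft r Y =
      A ◁ (α_ A X Y).inv ≫ (α_ A (A ⊗ X) Y).inv ≫ (A ◁ s ≫ r) ▷ Y := by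
    simp only [actLeft]; monoidal
  have h2 : oneL A (X ⊗ Y) ≫ comulL A (X ⊗ Y) ≫ A ◁ (α_ A X Y).inv ≫ (α_ A (A ⊗ X) Y).inv =
      (oneL A X ≫ comulL A X) ▷ Y := by
    simp only [oneL, comulL]; monoidal
  rw [pairing, h1, pairing]
  have h3 := h2 =≫ (A ◁ s ≫ r) ▷ Y
  simpa only [Category.assoc, comp_whiskerRight] using h3

theorem mulL_cofree (hs : IsSymmFrobenius A) {X Y : C} (f : A ⊗ X ⟶ Y) :
    mulL A X ≫ cofree f = A ◁ cofree f ≫ mulL A Y := by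
  rw [cofree, MonoidalCategory.whiskerLeft_comp, Category.assoc, mulL_naturality,
    reassoc_of% (hs.comul_mulL (X := X))]

theorem mulL_creation (hs : IsSymmFrobenius A) (n : ℕ) (V : Fin (n + 1) → Mod C A)
    (k : Fin (n + 1)) (g : algAut A) :
    mulL A _ ≫ creation n V k g = A ◁ creation n V k g ≫ mulL A _ := by
  rw [creation_eq, Linear.comp_smul, mulL_cofree hs, MonoidalLinear.whiskerLeft_smul,
    Linear.smul_comp]

theorem semilinear_average (hs : IsSymmFrobenius A) (g : A ⟶ A) [IsMonHom g] {X : C}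
    (φ : A ⟶ A ⊗ X) :
    μ[A] ≫ Δ[A] ≫ (g ⊗ₘ φ) ≫ mulL A X =
      (g ⊗ₘ (Δ[A] ≫ (g ⊗ₘ φ) ≫ mulL A X)) ≫ mulL A X := by
  have h1 : (α_ A A A).inv ≫ μ[A] ▷ A ≫ (g ⊗ₘ φ) = (g ⊗ₘ (g ⊗ₘ φ)) ≫ mulL A (A ⊗ X) := by
    rw [← mulL_map g φ, mulL, Category.assoc]
  rw [← reassoc_of% hs.frobenius_left, reassoc_of% h1, ← mulL_assoc,
    ← id_tensorHom, ← id_tensorHom, tensorHom_comp_tensorHom_assoc,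
    tensorHom_comp_tensorHom_assoc, Category.id_comp, Category.comp_id, Category.assoc]

/-- Multiplying $\varphi$ by the convolution unit changes nothing; replacing that unit by the
normalized sum over $G$ gives one semilinear part for each $g$. -/
theorem semilinear_decomposition (hA : IsCondensate A) (habs : IsAbsorbing A)
    [Fintype (algAut A)] {X : C} (φ : A ⟶ A ⊗ X) :
    ∑ g : algAut A, (qdim A)⁻¹ • (Δ[A] ≫ (g.1.hom ⊗ₘ φ) ≫ mulL A X) = φ := by
  have h : Δ[A] ≫ ((ε[A] ≫ η[A]) ⊗ₘ φ) ≫ mulL A X = φ := by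
    have h1 : ((ε[A] ≫ η[A]) ⊗ₘ φ) = ε[A] ▷ A ≫ (λ_ A).hom ≫ φ ≫ oneL A (A ⊗ X) := by
      rw [MonoidalCategory.tensorHom_def, comp_whiskerRight, Category.assoc, ← whisker_exchange]
      simp [oneL]
    rw [h1]
    simp [oneL_mulL]
  conv_rhs => rw [← h, ← hA.sum_algAut habs]
  simp only [MonoidalCategory.tensorHom_def, sum_whiskerRight, Preadditive.sum_comp,
    Preadditive.comp_sum, MonoidalLinear.smul_whiskerRight, Linear.smul_comp, Linear.comp_smul]

section Span

variable {J : Type w} {S : SimpleModules A J} {D : CoherentData S}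

theorem cofree_fixed {X Y Z : C} {r : A ⊗ Y ⟶ Y} {s : A ⊗ Z ⟶ Z} {t : Y ⟶ Z}
    (h : r ≫ t = A ◁ t ≫ s) {c : ℂ} {φ : X ⟶ A ⊗ Y} (hφ : φ ≫ (c • cofree r) = φ) :
    (φ ≫ A ◁ t) ≫ (c • cofree s) = φ ≫ A ◁ t := by
  have e : A ◁ t ≫ cofree s = cofree r ≫ A ◁ t := by
    rw [cofree, reassoc_of% (comulL_naturality (A := A) t), ← MonoidalCategory.whiskerLeft_comp,
      ← h, cofree_comp_whiskerLeft, cofree]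
  rw [Category.assoc, Linear.comp_smul, e, ← Linear.smul_comp, ← Category.assoc, hφ]

theorem pairing_fixed {X Y : C} {r s : A ⊗ Y ⟶ Y} {p : Y ⟶ Y}
    (h : cofree r ≫ cofree s = cofree r ≫ A ◁ p) {c : ℂ} {φ : X ⟶ A ⊗ Y}
    (hr : φ ≫ (c • cofree r) = φ) (hs : φ ≫ (c • cofree s) = φ) : φ ≫ A ◁ (c • p) = φ := by
  rw [MonoidalLinear.whiskerLeft_smul]
  have h1 : φ ≫ (c • cofree r) ≫ (c • cofree s) = φ := by rw [reassoc_of% hr, hs]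
  have h2 : φ ≫ (c • cofree r) ≫ (c • A ◁ p) = φ := by
    have h3 : (c • cofree r) ≫ (c • A ◁ p) = (c • cofree r) ≫ (c • cofree s) := by
      rw [Linear.smul_comp, Linear.comp_smul, Linear.smul_comp, Linear.comp_smul, h]
    rw [h3, h1]
  rwa [reassoc_of% hr] at h2

/-- Inserting an endomorphism of `Y` into a morphism `X ⟶ A ⊗ (Y ⊗ Z)`. -/
def insertMid {X Y : C} (Z : C) (φ : X ⟶ A ⊗ (Y ⊗ Z)) {Y' : C} :
    (Y ⟶ Y') →ₗ[ℂ] (X ⟶ A ⊗ (Y' ⊗ Z)) where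
  toFun f := φ ≫ A ◁ f ▷ Z
  map_add' f g := by simp
  map_smul' c f := by simp

/-- Induction on the number of particles, with a spectator $Y$ into which the last particle is
moved. Once the first particles are fused to a charge $U$, the vector is fixed by the actions on $U$
and on the last particle, hence by their relative idempotent, which is then expanded in vertices. -/
theorem FusionTree.mem_span (hA : IsCondensate A) (hs : IsSymmFrobenius A) :
    ∀ (n : ℕ) (V : Fin (n + 1) → J) (X Y : C)
      (φ : X ⟶ A ⊗ (tensorFam n (fun k => (S.M (V k)).X) ⊗ Y))
      (_ : ∀ k, φ ≫ ((qdim A)⁻¹ • cofree (actLeft (actOn n (fun k => S.M (V k)) k) Y)) = φ),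
      φ ∈ Submodule.span ℂ {ψ | ∃ (j : J) (t : FusionTree D n V j),
        ψ = φ ≫ A ◁ (t.bra ≫ t.ket) ▷ Y}
  | 0, V, X, Y, φ, _ => by
    refine Submodule.subset_span ⟨V 0, .leaf V, ?_⟩
    have h : (FusionTree.leaf (D := D) V).bra ≫ (FusionTree.leaf (D := D) V).ket =
        𝟙 (tensorFam 0 fun k => (S.M (V k)).X) := Category.comp_id (𝟙 (S.M (V 0)).X)
    rw [h]
    simp
  | n + 1, V, X, Y, φ, hφ => by
    let T : C := tensorFam n (fun k => (S.M (V k.castSucc)).X)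
    let W := S.M (V (Fin.last (n + 1)))
    let φ' : X ⟶ A ⊗ ((T ⊗ W.X) ⊗ Y) := φ
    have ih := FusionTree.mem_span hA hs n (fun k => V k.castSucc) X (W.X ⊗ Y)
      (φ' ≫ A ◁ (α_ T W.X Y).hom) fun k => by
        refine cofree_fixed ?_ (r := actLeft (actLeft (actOn n (fun k => S.M (V k.castSucc)) k)
          W.X) Y) ?_
        · rw [← cancel_epi (A ◁ (α_ T W.X Y).inv), ← reassoc_of% (actLeft_tensor (A := A))]
          simp
        · have := hφ k.castSucc
          rw [actOn_castSucc] at this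
          exact this
    have h1 := mem_of_mem_span ih (Linear.rightComp ℂ X (A ◁ (α_ T W.X Y).inv))
      (Submodule.span ℂ {ψ | ∃ (j : J) (t : FusionTree D (n + 1) V j),
        ψ = φ ≫ A ◁ (t.bra ≫ t.ket) ▷ Y}) (by
      rintro _ ⟨i, t, rfl⟩
      let bra : T ⟶ (S.M i).X := t.bra
      let ket : (S.M i).X ⟶ T := t.ket
      let χ : X ⟶ A ⊗ (((S.M i).X ⊗ W.X) ⊗ Y) := φ' ≫ A ◁ (bra ▷ W.X) ▷ Y
      have hl : ActionsCommute (actLeft (relAct (S.M i) W) Y)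
          (actLeft (actRight (S.M i).X (act W)) Y) :=
        (actionsCommute_actLeft_actRight (act (S.M i)) (act W)).actLeft Y
      have e1 : χ ≫ ((qdim A)⁻¹ • cofree (actLeft (relAct (S.M i) W) Y)) = χ := by
        -- Any particle of the subtree would serve, since $A$ acts on the charge through each of
        -- them.
        refine cofree_fixed (actLeft_naturality (actLeft_naturality (t.act_bra hs 0))) ?_
        have := hφ (0 : Fin (n + 1)).castSucc
        rw [actOn_castSucc] at this
        exact this
      have e2 : χ ≫ ((qdim A)⁻¹ • cofree (actLeft (actRight (S.M i).X (act W)) Y)) = χ := by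
        refine cofree_fixed (actLeft_naturality (actRight_naturality bra)) ?_
        have := hφ (Fin.last (n + 1))
        rw [actOn_last] at this
        exact this
      have e3 : χ ≫ A ◁ relIdem (S.M i) W ▷ Y = χ := by
        have h3 := hs.cofree_cofree hl (relAct_isAction (S.M i) W).actLeft
        rw [pairing_actLeft] at h3
        have h4 := pairing_fixed h3 e1 e2
        rw [← MonoidalLinear.smul_whiskerRight] at h4
        exact (congrArg (fun e => χ ≫ A ◁ e ▷ Y) (relIdem_eq (S.M i) W)).trans h4
      have h2 := mem_of_mem_span (relIdem_mem_span_basis hA hs fun j => D.vertex j i _)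
        ((insertMid Y χ).comp (Linear.rightComp ℂ _ (ket ▷ W.X)))
        (Submodule.span ℂ {ψ | ∃ (j : J) (t : FusionTree D (n + 1) V j),
          ψ = φ ≫ A ◁ (t.bra ≫ t.ket) ▷ Y}) (by
        rintro _ ⟨j, a, rfl⟩
        refine Submodule.subset_span ⟨j, .node V t j a, ?_⟩
        have h : ∀ {X T W Y U P : C} (φ : X ⟶ A ⊗ ((T ⊗ W) ⊗ Y)) (r : T ⟶ U) (k : U ⟶ T)
            (d : U ⊗ W ⟶ P) (b : P ⟶ U ⊗ W),
            (φ ≫ A ◁ r ▷ W ▷ Y) ≫ A ◁ ((d ≫ b) ≫ k ▷ W) ▷ Y =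
              φ ≫ A ◁ ((r ▷ W ≫ d) ≫ (b ≫ k ▷ W)) ▷ Y := by
          intros; simp
        exact h φ' bra ket _ _)
      have h5 : ∀ {T U W : C} (φ : X ⟶ A ⊗ ((T ⊗ W) ⊗ Y)) (r : T ⟶ U) (k : U ⟶ T)
          (e : U ⊗ W ⟶ U ⊗ W), (φ ≫ A ◁ r ▷ W ▷ Y) ≫ A ◁ e ▷ Y = φ ≫ A ◁ r ▷ W ▷ Y →
          ((φ ≫ A ◁ (α_ T W Y).hom) ≫ A ◁ (r ≫ k) ▷ (W ⊗ Y)) ≫ A ◁ (α_ T W Y).inv =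
            (φ ≫ A ◁ r ▷ W ▷ Y) ≫ A ◁ (e ≫ k ▷ W) ▷ Y := by
        intro T U W φ r k e he
        rw [comp_whiskerRight e, MonoidalCategory.whiskerLeft_comp, ← Category.assoc _ (A ◁ e ▷ Y),
          he]
        simp only [Category.assoc, ← MonoidalCategory.whiskerLeft_comp]
        congr 2
        monoidal
      exact (congrArg (· ∈ _) (h5 φ' bra ket _ e3)).mpr h2)
    have h6 : (φ' ≫ A ◁ (α_ T W.X Y).hom) ≫ A ◁ (α_ T W.X Y).inv = φ := by
      rw [Category.assoc, ← MonoidalCategory.whiskerLeft_comp, Iso.hom_inv_id,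
        MonoidalCategory.whiskerLeft_id]
      exact Category.comp_id φ
    exact (congrArg (· ∈ _) h6).mp h1

theorem FusionBasis.mem_span {U V W : Mod C A} (B : FusionBasis U V W) {f : U.X ⟶ V.X ⊗ W.X}
    (hf : f ∈ fusionHom U V W) : f ∈ Submodule.span ℂ (Set.range fun a => (B.basis a).1) :=
  mem_of_mem_span (B.basis.mem_span ⟨f, hf⟩) (fusionHom U V W).subtype _ (by
    rintro _ ⟨a, rfl⟩
    exact Submodule.subset_span ⟨a, rfl⟩)

theorem mem_span_rootKet (hs : IsSymmFrobenius A) {j : J} {ψ : A ⟶ A ⊗ (S.M j).X}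
    (h1 : ψ ≫ regIdem (S.M j) = ψ) (h2 : μ[A] ≫ ψ = A ◁ ψ ≫ mulL A (S.M j).X) :
    ψ ∈ Submodule.span ℂ (Set.range (rootKet D (j := j))) := by
  have h : ψ ∈ fusionHom (regularMod A) (regularMod A) (S.M j) :=
    ⟨by rw [relIdem_regularMod hs]; exact h1, h2⟩
  exact (D.root j).mem_span h

variable {n : ℕ} {V : Fin (n + 1) → J}

theorem mem_span_ket_of_fixed (hA : IsCondensate A) (hs : IsSymmFrobenius A) (g₀ : algAut A)
    (φ : A ⟶ A ⊗ tensorFam n (fun k => (S.M (V k)).X))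
    (hφ : μ[A] ≫ φ = (g₀.1.hom ⊗ₘ φ) ≫ mulL A _) (h : Fin (n + 1) → algAut A)
    (hh : ∀ k, φ ≫ creation n (fun k => S.M (V k)) k (h k) = φ) :
    φ ∈ Submodule.span ℂ (Set.range fun x : CoherentLabel D n V => x.ket) := by
  have : IsMonHom g₀.1.inv := (g₀⁻¹).2
  -- Forced by the eigenvalue equation $h_k=g_kg_0^{-1}$: after untwisting, every label becomes $1$.
  let g : Fin (n + 1) → algAut A := fun k => h k * g₀
  let V' : Fin (n + 1) → J := fun k => D.source (g k) (V k)
  let T : C := tensorFam n fun k => (S.M (V' k)).X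
  let φ' : A ⟶ A ⊗ T := φ ≫ twistInv D V g₀ g
  have h1 : φ' ≫ twistHom D V g₀ g = φ := by
    rw [Category.assoc, twistInv_twistHom, Category.comp_id]
  have h2 : μ[A] ≫ φ' = A ◁ φ' ≫ mulL A T := by
    have e : mulL A _ ≫ twistInv D V g₀ g = (g₀.1.inv ⊗ₘ twistInv D V g₀ g) ≫ mulL A _ :=
      mulL_map g₀.1.inv _
    rw [reassoc_of% hφ, e, tensorHom_comp_tensorHom_assoc, algAut_hom_inv, id_tensorHom]
  have h3 : ∀ k, φ' ≫ creation n (fun k => S.M (V' k)) k 1 = φ' := by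
    intro k
    have e := creation_twistInv (D := D) (V := V) hA hs g₀ g k (h k)
    have e' : (g k)⁻¹ * h k * g₀ = 1 := by simp [g]
    rw [e'] at e
    rw [Category.assoc]
    refine (congrArg (φ ≫ ·) e.symm).trans ?_
    rw [reassoc_of% (hh k)]
  clear_value φ'
  have h4 := FusionTree.mem_span (D := D) hA hs n V' A (𝟙_ C) (φ' ≫ A ◁ (ρ_ T).inv) (fun k => by
    refine cofree_fixed (r := actOn n (fun k => S.M (V' k)) k) ?_ ?_
    · exact actLeft_unit _
    · rw [← creation_one]
      exact h3 k)
  have h5 := mem_of_mem_span h4 (Linear.rightComp ℂ A (A ◁ (ρ_ T).hom ≫ twistHom D V g₀ g))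
    (Submodule.span ℂ (Set.range fun x : CoherentLabel D n V => x.ket)) (by
    rintro _ ⟨j, t, rfl⟩
    have e1 : (φ' ≫ A ◁ t.bra) ≫ regIdem (S.M j) = φ' ≫ A ◁ t.bra := by
      rw [Category.assoc, ← t.creation_bra hs 0, reassoc_of% (h3 0)]
    have e2 : μ[A] ≫ φ' ≫ A ◁ t.bra = A ◁ (φ' ≫ A ◁ t.bra) ≫ mulL A (S.M j).X := by
      rw [reassoc_of% h2, ← mulL_naturality, MonoidalCategory.whiskerLeft_comp, Category.assoc]
    have e3 := mem_of_mem_span (mem_span_rootKet (D := D) hs e1 e2)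
      (Linear.rightComp ℂ A (A ◁ t.ket ≫ twistHom D V g₀ g))
      (Submodule.span ℂ (Set.range fun x : CoherentLabel D n V => x.ket)) (by
        rintro _ ⟨a, rfl⟩
        exact Submodule.subset_span ⟨⟨g₀, g, j, t, a⟩, rfl⟩)
    have e4 : ∀ {X U Z : C} (φ : A ⟶ A ⊗ X) (r : X ⟶ U) (k : U ⟶ X) (t : A ⊗ X ⟶ Z),
        ((φ ≫ A ◁ (ρ_ X).inv) ≫ A ◁ (r ≫ k) ▷ 𝟙_ C) ≫ A ◁ (ρ_ X).hom ≫ t =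
          (φ ≫ A ◁ r) ≫ A ◁ k ≫ t := by
      intros; simp
    exact (congrArg (· ∈ _) (e4 φ' t.bra t.ket (twistHom D V g₀ g))).mpr e3)
  have h6 : (φ' ≫ A ◁ (ρ_ T).inv) ≫ A ◁ (ρ_ T).hom ≫ twistHom D V g₀ g = φ := by
    rw [← h1]; simp
  exact (congrArg (· ∈ _) h6).mp h5

/-- $m$ bounds the particles not yet diagonalized. Splitting by $\sum_hW_m^h=\mathrm{id}$ keeps
semilinearity, because $W$ is $A$-linear, and keeps the eigenvalues already fixed, because the $W$
commute. -/
theorem mem_span_ket_of_semilinear (hA : IsCondensate A) (habs : IsAbsorbing A) (g₀ : algAut A)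
    (m : ℕ) (φ : A ⟶ A ⊗ tensorFam n (fun k => (S.M (V k)).X))
    (hφ : μ[A] ≫ φ = (g₀.1.hom ⊗ₘ φ) ≫ mulL A _)
    (h : ∀ k : Fin (n + 1), m ≤ k.1 → ∃ h, φ ≫ creation n (fun k => S.M (V k)) k h = φ) :
    φ ∈ Submodule.span ℂ (Set.range fun x : CoherentLabel D n V => x.ket) := by
  have hs := hA.isSymmFrobenius habs
  induction m generalizing φ with
  | zero =>
    choose h hh using fun k => h k (Nat.zero_le _)
    exact mem_span_ket_of_fixed hA hs g₀ φ hφ h hh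
  | succ m ih =>
    by_cases hm : m < n + 1
    · have := hA.finite_algAut hs
      have := Fintype.ofFinite (algAut A)
      have e := sum_creation hA n (fun k => S.M (V k)) ⟨m, hm⟩ habs
      have e' : φ = ∑ g : algAut A, φ ≫ creation n (fun k => S.M (V k)) ⟨m, hm⟩ g := by
        rw [← Preadditive.comp_sum, e, Category.comp_id]
      rw [e']
      refine Submodule.sum_mem _ fun g _ => ih _ ?_ ?_
      · rw [reassoc_of% hφ, mulL_creation hs, ← id_tensorHom, tensorHom_comp_tensorHom_assoc,
          Category.comp_id]
      · intro k hk
        rcases Nat.eq_or_lt_of_le hk with rfl | hk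
        · exact ⟨g, by rw [Category.assoc, creation_idem hA]⟩
        · obtain ⟨h, hh⟩ := h k hk
          exact ⟨h, by rw [Category.assoc, creation_comm n _ _ _ hs, reassoc_of% hh]⟩
    · exact ih φ hφ fun k hk => absurd k.2 (by omega)

theorem span_ket (hA : IsCondensate A) (habs : IsAbsorbing A) :
    Submodule.span ℂ (Set.range fun x : CoherentLabel D n V => x.ket) = ⊤ := by
  have hs := hA.isSymmFrobenius habs
  have := hA.finite_algAut hs
  have := Fintype.ofFinite (algAut A)
  refine Submodule.eq_top_iff'.mpr fun φ => ?_
  have e := semilinear_decomposition hA habs φ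
  rw [← e]
  refine Submodule.sum_mem _ fun g _ => Submodule.smul_mem _ _ ?_
  have : IsMonHom g.1.hom := g.2
  -- For $m=n+1$ no particle is required to be an eigenvector.
  exact mem_span_ket_of_semilinear hA habs g (n + 1) _ (semilinear_average hs g.1.hom φ)
    fun k hk => absurd k.2 (by omega)

end Span

/-- The functionals $\varphi\mapsto\mathrm{tr}(\langle x|\circ\varphi)$ are dual to the states up to
the nonzero factor $\dim A$. -/
theorem linearIndependent_ket {J : Type w} {S : SimpleModules A J} {D : CoherentData S} {n : ℕ}
    {V : Fin (n + 1) → J} (hA : IsCondensate A) (hs : IsSymmFrobenius A) :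
    LinearIndependent ℂ (fun x : CoherentLabel D n V => x.ket) := by
  rw [linearIndependent_iff']
  intro s c hc x hx
  let F : (A ⟶ A ⊗ tensorFam n (fun k => (S.M (V k)).X)) →ₗ[ℂ] ℂ :=
    { toFun := fun φ => qtrace (φ ≫ x.bra)
      map_add' := fun φ ψ => by rw [Preadditive.add_comp, qtrace_add]
      map_smul' := fun c φ => by rw [Linear.smul_comp, qtrace_smul]; rfl }
  have h1 : F (∑ y ∈ s, c y • y.ket) = 0 := by rw [hc, map_zero]
  rw [map_sum, Finset.sum_eq_single x] at h1
  · rw [map_smul, smul_eq_mul] at h1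
    have h2 : F x.ket = qdim A := congrArg qtrace x.ket_bra_self
    rw [h2] at h1
    exact (mul_eq_zero.mp h1).resolve_right hA.qdim_ne_zero
  · intro y _ hxy
    rw [map_smul]
    have h2 : F y.ket = 0 := CoherentLabel.qtrace_ket_bra hA hs x y hxy.symm
    rw [h2, smul_zero]
  · exact fun h => absurd hx h

/-! ### Unitarity -/

namespace UnitaryStructure

variable (H : UnitaryStructure C)

theorem dag_whiskerLeft (X : C) {Y Z : C} (f : Y ⟶ Z) : H.dag (X ◁ f) = X ◁ H.dag f := by
  rw [← id_tensorHom, H.dag_tensor, H.dag_id, id_tensorHom]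

theorem dag_whiskerRight {Y Z : C} (f : Y ⟶ Z) (X : C) : H.dag (f ▷ X) = H.dag f ▷ X := by
  rw [← tensorHom_id, H.dag_tensor, H.dag_id, tensorHom_id]

theorem dag_associator_inv (X Y Z : C) : H.dag (α_ X Y Z).inv = (α_ X Y Z).hom := by
  rw [← H.dag_associator, H.dag_dag]

theorem dag_leftUnitor_inv (X : C) : H.dag (λ_ X).inv = (λ_ X).hom := by
  rw [← H.dag_leftUnitor, H.dag_dag]

theorem dag_sub {X Y : C} (f g : X ⟶ Y) : H.dag (f - g) = H.dag f - H.dag g := by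
  have h := H.dag_smul (-1) g
  rw [neg_one_smul, map_neg, map_one, neg_one_smul] at h
  rw [sub_eq_add_neg, H.dag_add, h, sub_eq_add_neg]

theorem eq_zero_of_comp_dag {X Y : C} {f : X ⟶ Y} (h : f ≫ H.dag f = 0) : f = 0 := by
  by_contra h0
  have := H.qtrace_pos f h0
  rw [h, qtrace_zero] at this
  exact lt_irrefl _ this

theorem dag_crossL (B X Y : C) : H.dag (crossL B X Y) = crossLInv B X Y := by
  rw [crossL, crossLInv, H.dag_comp, H.dag_comp, H.dag_associator_inv, H.dag_whiskerRight,
    H.dag_braiding, H.dag_associator, Category.assoc]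

theorem dag_tensorFamMap : ∀ (n : ℕ) {X Y : Fin (n + 1) → C} (f : ∀ k, X k ⟶ Y k),
    H.dag (tensorFamMap n f) = tensorFamMap n (fun k => H.dag (f k))
  | 0, _, _, _ => rfl
  | n + 1, _, _, _ => (H.dag_tensor _ _).trans (congrArg (· ⊗ₘ _) (dag_tensorFamMap n _))

end UnitaryStructure

/-! ### Coactions and adjoints. -/

/-- The coaction belonging to an action of `A`. -/
def coaction {X : C} (r : A ⊗ X ⟶ X) : X ⟶ A ⊗ X := oneL A X ≫ comulL A X ≫ A ◁ r

theorem whiskerLeft_coaction (hs : IsSymmFrobenius A) {X : C} (r : A ⊗ X ⟶ X) :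
    A ◁ coaction r ≫ mulL A X = cofree r := by
  have h := hs.mul_oneL_comulL (X := X)
  simp only [MonoidalCategory.whiskerLeft_comp, Category.assoc] at h
  simp only [coaction, MonoidalCategory.whiskerLeft_comp, Category.assoc, cofree]
  rw [mulL_naturality, reassoc_of% h]

theorem cofree_counitL {X : C} (r : A ⊗ X ⟶ X) : cofree r ≫ counitL A X = r := by
  rw [cofree, Category.assoc, counitL_naturality, reassoc_of% (comulL_counitL (A := A) (X := X))]

/-- An action is recovered from its coaction with the Frobenius form, so colinear maps are linear.
Adjoints of linear maps are at first only colinear. -/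
theorem action_comp_of_coaction (hs : IsSymmFrobenius A) {X Y : C} {r : A ⊗ X ⟶ X}
    {s : A ⊗ Y ⟶ Y} {t : X ⟶ Y} (h : t ≫ coaction s = coaction r ≫ A ◁ t) :
    r ≫ t = A ◁ t ≫ s := by
  rw [← cofree_counitL s, ← whiskerLeft_coaction hs s, ← cofree_counitL r,
    ← whiskerLeft_coaction hs r, Category.assoc, Category.assoc, Category.assoc,
    ← MonoidalCategory.whiskerLeft_comp_assoc, h, MonoidalCategory.whiskerLeft_comp_assoc,
    reassoc_of% (mulL_naturality (A := A) t), counitL_naturality]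

theorem coaction_actLeft {X : C} (r : A ⊗ X ⟶ X) (Y : C) :
    coaction (actLeft r Y) = coaction r ▷ Y ≫ (α_ A X Y).hom := by
  simp only [coaction, actLeft, oneL, comulL]; monoidal

theorem coaction_actRight {Y : C} (X : C) (r : A ⊗ Y ⟶ Y) :
    coaction (actRight X r) = X ◁ coaction r ≫ crossLInv A X Y := by
  have h := crossL_pairing (A := A) (X := X) (Y := Y) =≫ A ◁ X ◁ r
  simp only [Category.assoc] at h
  rw [coaction, coaction, actRight, MonoidalCategory.whiskerLeft_comp, h,
    ← crossLInv_naturality]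
  simp only [MonoidalCategory.whiskerLeft_comp, Category.assoc]

/-- An action whose adjoint is its coaction. -/
def IsUnitaryAction (H : UnitaryStructure C) {X : C} (r : A ⊗ X ⟶ X) : Prop :=
  H.dag r = coaction r

section Unitary

variable {H : UnitaryStructure C} (hU : IsUnitaryAlgebra H A)

theorem IsUnitaryModule.isUnitaryAction {V : Mod C A} (h : IsUnitaryModule H V) :
    IsUnitaryAction H (act V) := by
  rw [IsUnitaryAction, coaction, ← coact_eq]
  exact h

theorem IsUnitaryAction.actLeft {X : C} {r : A ⊗ X ⟶ X} (h : IsUnitaryAction H r) (Y : C) :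
    IsUnitaryAction H (actLeft r Y) := by
  rw [IsUnitaryAction, coaction_actLeft, Condensate.actLeft, H.dag_comp, H.dag_whiskerRight,
    H.dag_associator_inv, h]

theorem IsUnitaryAction.actRight {Y : C} (X : C) {r : A ⊗ Y ⟶ Y} (h : IsUnitaryAction H r) :
    IsUnitaryAction H (actRight X r) := by
  rw [IsUnitaryAction, coaction_actRight, Condensate.actRight, H.dag_comp, H.dag_whiskerLeft,
    H.dag_crossL, h]

theorem actOn_isUnitaryAction : ∀ (n : ℕ) (V : Fin (n + 1) → Mod C A)
    (_ : ∀ k, IsUnitaryModule H (V k)) (k : Fin (n + 1)), IsUnitaryAction H (actOn n V k)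
  | 0, V, h, k => (h 0).isUnitaryAction
  | n + 1, V, h, k => by
    induction k using Fin.lastCases with
    | last =>
      rw [actOn_last]
      exact (h _).isUnitaryAction.actRight _
    | cast k =>
      rw [actOn_castSucc]
      exact (actOn_isUnitaryAction n _ (fun k => h k.castSucc) k).actLeft _

include hU

theorem IsUnitaryAlgebra.dag_mul : H.dag μ[A] = Δ[A] := hU.1

theorem IsUnitaryAlgebra.dag_comul : H.dag Δ[A] = μ[A] := by rw [← hU.1, H.dag_dag]

theorem IsUnitaryAlgebra.dag_one : H.dag η[A] = ε[A] := hU.2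

theorem IsUnitaryAlgebra.dag_counit : H.dag ε[A] = η[A] := by rw [← hU.2, H.dag_dag]

theorem IsUnitaryAlgebra.dag_oneL (X : C) : H.dag (oneL A X) = counitL A X := by
  rw [oneL, counitL, H.dag_comp, H.dag_whiskerRight, hU.dag_one, H.dag_leftUnitor_inv]

theorem IsUnitaryAlgebra.dag_comulL (X : C) : H.dag (comulL A X) = mulL A X := by
  rw [comulL, mulL, H.dag_comp, H.dag_whiskerRight, hU.dag_comul, H.dag_associator]

theorem IsUnitaryAlgebra.star_qdim (hA : IsCondensate A) : starRingEnd ℂ (qdim A) = qdim A := by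
  have h := congrArg H.dag hA.comul_mul
  rw [H.dag_comp, hU.dag_mul, hU.dag_comul, hA.comul_mul, H.dag_smul, H.dag_id, ← sub_eq_zero,
    ← sub_smul] at h
  exact (sub_eq_zero.mp ((smul_eq_zero.mp h).resolve_right hA.id_ne_zero)).symm

/-- $g^\dagger$ is an algebra endomorphism because $g$ preserves $\Delta$ and $\epsilon$. So
$g^\dagger g$ is one as well; its trace is positive, whereas algebra endomorphisms other than the
identity have trace zero. -/
theorem IsUnitaryAlgebra.dag_algAut (hA : IsCondensate A) (hs : IsSymmFrobenius A)
    (g : algAut A) : H.dag g.1.hom = g.1.inv := by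
  have : IsMonHom g.1.hom := g.2
  have : IsMonHom (H.dag g.1.hom) := by
    constructor
    · have h := congrArg H.dag (hA.counit_of_one g.1.hom (IsMonHom.one_hom g.1.hom))
      rwa [H.dag_comp, hU.dag_counit] at h
    · have h := congrArg H.dag (hA.comul_hom hs g.1.hom)
      rwa [H.dag_comp, H.dag_comp, hU.dag_comul, H.dag_tensor] at h
  have h1 : g.1.hom ≫ H.dag g.1.hom = 𝟙 A := by
    by_contra h
    have h2 : g.1.hom ≠ 0 := fun h0 => hA.id_ne_zero (by
      rw [← algAut_hom_inv g, h0, Limits.zero_comp])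
    have h3 := H.qtrace_pos _ h2
    have h4 : IsMonHom (g.1.hom ≫ H.dag g.1.hom) := inferInstance
    rw [hA.qtrace_eq_zero hs _ h] at h3
    exact lt_irrefl _ h3
  have h5 : g.1.inv ≫ g.1.hom ≫ H.dag g.1.hom = g.1.inv := by
    rw [h1]; exact Category.comp_id g.1.inv
  rwa [reassoc_of% (algAut_inv_hom g)] at h5

/-- The adjoint puts $g^{-1}$ on the left leg of $\Delta(1)$; invariance of $\Delta(1)$ under
$g\otimes g$ turns this into $g$ on the right leg. -/
theorem IsUnitaryAlgebra.dag_cofree (hA : IsCondensate A) (hs : IsSymmFrobenius A)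
    (g : algAut A) {X : C} {r : A ⊗ X ⟶ X} (hr : IsUnitaryAction H r) :
    H.dag (cofree (g.1.hom ▷ X ≫ r)) = cofree (g.1.hom ▷ X ≫ r) := by
  have : IsMonHom g.1.hom := g.2
  have h1 : coaction r ≫ g.1.inv ▷ X = coaction (g.1.hom ▷ X ≫ r) := by
    have e : η[A] ≫ Δ[A] ≫ g.1.inv ▷ A = η[A] ≫ Δ[A] ≫ A ◁ g.1.hom := by
      have e1 : (g.1.hom ⊗ₘ g.1.hom) ≫ g.1.inv ▷ A = A ◁ g.1.hom := by
        rw [← tensorHom_id, tensorHom_comp_tensorHom, algAut_hom_inv, Category.comp_id,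
          id_tensorHom]
      rw [← e1, ← reassoc_of% (hA.comul_hom hs g.1.hom), reassoc_of% (IsMonHom.one_hom g.1.hom)]
    have e2 : oneL A X ≫ comulL A X ≫ g.1.inv ▷ (A ⊗ X) =
        oneL A X ≫ comulL A X ≫ A ◁ g.1.hom ▷ X := by
      have e3 : ∀ f : A ⊗ A ⟶ A ⊗ A, oneL A X ≫ comulL A X ≫ (α_ A A X).inv ≫ f ▷ X =
          (λ_ X).inv ≫ (η[A] ≫ Δ[A] ≫ f) ▷ X := by
        intro f; simp [oneL, comulL]
      have e4 : g.1.inv ▷ (A ⊗ X) = (α_ A A X).inv ≫ (g.1.inv ▷ A) ▷ X ≫ (α_ A A X).hom := by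
        simp
      have e5 : A ◁ g.1.hom ▷ X = (α_ A A X).inv ≫ (A ◁ g.1.hom) ▷ X ≫ (α_ A A X).hom := by
        simp
      have e6 := ((e3 (g.1.inv ▷ A)).trans (by rw [e])).trans (e3 (A ◁ g.1.hom)).symm
      rw [e4, e5]
      simpa only [Category.assoc] using e6 =≫ (α_ A A X).hom
    rw [coaction, coaction, MonoidalCategory.whiskerLeft_comp, Category.assoc, Category.assoc,
      whisker_exchange, reassoc_of% e2]
  rw [cofree, H.dag_comp, hU.dag_comulL, H.dag_whiskerLeft, H.dag_comp, H.dag_whiskerRight,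
    hU.dag_algAut hA hs, hr]
  exact (congrArg (fun f => A ◁ f ≫ mulL A X) h1).trans (whiskerLeft_coaction hs _)

theorem IsUnitaryAlgebra.dag_creation (hA : IsCondensate A) (hs : IsSymmFrobenius A) {n : ℕ}
    {V : Fin (n + 1) → Mod C A} (hV : ∀ k, IsUnitaryModule H (V k)) (k : Fin (n + 1))
    (g : algAut A) : H.dag (creation n V k g) = creation n V k g := by
  rw [creation_eq, H.dag_smul, hU.dag_cofree hA hs g (actOn_isUnitaryAction n V hV k), map_inv₀,
    hU.star_qdim hA]

theorem IsUnitaryAlgebra.dag_pairing (hs : IsSymmFrobenius A) {X : C} {r s : A ⊗ X ⟶ X}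
    (hr : IsUnitaryAction H r) (hs' : IsUnitaryAction H s) (h : ActionsCommute r s) :
    H.dag (pairing r s) = pairing r s := by
  rw [hs.pairing_comm h, pairing, H.dag_comp, H.dag_comp, H.dag_comp, hU.dag_oneL, hU.dag_comulL,
    H.dag_whiskerLeft, hr, hs', Category.assoc, Category.assoc]
  have e := whiskerLeft_coaction hs r
  rw [reassoc_of% e, cofree_counitL, coaction, Category.assoc, Category.assoc, ← pairing,
    hs.pairing_comm h, pairing]

theorem IsUnitaryAlgebra.dag_relIdem (hA : IsCondensate A) (hs : IsSymmFrobenius A)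
    {V W : Mod C A} (hV : IsUnitaryModule H V) (hW : IsUnitaryModule H W) :
    H.dag (relIdem V W) = relIdem V W := by
  have h := hU.dag_pairing hs (hV.isUnitaryAction.actLeft W.X) (hW.isUnitaryAction.actRight V.X)
    (actionsCommute_actLeft_actRight (act V) (act W))
  rw [relIdem_eq, H.dag_smul, map_inv₀, hU.star_qdim hA]
  exact congrArg _ h

theorem IsUnitaryAlgebra.regularMod (hs : IsSymmFrobenius A) :
    IsUnitaryModule H (regularMod A) := by
  have h1 : H.dag μ[A] = oneL A A ≫ comulL A A ≫ A ◁ μ[A] := by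
    have h2 : comulL A A ≫ A ◁ μ[A] = μ[A] ≫ Δ[A] := by
      rw [comulL, Category.assoc, hs.frobenius_right]
    have h3 : oneL A A ≫ μ[A] = 𝟙 A := by simp [oneL]
    rw [h2, reassoc_of% h3, hU.dag_mul]
  rw [IsUnitaryModule, coact_eq]
  exact h1

variable {U V W : Mod C A}

theorem IsUnitaryAlgebra.dag_fusionHom (hA : IsCondensate A) (hs : IsSymmFrobenius A)
    (hW₀ : IsUnitaryModule H U) (hV : IsUnitaryModule H V)
    (hW : IsUnitaryModule H W) {f : U.X ⟶ V.X ⊗ W.X} (hf : f ∈ fusionHom U V W) :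
    IsSplitting U V W (H.dag f) := by
  refine ⟨?_, ?_⟩
  · conv_rhs => rw [← hf.1]
    rw [H.dag_comp, hU.dag_relIdem hA hs hV hW]
  · refine action_comp_of_coaction hs ?_
    have h := congrArg H.dag hf.2
    rw [H.dag_comp, H.dag_comp, H.dag_whiskerLeft, hW₀.isUnitaryAction] at h
    rw [h]
    exact congrArg (· ≫ _) (hV.isUnitaryAction.actLeft W.X)

theorem IsUnitaryAlgebra.dag_splitting (hA : IsCondensate A) (hs : IsSymmFrobenius A)
    (hW₀ : IsUnitaryModule H U) (hV : IsUnitaryModule H V)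
    (hW : IsUnitaryModule H W) {f : V.X ⊗ W.X ⟶ U.X} (hf : IsSplitting U V W f) :
    H.dag f ∈ fusionHom U V W := by
  refine ⟨?_, ?_⟩
  · conv_rhs => rw [← hf.1]
    rw [H.dag_comp, hU.dag_relIdem hA hs hV hW]
  · refine action_comp_of_coaction hs ?_
    have h := congrArg H.dag hf.2
    rw [H.dag_comp, H.dag_comp, H.dag_whiskerLeft, hW₀.isUnitaryAction] at h
    rw [← h]
    exact congrArg (_ ≫ ·) (hV.isUnitaryAction.actLeft W.X).symm

/-- The difference $d$ of the two candidates is a splitting killed by every basis vertex, hence by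
$d^\dagger$, which lies in their span. Positivity of the trace gives $d=0$. -/
theorem IsUnitaryAlgebra.dual_eq (hA : IsCondensate A) (hs : IsSymmFrobenius A)
    (hW₀ : IsUnitaryModule H U) (hV : IsUnitaryModule H V)
    (hW : IsUnitaryModule H W) (B : FusionBasis U V W) (hB : IsOrthonormalVertex H B) (a : B.ι) :
    B.dual a = H.dag (B.basis a).1 := by
  have h1 : B.dual a - H.dag (B.basis a).1 ∈ splittingHom U V W :=
    Submodule.sub_mem _ (B.dual_isSplitting a)
      (hU.dag_fusionHom hA hs hW₀ hV hW (B.basis a).2)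
  have h2 := hU.dag_splitting hA hs hW₀ hV hW h1
  have h3 := fusionHom_comp_eq_zero B (B.dual a - H.dag (B.basis a).1) (fun b => by
    rw [Preadditive.comp_sub]
    by_cases hab : b = a
    · subst hab
      rw [B.basis_dual_self, hB.1, sub_self]
    · rw [B.basis_dual_ne b a hab, hB.2 b a hab, sub_self]) h2
  have h4 : H.dag (B.dual a - H.dag (B.basis a).1) = 0 :=
    H.eq_zero_of_comp_dag (by rw [H.dag_dag]; exact h3)
  have h5 := congrArg H.dag h4
  rw [H.dag_dag] at h5
  have h6 := H.dag_sub (0 : U.X ⟶ V.X ⊗ W.X) 0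
  rw [sub_self, sub_self] at h6
  rw [h6] at h5
  exact sub_eq_zero.mp h5

variable {J : Type w} {S : SimpleModules A J} {D : CoherentData S}

theorem FusionTree.bra_eq (hA : IsCondensate A) (hs : IsSymmFrobenius A)
    (hD : IsUnitaryData H D) {n : ℕ} {V : Fin (n + 1) → J} {j : J} (t : FusionTree D n V j) :
    t.bra = H.dag t.ket := by
  induction t with
  | leaf V => exact (H.dag_id _).symm
  | @node _ V i t j a ih =>
    have h := hU.dual_eq hA hs (hD.modules _) (hD.modules _) (hD.modules _) (D.vertex j i _)
      (hD.vertex _ _ _) a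
    have e : ∀ {X U T W : C} (b : X ⟶ U ⊗ W) (k : U ⟶ T),
        H.dag (b ≫ k ▷ W) = H.dag k ▷ W ≫ H.dag b := by
      intro X U T W b k
      rw [H.dag_comp, H.dag_whiskerRight]
    refine Eq.trans ?_ (e _ _).symm
    rw [← ih, ← h]
    rfl

theorem CoherentLabel.bra_eq_dag (hA : IsCondensate A) (hs : IsSymmFrobenius A)
    (hD : IsUnitaryData H D) {n : ℕ} {V : Fin (n + 1) → J} (x : CoherentLabel D n V) :
    x.bra = H.dag x.ket := by
  have h1 : rootBra D x.root = H.dag (rootKet D x.root) :=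
    hU.dual_eq hA hs (hU.regularMod hs) (hU.regularMod hs) (hD.modules _) (D.root x.charge)
      (hD.root _) x.root
  have h2 : twistInv D V x.g₀ x.g = H.dag (twistHom D V x.g₀ x.g) := by
    rw [twistInv, twistHom]
    refine Eq.trans ?_ (H.dag_tensor _ _).symm
    rw [hU.dag_algAut hA hs, H.dag_tensorFamMap]
    simp only [hD.u]
  rw [x.bra_eq, h1, h2, FusionTree.bra_eq hU hA hs hD, x.ket_eq, H.dag_comp, H.dag_comp,
    H.dag_whiskerLeft, Category.assoc]

end Unitary

end Modular
end
end Condensate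

/-! ### Assembly of the statements. -/

theorem mainTheorem6 {C : Type u} [Category.{v} C] [Abelian C] [Linear ℂ C]
    [MonoidalCategory C] [MonoidalPreadditive C] [MonoidalLinear ℂ C] [BraidedCategory C]
    [RigidCategory C] [Condensate.RibbonCategory C] [Condensate.ModularCategory C]
    (A : C) [MonObj A] [ComonObj A] (hA : Condensate.IsCondensate A)
    (habs : Condensate.IsAbsorbing A) :
    -- the operators `W_k^g`
    Finite (Condensate.algAut A) ∧
    (∀ (n : ℕ) (V : Fin (n + 1) → Mod C A),
      (∀ k g, Condensate.creation n V k g ≫ Condensate.creation n V k g =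
        Condensate.creation n V k g) ∧
      (∀ k g h, g ≠ h → Condensate.creation n V k h ≫ Condensate.creation n V k g = 0) ∧
      (∀ k, ∑ᶠ g : Condensate.algAut A, Condensate.creation n V k g = 𝟙 _) ∧
      (∀ k l g h, Condensate.creation n V k g ≫ Condensate.creation n V l h =
        Condensate.creation n V l h ≫ Condensate.creation n V k g) ∧
      (∀ H : Condensate.UnitaryStructure C, Condensate.IsUnitaryAlgebra H A →
        (∀ k, Condensate.IsUnitaryModule H (V k)) →
        ∀ k g, H.dag (Condensate.creation n V k g) = Condensate.creation n V k g)) ∧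
    -- the coherent states
    ∀ {J : Type w} (S : Condensate.SimpleModules A J),
      (∀ (g : Condensate.algAut A) (j : J),
        (∃! i : J, ∃ f : (S.M i).X ≅ (S.M j).X,
          Condensate.IsEquivariant g (S.M i) (S.M j) f.hom) ∧
        ∀ (i : J) (f f' : (S.M i).X ≅ (S.M j).X),
          Condensate.IsEquivariant g (S.M i) (S.M j) f.hom →
          Condensate.IsEquivariant g (S.M i) (S.M j) f'.hom →
          ∃ c : ℂ, c ≠ 0 ∧ f'.hom = c • f.hom) ∧
      ∀ (D : Condensate.CoherentData S) (n : ℕ) (V : Fin (n + 1) → J),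
        -- simultaneous eigenvectors
        (∀ (x : Condensate.CoherentLabel D n V) (k : Fin (n + 1)),
          x.ket ≫ Condensate.creation n (fun k => S.M (V k)) k (x.g k * x.g₀⁻¹) = x.ket ∧
          ∀ h : Condensate.algAut A, h ≠ x.g k * x.g₀⁻¹ →
            x.ket ≫ Condensate.creation n (fun k => S.M (V k)) k h = 0) ∧
        -- basis of `Hom_C(A, A ⊗ V₁ ⊗ … ⊗ V_N)`
        LinearIndependent ℂ (fun x : Condensate.CoherentLabel D n V => x.ket) ∧
        Submodule.span ℂ (Set.range fun x : Condensate.CoherentLabel D n V => x.ket) = ⊤ ∧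
        -- orthonormality with respect to the dual states
        (∀ x : Condensate.CoherentLabel D n V,
          (Condensate.qdim A)⁻¹ * Condensate.qtrace (x.ket ≫ x.bra) = 1) ∧
        (∀ x y : Condensate.CoherentLabel D n V, x ≠ y →
          (Condensate.qdim A)⁻¹ * Condensate.qtrace (y.ket ≫ x.bra) = 0) ∧
        -- orthonormality with respect to the inner product of a unitary structure
        ∀ H : Condensate.UnitaryStructure C, Condensate.IsUnitaryAlgebra H A →
          Condensate.IsUnitaryData H D →
          (∀ x : Condensate.CoherentLabel D n V, Condensate.homInner H x.ket x.ket = 1) ∧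
          ∀ x y : Condensate.CoherentLabel D n V, x ≠ y →
            Condensate.homInner H x.ket y.ket = 0 := by
  have hs := hA.isSymmFrobenius habs
  have hfin := hA.finite_algAut hs
  have := Fintype.ofFinite (Condensate.algAut A)
  refine ⟨hfin, fun n V => ⟨fun k g => Condensate.creation_idem hA n V k g,
    fun k g h hgh => Condensate.creation_comp_of_ne hA n V k hs hgh, fun k => ?_,
    fun k l g h => Condensate.creation_comm n V k l hs g h,
    fun H hU hV k g => hU.dag_creation hA hs hV k g⟩,
    fun S => ⟨fun g j => ⟨S.existsUnique_source g j,
      fun i f f' hf hf' => S.equivariant_unique g i j f f' hf hf'⟩,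
    fun D n V => ⟨fun x k => ⟨x.ket_creation_self hA hs k,
      fun h hh => x.ket_creation_of_ne hA hs k hh⟩,
    Condensate.linearIndependent_ket hA hs, Condensate.span_ket hA habs, fun x => ?_,
    fun x y hxy => ?_, fun H hU hD => ⟨fun x => ?_, fun x y hxy => ?_⟩⟩⟩⟩
  -- `finsum` defaults to zero on infinite support; finiteness of $G$ makes it the genuine sum.
  · rw [finsum_eq_sum_of_fintype]
    exact Condensate.sum_creation hA n V k habs
  · rw [x.ket_bra_self]
    exact inv_mul_cancel₀ hA.qdim_ne_zero
  · rw [Condensate.CoherentLabel.qtrace_ket_bra hA hs x y hxy, mul_zero]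
  · rw [Condensate.homInner, ← Condensate.CoherentLabel.bra_eq_dag hU hA hs hD x, x.ket_bra_self]
    exact inv_mul_cancel₀ hA.qdim_ne_zero
  · rw [Condensate.homInner, ← Condensate.CoherentLabel.bra_eq_dag hU hA hs hD x,
      Condensate.CoherentLabel.qtrace_ket_bra hA hs x y hxy, mul_zero]
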